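/- **Setting.** Let $M$ be a finite-dimensional smooth manifold (Hausdorff, second countable, without boundary), and let $\mathcal V$ be a regular foliation of $M$ of rank $k$ with tangent bundle $\mathbb V=T\mathcal V\subset TM$ and annihilator $\mathbb V^0\subset T^*M$. Let $P\in\Gamma(\wedge^2\mathbb V)$ be a leaf-tangent Poisson bivector field, with $P^\sharp$ normalised by $\langle\beta,P^\sharp\alpha\rangle=P(\alpha,\beta)$. Let $\mathrm{Poiss}(M,P)=\{X\in\Gamma(TM): L_XP=0\}$, $\mathrm{Ham}(M,P)=\{P^\sharp \mathrm df: f\in C^\infty(M)\}$, $\mathrm{Poiss}_{\mathcal V}(M,P)=\Gamma(\mathbb V)\cap\mathrm{Poiss}(M,P)$ and $H^1_P(M)=\mathrm{Poiss}(M,P)/\mathrm{Ham}(M,P)$. The quotient $\mathrm{Poiss}_{\mathcal V}(M,P)/\mathrm{Ham}(M,P)$ is regarded as a subspace of $H^1_P(M)$. Let $H^1_{\mathrm{dR}}(\mathcal V)$ be the first cohomology of the foliated de Rham complex $(\Gamma(\wedge^\bullet\mathbb V^*),\mathrm d_{\mathcal V})$, and let $(P^\sharp)^*:H^1_{\mathrm{dR}}(\mathcal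 V)\to\mathrm{Poiss}_{\mathcal V}(M,P)/\mathrm{Ham}(M,P)$ be the map $[\mu]\mapsto[P^\sharp\mu]$. * For a volume form $\Omega$ on $M$, the modular vector field $Z_P^\Omega$ is defined by $L_{P^\sharp \mathrm df}\,\Omega=Z_P^\Omega(f)\,\Omega$ for all $f\in C^\infty(M)$, and $\mathrm{Mod}(M,P)=[Z_P^\Omega]\in H^1_P(M)$. * For a leaf-wise volume form $\tau$ (a nowhere vanishing section of $\wedge^{k}\mathbb V^*$), the foliated modular vector field $Z_P^\tau\in\Gamma(\mathbb V)$ is defined by $\mathbf i_{Z_P^\tau}\tau=-\mathrm d_{\mathcal V}\mathbf i_P\tau$, where $\mathbf i_{X\wedge Y}=\mathbf i_X\circ\mathbf i_Y$, and $\mathrm{Mod}(M,\mathcal V,P)=[Z_P^\tau]\in\mathrm{Poiss}_{\mathcal V}(M,P)/\mathrm{Ham}(M,P)$. * For a transversal volume element $\varsigma$ (a nowhere vanishing section of $\wedge^{s}\mathbb V^0$, $s=\operatorname{codim}\mathcal V$), the foliated 1-form $\lambda_\varsigma\in\Gamma(\mathbb V^*)$ is defined by $L_X\varsigma=\lambda_\varsigma(X)\varsigma$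 for $X\in\Gamma(\mathbb V)$, and the Reeb class is $\mathrm{Mod}(\mathcal V)=[\lambda_\varsigma]\in H^1_{\mathrm{dR}}(\mathcal V)$. * A connection form is a smooth projection $\gamma:TM\to\mathbb V$ onto $\mathbb V$, with kernel $\mathbb H$. Put $\tau_\gamma=\tau\circ\gamma$. Let $\mathrm d_{0,1}^\gamma$ be the component of bidegree $(0,1)$ of $\mathrm d$ for the bigrading of forms induced by $TM=\mathbb H\oplus\mathbb V$. The 1-form $\lambda_\varsigma^\gamma$ vanishing on $\mathbb H$ is defined by $\mathrm d^\gamma_{0,1}\varsigma=\lambda_\varsigma^\gamma\wedge\varsigma$. **Proposition.** Suppose that $\mathcal V$ is orientable (a leaf-wise volume form exists) and transversally orientable (a transversal volume element exists). Then the classes $\mathrm{Mod}(M,P)$, $\mathrm{Mod}(M,\mathcal V,P)$ and $\mathrm{Mod}(\mathcal V)$ are well defined, that is, the representatives above exist, are Poisson vector fields (respectively a closed foliated 1-form), and their classes do not depend on the choice of $\Omega$, $\tau$ and $\varsigma$, and $$\mathrm{Mod}(M,P)=\mathrm{Mod}(M,\mathcal V,P)-(P^\sharp)^*\,\mathrm{Mod}(\mathcal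 V).$$ At the level of vector fields, let $\gamma$ be any connection form, $\tau$ any leaf-wise volume form and $\varsigma$ any transversal volume element. Then $\Omega:=\varsigma\wedge\tau_\gamma$ is a volume form on $M$, the vector fields $Z_P^\Omega$ and $Z_P^\tau$ and the 1-form $\lambda_\varsigma^\gamma$ exist and are unique, and $$Z_P^\Omega=Z_P^\tau-P^\sharp\lambda_\varsigma^\gamma .$$ -/

import Mathlib

open scoped ContDiff Manifold Topology

set_option linter.unusedSectionVars false

namespace FoliatedPoisson

/-! ## Linear algebra of bivectors -/

section Bivectors

variable {V W : Type*} [AddCommGroup V] [Module ℝ V] [AddCommGroup W] [Module ℝ W]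

/-- The decomposable bivector `X ∧ Y`. -/
noncomputable def wedgeVec (X Y : V) : ⋀[ℝ]^2 V := exteriorPower.ιMulti ℝ 2 ![X, Y]

/-- The linear map on bivectors with `X ∧ Y ↦ B X Y`, for an alternating bilinear map `B`. -/
noncomputable def bivectorLift (B : V →ₗ[ℝ] V →ₗ[ℝ] W) (hB : ∀ X, B X X = 0) :
    ⋀[ℝ]^2 V →ₗ[ℝ] W :=
  exteriorPower.alternatingMapLinearEquiv
    { toFun := fun v => B (v 0) (v 1)
      map_update_add' := by
        intro dec m i x y
        obtain rfl : dec = instDecidableEqFin 2 := Subsingleton.elim _ _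
        fin_cases i <;> simp
      map_update_smul' := by
        intro dec m i c x
        obtain rfl : dec = instDecidableEqFin 2 := Subsingleton.elim _ _
        fin_cases i <;> simp
      map_eq_zero_of_eq' := by
        intro v i j h hij
        fin_cases i <;> fin_cases j <;> simp_all }

theorem bivectorLift_wedgeVec (B : V →ₗ[ℝ] V →ₗ[ℝ] W) (hB : ∀ X, B X X = 0) (X Y : V) :
    bivectorLift B hB (wedgeVec X Y) = B X Y := by
  simp [bivectorLift, wedgeVec]

theorem bivector_hom_ext {f g : ⋀[ℝ]^2 V →ₗ[ℝ] W}
    (h : ∀ X Y, f (wedgeVec X Y) = g (wedgeVec X Y)) : f = g := by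
  apply exteriorPower.linearMap_ext
  ext v
  have hv : v = ![v 0, v 1] := by ext i; fin_cases i <;> rfl
  have := h (v 0) (v 1)
  unfold wedgeVec at this
  rw [← hv] at this
  exact this

/-- The map `P ↦ P^♯`, normalised by `⟨β, P^♯ α⟩ = P(α, β)`; thus
`(X ∧ Y)^♯ α = α(X) Y - α(Y) X`. -/
noncomputable def sharp : ⋀[ℝ]^2 V →ₗ[ℝ] Module.Dual ℝ V →ₗ[ℝ] V :=
  bivectorLift
    (LinearMap.mk₂ ℝ
      (fun X Y => (LinearMap.applyₗ X : Module.Dual ℝ V →ₗ[ℝ] ℝ).smulRight Y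
        - (LinearMap.applyₗ Y : Module.Dual ℝ V →ₗ[ℝ] ℝ).smulRight X)
      (by intros; ext; simp; module) (by intros; ext; simp; module)
      (by intros; ext; simp; module) (by intros; ext; simp; module))
    (by intro X; simp)

theorem sharp_wedgeVec (X Y : V) (α : Module.Dual ℝ V) :
    sharp (wedgeVec X Y) α = α X • Y - α Y • X := by
  simp [sharp, bivectorLift_wedgeVec]

/-- The insertion `i_P` of a bivector into a form of degree `n + 2`, with
`i_{X ∧ Y} = i_X ∘ i_Y`. -/
noncomputable def contractTwo {n : ℕ} (η : V [⋀^Fin (n + 2)]→ₗ[ℝ] ℝ) :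
    ⋀[ℝ]^2 V →ₗ[ℝ] V [⋀^Fin n]→ₗ[ℝ] ℝ :=
  bivectorLift
    (LinearMap.mk₂ ℝ (fun X Y => (η.curryLeft Y).curryLeft X)
      (by intros; simp) (by intros; simp) (by intros; simp) (by intros; simp))
    (by intro X; simp)

end Bivectors

/-! ## Vector fields and functions on a manifold -/

section Calculus

variable {E : Type*} [NormedAddCommGroup E] [NormedSpace ℝ E]
  {M : Type*} [TopologicalSpace M] [ChartedSpace E M]

/-- A real function on `M` is smooth. The model space `E` is explicit. -/
def SmoothFun (E : Type*) [NormedAddCommGroup E] [NormedSpace ℝ E]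
    {M : Type*} [TopologicalSpace M] [ChartedSpace E M] (f : M → ℝ) : Prop :=
  ContMDiff 𝓘(ℝ, E) 𝓘(ℝ, ℝ) ∞ f

/-- Set-theoretic vector fields; smoothness is the predicate `SmoothField`. -/
abbrev VField (E : Type*) [NormedAddCommGroup E] [NormedSpace ℝ E]
    (M : Type*) [TopologicalSpace M] [ChartedSpace E M] : Type _ :=
  Π x : M, TangentSpace 𝓘(ℝ, E) x

def SmoothField [IsManifold 𝓘(ℝ, E) ∞ M] (X : VField E M) : Prop :=
  ContMDiff 𝓘(ℝ, E) 𝓘(ℝ, E).tangent ∞ (fun x => (⟨x, X x⟩ : TangentBundle 𝓘(ℝ, E) M))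

/-- The differential `d f` as a family of covectors. -/
noncomputable def dif (f : M → ℝ) (x : M) : Module.Dual ℝ (TangentSpace 𝓘(ℝ, E) x) :=
  (mvfderiv 𝓘(ℝ, E) f x).toLinearMap

/-- `X f`, the derivative of the function `f` along `X`. -/
noncomputable def act (X : VField E M) (f : M → ℝ) (x : M) : ℝ := dif f x (X x)

/-- The Lie bracket of vector fields. -/
noncomputable def br (X Y : VField E M) : VField E M := VectorField.mlieBracket 𝓘(ℝ, E) X Y

theorem dif_add {f g : M → ℝ} (hf : SmoothFun E f) (hg : SmoothFun E g) (x : M) :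
    dif (E := E) (f + g) x = dif f x + dif g x := by
  unfold dif
  rw [mvfderiv_add (hf.mdifferentiable (by simp) x) (hg.mdifferentiable (by simp) x)]
  rfl

theorem dif_smul {f : M → ℝ} (hf : SmoothFun E f) (c : ℝ) (x : M) :
    dif (E := E) (c • f) x = c • dif f x := by
  unfold dif
  have := mvfderiv_smul (I := 𝓘(ℝ, E)) (x := x) (a := fun _ : M => c)
    mdifferentiableAt_const (hf.mdifferentiable (by simp) x)
  have e : (c • f : M → ℝ) = (fun _ : M => c) • f := rfl
  rw [e, this]
  ext v
  simp [mvfderiv_const]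

variable [IsManifold 𝓘(ℝ, E) ∞ M]

theorem act_smooth {X : VField E M} {f : M → ℝ} (hX : SmoothField X) (hf : SmoothFun E f) :
    SmoothFun E (act X f) := by
  have h1 := (ContMDiff.contMDiff_tangentMap (m := ∞) hf (by simp)).comp hX
  have h2 := (contMDiff_tangentBundleModelSpaceHomeomorph (I := 𝓘(ℝ, ℝ)) (n := ∞)).comp h1
  have h3 : @ContMDiff ℝ _ (ℝ × ℝ) _ _ (ModelProd ℝ ℝ) _ (𝓘(ℝ, ℝ).prod 𝓘(ℝ, ℝ)) (ModelProd ℝ ℝ) _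
      (chartedSpaceSelf (ModelProd ℝ ℝ)) ℝ _ _ ℝ _ 𝓘(ℝ, ℝ) ℝ _ _ ∞ (Prod.snd : ℝ × ℝ → ℝ) := by
    have := contMDiff_snd (I := 𝓘(ℝ, ℝ)) (J := 𝓘(ℝ, ℝ)) (M := ℝ) (N := ℝ) (n := ∞)
    rw [chartedSpaceSelf_prod] at this
    exact this
  exact h3.comp h2

theorem br_smooth [CompleteSpace E] {X Y : VField E M} (hX : SmoothField X) (hY : SmoothField Y) :
    SmoothField (br X Y) := by
  have : IsManifold 𝓘(ℝ, E) (minSmoothness ℝ 2) M := by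
    rw [minSmoothness_of_isRCLikeNormedField]
    exact IsManifold.of_le (n := ∞) ENat.LEInfty.out
  have : IsManifold 𝓘(ℝ, E) (((⊤ : ℕ∞) : WithTop ℕ∞) + 1) M := IsManifold.of_le (n := ∞) (mod_cast le_top)
  exact ContDiff.mlieBracket_vectorField (n := ⊤) hX hY
    (by rw [minSmoothness_of_isRCLikeNormedField]; simp)

theorem act_br [CompleteSpace E] {X Y : VField E M} (hX : SmoothField X) (hY : SmoothField Y)
    {f : M → ℝ} (hf : SmoothFun E f) (x : M) :
    act (br X Y) f x = act X (act Y f) x - act Y (act X f) x := by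
  by_cases hE : ∀ v : TangentSpace 𝓘(ℝ, E) x, v = 0
  · simp only [act]
    rw [hE (br X Y x), hE (X x), hE (Y x)]
    simp
  push Not at hE
  obtain ⟨v, hv⟩ := hE
  have : IsManifold 𝓘(ℝ, E) (minSmoothness ℝ 3) M := by
    rw [minSmoothness_of_isRCLikeNormedField]
    exact IsManifold.of_le (n := ∞) ENat.LEInfty.out
  obtain ⟨s, hs, hZ⟩ := FiberBundle.exists_contMDiffOn_extend (k := ∞) 𝓘(ℝ, E) E v
  set Z : VField E M := FiberBundle.extend E v with hZdef
  have hZx : Z x = v := by simp [Z]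
  have hZat : ∀ᶠ y in 𝓝 x, ContMDiffAt 𝓘(ℝ, E) 𝓘(ℝ, E).tangent ∞
      (fun y => (⟨y, Z y⟩ : TangentBundle 𝓘(ℝ, E) M)) y := by
    filter_upwards [eventually_mem_nhds_iff.mpr hs] with y hy using hZ.contMDiffAt hy
  have hmZ : ∀ᶠ y in 𝓝 x, MDifferentiableAt 𝓘(ℝ, E) 𝓘(ℝ, E).tangent
      (fun y => (⟨y, Z y⟩ : TangentBundle 𝓘(ℝ, E) M)) y := by
    filter_upwards [hZat] with y hy using hy.mdifferentiableAt (by simp)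
  have key : ∀ (U : VField E M) (hU : SmoothField U) (g : M → ℝ), SmoothFun E g → ∀ᶠ y in 𝓝 x,
      br U (g • Z) y = (act U g • Z + g • br U Z) y := by
    intro U hU g hg
    filter_upwards [hmZ] with y hy
    exact VectorField.mlieBracket_smul_right (hg.mdifferentiable (by simp) y) hy
  have hfZ : ContMDiffAt 𝓘(ℝ, E) 𝓘(ℝ, E).tangent ∞
      (fun y => (⟨y, (f • Z) y⟩ : TangentBundle 𝓘(ℝ, E) M)) x :=
    ContMDiffAt.smul_section (hf x) hZat.self_of_nhds
  have hbr : ∀ (U : VField E M) (hU : SmoothField U), MDifferentiableAt 𝓘(ℝ, E) 𝓘(ℝ, E).tangent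
      (fun y => (⟨y, (br U Z) y⟩ : TangentBundle 𝓘(ℝ, E) M)) x := by
    intro U hU
    have : IsManifold 𝓘(ℝ, E) (minSmoothness ℝ 2) M := by
      rw [minSmoothness_of_isRCLikeNormedField]
      exact IsManifold.of_le (n := ∞) ENat.LEInfty.out
    have : IsManifold 𝓘(ℝ, E) (((⊤ : ℕ∞) : WithTop ℕ∞) + 1) M :=
      IsManifold.of_le (n := ∞) (mod_cast le_top)
    have := ContMDiffAt.mlieBracket_vectorField (n := ⊤) (m := ⊤) (hU x) hZat.self_of_nhds
      (by rw [minSmoothness_of_isRCLikeNormedField]; exact mod_cast le_top)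
    exact this.mdifferentiableAt (by simp)
  have second : ∀ (U V : VField E M) (hU : SmoothField U) (hV : SmoothField V),
      br U (br V (f • Z)) x = act U (act V f) x • v + act V f x • br U Z x
        + act U f x • br V Z x + f x • br U (br V Z) x := by
    intro U V hU hV
    have e1 : br U (br V (f • Z)) x = br U (act V f • Z + f • br V Z) x :=
      Filter.EventuallyEq.mlieBracket_vectorField_eq (Filter.EventuallyEq.refl _ _) (key V hV f hf)
    rw [e1]
    have hs1 := act_smooth hV hf
    have e2 : br U (act V f • Z + f • br V Z) x = br U (act V f • Z) x + br U (f • br V Z) x := by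
      refine VectorField.mlieBracket_add_right ?_ ?_
      · exact (ContMDiffAt.smul_section (hs1 x) hZat.self_of_nhds).mdifferentiableAt (by simp)
      · exact MDifferentiableAt.smul_section (hf.mdifferentiable (by simp) x) (hbr V hV)
    have e3 : br U (f • br V Z) x = (act U f • br V Z + f • br U (br V Z)) x :=
      VectorField.mlieBracket_smul_right (hf.mdifferentiable (by simp) x) (hbr V hV)
    rw [e2, (key U hU _ hs1).self_of_nhds, e3]
    simp only [Pi.add_apply, Pi.smul_apply', hZx]
    module
  have hle : minSmoothness ℝ 2 ≤ ((⊤ : ℕ∞) : WithTop ℕ∞) := by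
    rw [minSmoothness_of_isRCLikeNormedField]; exact ENat.LEInfty.out
  have J1 := VectorField.leibniz_identity_mlieBracket_apply (I := 𝓘(ℝ, E))
    ((hX x).of_le hle) ((hY x).of_le hle) (hfZ.of_le hle)
  have J2 := VectorField.leibniz_identity_mlieBracket_apply (I := 𝓘(ℝ, E))
    ((hX x).of_le hle) ((hY x).of_le hle) (hZat.self_of_nhds.of_le hle)
  change br X (br Y (f • Z)) x = br (br X Y) (f • Z) x + br Y (br X (f • Z)) x at J1
  change br X (br Y Z) x = br (br X Y) Z x + br Y (br X Z) x at J2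
  rw [second X Y hX hY, second Y X hY hX, (key _ (br_smooth hX hY) f hf).self_of_nhds] at J1
  simp only [Pi.add_apply, Pi.smul_apply', hZx] at J1
  rw [J2] at J1
  have : (act (br X Y) f x - (act X (act Y f) x - act Y (act X f) x)) • v = 0 := by
    have h0 := sub_eq_zero.mpr J1
    rw [← neg_eq_zero, ← h0]
    module
  rcases smul_eq_zero.mp this with h | h
  · linarith
  · exact absurd h hv

theorem exists_dif [FiniteDimensional ℝ E] [T2Space M] (x : M) (v : TangentSpace 𝓘(ℝ, E) x)
    (hv : v ≠ 0) : ∃ f : M → ℝ, SmoothFun E f ∧ dif f x v ≠ 0 := by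
  have : IsManifold 𝓘(ℝ, E) 1 M := IsManifold.of_le (n := ∞) (mod_cast le_top)
  have hx : x ∈ (extChartAt 𝓘(ℝ, E) x).source := mem_extChartAt_source x
  set L : TangentSpace 𝓘(ℝ, E) x →L[ℝ] E :=
    mfderiv 𝓘(ℝ, E) 𝓘(ℝ, E) (extChartAt 𝓘(ℝ, E) x) x with hL
  have hLv : L v ≠ 0 := by
    obtain ⟨e, he⟩ := isInvertible_mfderiv_extChartAt (I := 𝓘(ℝ, E)) hx
    intro h
    apply hv
    apply e.injective
    rw [map_zero]
    refine Eq.trans ?_ h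
    rw [hL, ← he]
    rfl
  obtain ⟨l, -, hl⟩ := exists_dual_vector ℝ (L v) (norm_ne_zero_iff.mpr hLv)
  let b : SmoothBumpFunction 𝓘(ℝ, E) x := Classical.arbitrary _
  refine ⟨fun y => b y • l (extChartAt 𝓘(ℝ, E) x y), ?_, ?_⟩
  · apply b.contMDiff_smul
    exact l.contMDiff.comp_contMDiffOn contMDiffOn_extChartAt
  · have he : (fun y => b y • l (extChartAt 𝓘(ℝ, E) x y)) =ᶠ[𝓝 x]
        (l ∘ extChartAt 𝓘(ℝ, E) x) := by
      filter_upwards [b.eventuallyEq_one] with y hy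
      simp [hy]
    have hd := he.mfderiv_eq (I := 𝓘(ℝ, E)) (I' := 𝓘(ℝ, ℝ))
    have hc := mfderiv_comp x (I := 𝓘(ℝ, E)) (I' := 𝓘(ℝ, E)) (I'' := 𝓘(ℝ, ℝ)) (g := l)
      (l.mdifferentiableAt) (mdifferentiableAt_extChartAt (I := 𝓘(ℝ, E)) (mem_chart_source E x))
    have : dif (fun y => b y • l (extChartAt 𝓘(ℝ, E) x y)) x v = l (L v) := by
      change mfderiv 𝓘(ℝ, E) 𝓘(ℝ, ℝ) _ x v = _
      rw [hd, hc, ContinuousLinearMap.mfderiv_eq]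
      rfl
    rw [this, hl]
    simpa using hLv

end Calculus

/-! ## Differential forms, Lie derivative, exterior derivative -/

section Forms

variable {E : Type*} [NormedAddCommGroup E] [NormedSpace ℝ E]
  {M : Type*} [TopologicalSpace M] [ChartedSpace E M]

/-- Set-theoretic differential forms of degree `n` on `M`. -/
abbrev Form (E : Type*) [NormedAddCommGroup E] [NormedSpace ℝ E]
    (M : Type*) [TopologicalSpace M] [ChartedSpace E M] (n : ℕ) : Type _ :=
  Π x : M, (TangentSpace 𝓘(ℝ, E) x) [⋀^Fin n]→ₗ[ℝ] ℝ

/-- A form is smooth if its value on smooth vector fields is a smooth function. -/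
def SmoothForm [IsManifold 𝓘(ℝ, E) ∞ M] {n : ℕ} (η : Form E M n) : Prop :=
  ∀ Y : Fin n → VField E M, (∀ i, SmoothField (Y i)) →
    SmoothFun E (fun x => η x (fun i => Y i x))

/-- `(L_X η)(Y_1, …, Y_n) = X (η(Y_1, …, Y_n)) - ∑ i, η(Y_1, …, [X, Y_i], …, Y_n)`. -/
noncomputable def lieDeriv {n : ℕ} (X : VField E M) (η : Form E M n) (Y : Fin n → VField E M)
    (x : M) : ℝ :=
  act X (fun y => η y (fun i => Y i y)) x
    - ∑ i, η x (Function.update (fun j => Y j x) i (br X (Y i) x))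

/-- The Koszul formula for the exterior derivative of an `n`-form `η`, given by its values on
tuples from a family `S` of vector fields with action `a` on functions and bracket `b`:
`(dη)(X_0, …, X_n) = ∑ i, (-1)^i X_i (η(…, X̂_i, …))
  + ∑ i < j, (-1)^(i+j) η([X_i, X_j], …, X̂_i, …, X̂_j, …)`.
In the second sum `[X_i, X_j]` is put in the place of `X_i` instead of in front, which accounts
for the sign `(-1)^j` there. -/
noncomputable def koszul {S : Type*} (a : S → (M → ℝ) → M → ℝ) (b : S → S → S) {n : ℕ}
    (η : (Fin n → S) → M → ℝ) (X : Fin (n + 1) → S) (x : M) : ℝ :=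
  ∑ i : Fin (n + 1), (-1 : ℝ) ^ (i : ℕ) * a (X i) (η (i.removeNth X)) x
    + ∑ i : Fin (n + 1), ∑ j : Fin (n + 1), if i < j then
        (-1 : ℝ) ^ (j : ℕ) * η (j.removeNth (Function.update X i (b (X i) (X j)))) x
      else 0

/-- The values of a form on tuples of vector fields. -/
noncomputable def formEval {n : ℕ} (η : Form E M n) (Y : Fin n → VField E M) (x : M) : ℝ :=
  η x (fun i => Y i x)

/-- The exterior derivative on `M`, as a function of tuples of smooth vector fields. -/
noncomputable def extD {n : ℕ} (η : Form E M n) : (Fin (n + 1) → VField E M) → M → ℝ :=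
  koszul act br (formEval η)

/-- The exterior product of two alternating forms (the sum over shuffles). -/
noncomputable def wedgeForm {V : Type*} [AddCommGroup V] [Module ℝ V] {p q : ℕ}
    (α : V [⋀^Fin p]→ₗ[ℝ] ℝ) (β : V [⋀^Fin q]→ₗ[ℝ] ℝ) : V [⋀^Fin (p + q)]→ₗ[ℝ] ℝ :=
  ((LinearMap.mul' ℝ ℝ).compAlternatingMap (α.domCoprod β)).domDomCongr finSumFinEquiv

/-- A volume form: a nowhere vanishing smooth form of top degree. -/
def IsVolumeForm [IsManifold 𝓘(ℝ, E) ∞ M] {n : ℕ} (Ω : Form E M n) : Prop :=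
  n = Module.finrank ℝ E ∧ SmoothForm Ω ∧ ∀ x, Ω x ≠ 0

end Forms

/-! ## Poisson structures on a manifold, modular vector fields -/

section Poisson

variable {E : Type*} [NormedAddCommGroup E] [NormedSpace ℝ E]
  {M : Type*} [TopologicalSpace M] [ChartedSpace E M]

/-- Set-theoretic bivector fields on `M`. -/
abbrev Bivector (E : Type*) [NormedAddCommGroup E] [NormedSpace ℝ E]
    (M : Type*) [TopologicalSpace M] [ChartedSpace E M] : Type _ :=
  Π x : M, ⋀[ℝ]^2 (TangentSpace 𝓘(ℝ, E) x)

/-- `Π^♯ df`. -/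
noncomputable def hamField (Λ : Bivector E M) (f : M → ℝ) : VField E M :=
  fun x => sharp (Λ x) (dif f x)

/-- `{f, g} = Π(df, dg) = ⟨dg, Π^♯ df⟩`. -/
noncomputable def pbr (Λ : Bivector E M) (f g : M → ℝ) (x : M) : ℝ :=
  dif g x (hamField Λ f x)

/-- The Jacobi identity `[Π, Π] = 0`. -/
def IsJacobi (Λ : Bivector E M) : Prop :=
  ∀ f g h : M → ℝ, SmoothFun E f → SmoothFun E g → SmoothFun E h → ∀ x,
    pbr Λ f (pbr Λ g h) x + pbr Λ g (pbr Λ h f) x + pbr Λ h (pbr Λ f g) x = 0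

theorem pbr_add_left (Λ : Bivector E M) {f f' g : M → ℝ} (hf : SmoothFun E f)
    (hf' : SmoothFun E f') (x : M) : pbr Λ (f + f') g x = pbr Λ f g x + pbr Λ f' g x := by
  simp [pbr, hamField, dif_add hf hf']

theorem pbr_add_right (Λ : Bivector E M) {f g g' : M → ℝ} (hg : SmoothFun E g)
    (hg' : SmoothFun E g') (x : M) : pbr Λ f (g + g') x = pbr Λ f g x + pbr Λ f g' x := by
  simp [pbr, dif_add hg hg']

theorem pbr_smul_left (Λ : Bivector E M) {f g : M → ℝ} (hf : SmoothFun E f) (c : ℝ) (x : M) :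
    pbr Λ (c • f) g x = c * pbr Λ f g x := by
  simp [pbr, hamField, dif_smul hf]

theorem pbr_smul_right (Λ : Bivector E M) {f g : M → ℝ} (hg : SmoothFun E g) (c : ℝ) (x : M) :
    pbr Λ f (c • g) x = c * pbr Λ f g x := by
  simp [pbr, dif_smul hg]

theorem dif_zero (x : M) : dif (E := E) (0 : M → ℝ) x = 0 := by
  unfold dif; rw [mvfderiv_zero]; rfl

theorem smoothFun_zero : SmoothFun E (0 : M → ℝ) := contMDiff_const

theorem smoothFun_smul (c : ℝ) {f : M → ℝ} (hf : SmoothFun E f) : SmoothFun E (c • f) :=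
  ContMDiff.mul (contMDiff_const (c := c)) hf

/-- Hamiltonian vector fields `Π^♯ df`, `f ∈ C^∞(M)`. -/
noncomputable def Ham (Λ : Bivector E M) : Submodule ℝ (VField E M) where
  carrier := {X | ∃ f : M → ℝ, SmoothFun E f ∧ X = hamField Λ f}
  zero_mem' := ⟨0, smoothFun_zero, by funext x; simp [hamField, dif_zero]⟩
  add_mem' := by
    rintro _ _ ⟨f, hf, rfl⟩ ⟨g, hg, rfl⟩
    exact ⟨f + g, ContMDiff.add hf hg, by funext x; simp [hamField, dif_add hf hg]⟩
  smul_mem' := by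
    rintro c _ ⟨f, hf, rfl⟩
    exact ⟨c • f, smoothFun_smul c hf, by funext x; simp [hamField, dif_smul hf]⟩

variable [IsManifold 𝓘(ℝ, E) ∞ M]

/-- Poisson vector fields: smooth `X` with `L_X Π = 0`, the latter evaluated on exact 1-forms:
`(L_X Π)(df, dg) = X {f, g} - {X f, g} - {f, X g}`. -/
noncomputable def Poiss (Λ : Bivector E M) : Submodule ℝ (VField E M) where
  carrier := {X | SmoothField X ∧ ∀ f g : M → ℝ, SmoothFun E f → SmoothFun E g → ∀ x,
    act X (pbr Λ f g) x = pbr Λ (act X f) g x + pbr Λ f (act X g) x}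
  zero_mem' := by
    refine ⟨Bundle.contMDiff_zeroSection ℝ (TangentSpace 𝓘(ℝ, E) : M → Type _), ?_⟩
    intro f g _ _ x
    have h : ∀ f : M → ℝ, act (0 : VField E M) f = 0 := by intro f; funext y; simp [act]
    rw [h, h, h]
    simp [pbr, hamField, dif_zero]
  add_mem' := by
    rintro X Y ⟨hX, hX'⟩ ⟨hY, hY'⟩
    refine ⟨ContMDiff.add_section hX hY, fun f g hf hg x => ?_⟩
    have h : ∀ f : M → ℝ, act (X + Y) f = act X f + act Y f := by
      intro f; funext y; simp [act]
    rw [h, h, h, pbr_add_left Λ (act_smooth hX hf) (act_smooth hY hf),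
      pbr_add_right Λ (act_smooth hX hg) (act_smooth hY hg), Pi.add_apply,
      hX' f g hf hg, hY' f g hf hg]
    ring
  smul_mem' := by
    rintro c X ⟨hX, hX'⟩
    refine ⟨ContMDiff.const_smul_section hX, fun f g hf hg x => ?_⟩
    have h : ∀ f : M → ℝ, act (c • X) f = c • act X f := by
      intro f; funext y; simp [act]
    rw [h, h, h, pbr_smul_left Λ (act_smooth hX hf), pbr_smul_right Λ (act_smooth hX hg),
      Pi.smul_apply, hX' f g hf hg, smul_eq_mul]
    ring

/-- The first Poisson cohomology `Poiss(M, Π) / Ham(M, Π)`. -/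
abbrev PoissonH1 (Λ : Bivector E M) : Type _ := Poiss Λ ⧸ (Ham Λ).submoduleOf (Poiss Λ)

/-- `Z` is the modular vector field of `Π` relative to `Ω`: for all `f ∈ C^∞(M)` one has
`Z f = div^Ω (Π^♯ df)`, that is, `L_{Π^♯ df} Ω = (Z f) Ω`. -/
def IsModularField (Λ : Bivector E M) {n : ℕ} (Ω : Form E M n) (Z : VField E M) : Prop :=
  SmoothField Z ∧ ∀ f : M → ℝ, SmoothFun E f →
    ∀ Y : Fin n → VField E M, (∀ i, SmoothField (Y i)) → ∀ x,
      lieDeriv (hamField Λ f) Ω Y x = act Z f x * formEval Ω Y x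

/-- `c = Mod(M, Π)`: for every volume form `Ω` the modular vector field exists, is Poisson, and
`c` is its Poisson cohomology class. -/
def IsModularClass (Λ : Bivector E M) (c : PoissonH1 Λ) : Prop :=
  ∀ Ω : Form E M (Module.finrank ℝ E), IsVolumeForm Ω →
    ∃ Z : Poiss Λ, IsModularField Λ Ω Z.1 ∧ c = Submodule.Quotient.mk Z

end Poisson

/-! ## Regular foliations -/

section Foliations

/-- A regular foliation of rank `k`, given by its tangent bundle: a smooth subbundle of `TM` of
constant rank `k` which is closed under the Lie bracket. (`exists_section` and the constancy of
the rank say together that the subspaces form a smooth subbundle.) -/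
structure RegularFoliation (E : Type*) [NormedAddCommGroup E] [NormedSpace ℝ E]
    (M : Type*) [TopologicalSpace M] [ChartedSpace E M] [IsManifold 𝓘(ℝ, E) ∞ M] (k : ℕ) where
  /-- the tangent space of the leaf through `x` -/
  tangent : Π x : M, Submodule ℝ (TangentSpace 𝓘(ℝ, E) x)
  finrank_tangent : ∀ x, Module.finrank ℝ (tangent x) = k
  exists_section : ∀ x, ∀ v ∈ tangent x, ∃ X : VField E M,
    SmoothField X ∧ (∀ y, X y ∈ tangent y) ∧ X x = v
  involutive : ∀ X Y : VField E M, SmoothField X → SmoothField Y →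
    (∀ y, X y ∈ tangent y) → (∀ y, Y y ∈ tangent y) → ∀ y, br X Y y ∈ tangent y

variable {E : Type*} [NormedAddCommGroup E] [NormedSpace ℝ E] [FiniteDimensional ℝ E]
  {M : Type*} [TopologicalSpace M] [ChartedSpace E M] [IsManifold 𝓘(ℝ, E) ∞ M] {k : ℕ}

namespace RegularFoliation

/-- The smooth vector fields tangent to the foliation. -/
noncomputable def sections (F : RegularFoliation E M k) : Submodule ℝ (VField E M) where
  carrier := {X | SmoothField X ∧ ∀ y, X y ∈ F.tangent y}
  zero_mem' := ⟨Bundle.contMDiff_zeroSection ℝ (TangentSpace 𝓘(ℝ, E) : M → Type _),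
    fun y => (F.tangent y).zero_mem⟩
  add_mem' := fun hX hY => ⟨ContMDiff.add_section hX.1 hY.1,
    fun y => (F.tangent y).add_mem (hX.2 y) (hY.2 y)⟩
  smul_mem' := fun c _ hX => ⟨ContMDiff.const_smul_section hX.1,
    fun y => (F.tangent y).smul_mem c (hX.2 y)⟩

/-- The value of a tangent section at `x`. -/
noncomputable def val (F : RegularFoliation E M k) (X : F.sections) (x : M) : F.tangent x := ⟨X.1 x, X.2.2 x⟩

/-- The Lie bracket of tangent sections. -/
noncomputable def bracket (F : RegularFoliation E M k) (X Y : F.sections) : F.sections :=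
  ⟨br X.1 Y.1, by
    have := FiniteDimensional.complete ℝ E
    exact ⟨br_smooth X.2.1 Y.2.1, F.involutive _ _ X.2.1 Y.2.1 X.2.2 Y.2.2⟩⟩

/-- Set-theoretic foliated forms of degree `n`: sections of the `n`-th exterior power of the dual
of the tangent bundle of the foliation. -/
abbrev FolForm (F : RegularFoliation E M k) (n : ℕ) : Type _ :=
  Π x : M, (F.tangent x) [⋀^Fin n]→ₗ[ℝ] ℝ

/-- The values of a foliated form on tuples of tangent sections. -/
noncomputable def folEval (F : RegularFoliation E M k) {n : ℕ} (η : F.FolForm n) (X : Fin n → F.sections)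
    (x : M) : ℝ :=
  η x (fun i => F.val (X i) x)

/-- The foliated exterior derivative, as a function of tuples of tangent sections. -/
noncomputable def folD (F : RegularFoliation E M k) {n : ℕ} (η : F.FolForm n) :
    (Fin (n + 1) → F.sections) → M → ℝ :=
  koszul (fun X => act X.1) F.bracket (F.folEval η)

/-- `i_Z η`, a foliated form of degree `n - 1`, as a function of tuples of tangent sections. -/
noncomputable def folInsert (F : RegularFoliation E M k) (Z : F.sections) : {n : ℕ} →
    F.FolForm n → (Fin (n - 1) → F.sections) → M → ℝ
  | 0, _ => 0
  | _ + 1, η => fun X => F.folEval η (Fin.cons Z X)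

/-- A leaf-wise volume form: a nowhere vanishing smooth foliated form of top degree. -/
def IsLeafVolume (F : RegularFoliation E M k) (τ : F.FolForm k) : Prop :=
  (∀ X : Fin k → F.sections, SmoothFun E (F.folEval τ X)) ∧ ∀ x, τ x ≠ 0

/-- A transversal volume element: a nowhere vanishing smooth section of the top exterior power of
the annihilator of the tangent bundle of the foliation. Here `s` is the codimension. -/
def IsTransverseVolume (F : RegularFoliation E M k) {s : ℕ} (ς : Form E M s) : Prop :=
  k + s = Module.finrank ℝ E ∧ SmoothForm ς ∧
    (∀ x, ∀ v : Fin s → TangentSpace 𝓘(ℝ, E) x, (∃ i, v i ∈ F.tangent x) → ς x v = 0) ∧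
    ∀ x, ς x ≠ 0

/-- The foliation is orientable. -/
def Orientable (F : RegularFoliation E M k) : Prop := ∃ τ : F.FolForm k, F.IsLeafVolume τ

/-- The foliation is transversally orientable. -/
def TransversallyOrientable (F : RegularFoliation E M k) : Prop :=
  ∃ (s : ℕ) (ς : Form E M s), F.IsTransverseVolume ς

/-! ### Foliated de Rham cohomology in degree one and the Reeb class -/

/-- Set-theoretic foliated 1-forms. -/
def OneForm (F : RegularFoliation E M k) : Type _ := Π x : M, F.tangent x →ₗ[ℝ] ℝ

noncomputable instance instOneFormGroup (F : RegularFoliation E M k) : AddCommGroup F.OneForm :=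
  inferInstanceAs (AddCommGroup (Π x : M, F.tangent x →ₗ[ℝ] ℝ))

noncomputable instance instOneFormModule (F : RegularFoliation E M k) : Module ℝ F.OneForm :=
  inferInstanceAs (Module ℝ (Π x : M, F.tangent x →ₗ[ℝ] ℝ))

theorem OneForm.zero_apply (F : RegularFoliation E M k) (x : M) : (0 : F.OneForm) x = 0 := rfl

theorem OneForm.add_apply (F : RegularFoliation E M k) (μ ν : F.OneForm) (x : M) :
    (μ + ν) x = μ x + ν x := rfl

theorem OneForm.smul_apply (F : RegularFoliation E M k) (c : ℝ) (μ : F.OneForm) (x : M) :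
    (c • μ) x = c • μ x := rfl

/-- The function `μ(X)`. -/
noncomputable def pair (F : RegularFoliation E M k) (μ : F.OneForm) (X : F.sections) (x : M) : ℝ :=
  μ x (F.val X x)

/-- Smooth closed foliated 1-forms. -/
noncomputable def closedForms (F : RegularFoliation E M k) : Submodule ℝ F.OneForm where
  carrier := {μ | (∀ X, SmoothFun E (F.pair μ X)) ∧ ∀ X Y x,
    act X.1 (F.pair μ Y) x - act Y.1 (F.pair μ X) x - F.pair μ (F.bracket X Y) x = 0}
  zero_mem' := by
    have h : ∀ X, F.pair 0 X = 0 := by intro X; funext x; simp [pair, OneForm.zero_apply]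
    refine ⟨fun X => by rw [h]; exact smoothFun_zero, fun X Y x => ?_⟩
    rw [h, h, h]; simp [act, dif_zero]
  add_mem' := by
    rintro μ ν ⟨hμ, hμ'⟩ ⟨hν, hν'⟩
    have h : ∀ X, F.pair (μ + ν) X = F.pair μ X + F.pair ν X := by
      intro X; funext x; simp [pair, OneForm.add_apply]
    refine ⟨fun X => by rw [h]; exact ContMDiff.add (hμ X) (hν X), fun X Y x => ?_⟩
    rw [h, h, h]
    have h1 := hμ' X Y x
    have h2 := hν' X Y x
    simp only [act, dif_add (hμ _) (hν _), LinearMap.add_apply, Pi.add_apply] at *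
    linarith
  smul_mem' := by
    rintro c μ ⟨hμ, hμ'⟩
    have h : ∀ X, F.pair (c • μ) X = c • F.pair μ X := by
      intro X; funext x; simp [pair, OneForm.smul_apply]
    refine ⟨fun X => by rw [h]; exact smoothFun_smul c (hμ X), fun X Y x => ?_⟩
    rw [h, h, h]
    have h1 := hμ' X Y x
    simp only [act, dif_smul (hμ _), LinearMap.smul_apply, Pi.smul_apply, smul_eq_mul] at *
    linear_combination c * h1

/-- `d_F f`, the restriction of `df` to the tangent bundle of the foliation. -/
noncomputable def folDif (F : RegularFoliation E M k) (f : M → ℝ) : F.OneForm :=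
  fun x => (dif f x).comp (F.tangent x).subtype

/-- Exact foliated 1-forms. -/
noncomputable def exactForms (F : RegularFoliation E M k) : Submodule ℝ F.OneForm where
  carrier := {μ | ∃ f : M → ℝ, SmoothFun E f ∧ μ = F.folDif f}
  zero_mem' := ⟨0, smoothFun_zero, by funext x; simp [folDif, OneForm.zero_apply, dif_zero]⟩
  add_mem' := by
    rintro _ _ ⟨f, hf, rfl⟩ ⟨g, hg, rfl⟩
    exact ⟨f + g, ContMDiff.add hf hg, by
      funext x; simp [folDif, OneForm.add_apply, dif_add hf hg, LinearMap.add_comp]⟩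
  smul_mem' := by
    rintro c _ ⟨f, hf, rfl⟩
    exact ⟨c • f, smoothFun_smul c hf, by
      funext x; simp [folDif, OneForm.smul_apply, dif_smul hf, LinearMap.smul_comp]⟩

/-- The first foliated de Rham cohomology. -/
abbrev DeRhamH1 (F : RegularFoliation E M k) : Type _ :=
  F.closedForms ⧸ F.exactForms.submoduleOf F.closedForms

/-- `L_X ς = λ(X) ς` for all sections `X` of the tangent bundle of the foliation. -/
def IsReebForm (F : RegularFoliation E M k) {s : ℕ} (ς : Form E M s) (μ : F.OneForm) : Prop :=
  ∀ (X : F.sections) (Y : Fin s → VField E M), (∀ i, SmoothField (Y i)) → ∀ x,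
    lieDeriv X.1 ς Y x = F.pair μ X x * formEval ς Y x

/-- `r` is the Reeb class: for every transversal volume element `ς` the foliated 1-form `λ_ς`
exists, is smooth and closed, and `r` is its foliated de Rham cohomology class. -/
def IsReebClass (F : RegularFoliation E M k) (r : F.DeRhamH1) : Prop :=
  ∀ (s : ℕ) (ς : Form E M s), F.IsTransverseVolume ς →
    ∃ μ : F.closedForms, F.IsReebForm ς μ.1 ∧ r = Submodule.Quotient.mk μ

end RegularFoliation

/-! ### Poisson foliations -/

/-- A leaf-tangent Poisson bivector field `P`: a smooth section of the second exterior power of the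
tangent bundle of the foliation, that is, locally a finite sum of wedge products of tangent
sections, which is a Poisson bivector field on `M`. -/
structure LeafPoisson (F : RegularFoliation E M k) where
  /-- the bivector at `x` -/
  toFun : Π x : M, ⋀[ℝ]^2 (F.tangent x)
  smooth : ∀ x₀ : M, ∃ (m : ℕ) (X Y : Fin m → F.sections), ∀ᶠ x in 𝓝 x₀,
    toFun x = ∑ i, wedgeVec (F.val (X i) x) (F.val (Y i) x)
  jacobi : IsJacobi (E := E)
    (fun x => exteriorPower.map 2 (F.tangent x).subtype (toFun x))

namespace LeafPoisson

variable {F : RegularFoliation E M k}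

/-- `P` as a bivector field on `M`. -/
noncomputable def onM (P : LeafPoisson F) : Bivector E M :=
  fun x => exteriorPower.map 2 (F.tangent x).subtype (P.toFun x)

/-- `P^♯ μ` for a foliated 1-form `μ`. -/
noncomputable def sharpFol (P : LeafPoisson F) (μ : F.OneForm) : VField E M :=
  fun x => (sharp (P.toFun x) (μ x) : F.tangent x)

theorem sharp_map {V : Type*} [AddCommGroup V] [Module ℝ V] (W : Submodule ℝ V) (P : ⋀[ℝ]^2 W)
    (α : Module.Dual ℝ V) :
    sharp (exteriorPower.map 2 W.subtype P) α = (sharp P (α.comp W.subtype) : W) := by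
  have : ((LinearMap.applyₗ α).comp sharp).comp (exteriorPower.map 2 W.subtype)
      = W.subtype.comp ((LinearMap.applyₗ (α.comp W.subtype)).comp sharp) := by
    apply bivector_hom_ext
    intro X Y
    have : exteriorPower.map 2 W.subtype (wedgeVec X Y) = wedgeVec (X : V) (Y : V) := by
      simp only [wedgeVec, exteriorPower.map_apply_ιMulti]
      congr 1
      funext i; fin_cases i <;> rfl
    simp [this, sharp_wedgeVec]
  exact LinearMap.congr_fun this P

theorem sharp_skew {V : Type*} [AddCommGroup V] [Module ℝ V] (P : ⋀[ℝ]^2 V)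
    (α β : Module.Dual ℝ V) : β (sharp P α) = - α (sharp P β) := by
  have : β.comp ((LinearMap.applyₗ α).comp sharp)
      = - α.comp ((LinearMap.applyₗ β).comp (sharp (V := V))) := by
    apply bivector_hom_ext
    intro X Y
    simp [sharp_wedgeVec]
    ring
  exact LinearMap.congr_fun this P

theorem hamField_eq (P : LeafPoisson F) (f : M → ℝ) :
    hamField P.onM f = P.sharpFol (F.folDif f) := by
  funext x
  exact sharp_map _ _ _

theorem sharpFol_mem (P : LeafPoisson F) {μ : F.OneForm}
    (hμ : ∀ X, SmoothFun E (F.pair μ X)) : P.sharpFol μ ∈ F.sections := by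
  refine ⟨fun x₀ => ?_, fun y => (sharp (P.toFun y) (μ y)).2⟩
  obtain ⟨m, X, Y, h⟩ := P.smooth x₀
  have hs : SmoothField (fun x => ∑ i, ((F.pair μ (X i) • (Y i).1) - (F.pair μ (Y i) • (X i).1)) x) :=
    ContMDiff.sum_section fun i _ => ContMDiff.sub_section
      (ContMDiff.smul_section (hμ _) (Y i).2.1) (ContMDiff.smul_section (hμ _) (X i).2.1)
  refine (hs x₀).congr_of_eventuallyEq ?_
  filter_upwards [h] with x hx
  congr 1
  simp only [sharpFol, hx, map_sum, LinearMap.sum_apply, sharp_wedgeVec, Submodule.coe_sum]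
  rfl

theorem folDif_smooth {f : M → ℝ} (hf : SmoothFun E f) (X : F.sections) :
    SmoothFun E (F.pair (F.folDif f) X) :=
  act_smooth X.2.1 hf

/-- Poisson vector fields of `P` tangent to the foliation. -/
noncomputable def folPoiss (P : LeafPoisson F) : Submodule ℝ (VField E M) :=
  F.sections ⊓ Poiss P.onM

/-- The first cohomology of the Poisson foliation. -/
abbrev FolH1 (P : LeafPoisson F) : Type _ :=
  P.folPoiss ⧸ (Ham P.onM).submoduleOf P.folPoiss

/-- The natural map from the first cohomology of the Poisson foliation to the first Poisson
cohomology of `M`, induced by the inclusion. -/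
noncomputable def incl (P : LeafPoisson F) : P.FolH1 →ₗ[ℝ] PoissonH1 P.onM :=
  Submodule.mapQ _ _ (Submodule.inclusion inf_le_right) (fun _ hX => hX)

theorem sharpFol_mem_folPoiss [T2Space M] (P : LeafPoisson F) {μ : F.OneForm}
    (hμ : μ ∈ F.closedForms) : P.sharpFol μ ∈ P.folPoiss := by
  have := FiniteDimensional.complete ℝ E
  have hW := P.sharpFol_mem hμ.1
  refine ⟨hW, hW.1, fun f g hf hg x => ?_⟩
  -- Hamiltonian fields as tangent sections
  have ham : ∀ f : M → ℝ, SmoothFun E f → hamField P.onM f ∈ F.sections := fun f hf => by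
    rw [hamField_eq]; exact P.sharpFol_mem (folDif_smooth hf)
  have pbr_eq : ∀ f g : M → ℝ, pbr P.onM f g = act (hamField P.onM f) g := fun _ _ => rfl
  have pbr_smooth : ∀ f g : M → ℝ, SmoothFun E f → SmoothFun E g →
      SmoothFun E (pbr P.onM f g) := fun f g hf hg => act_smooth (ham f hf).1 hg
  have skew : ∀ f g : M → ℝ, pbr P.onM f g = -pbr P.onM g f := by
    intro f g; funext y; exact sharp_skew _ _ _
  -- the action of `P^♯ μ`
  have hact : ∀ (f : M → ℝ) (hf : SmoothFun E f),
      act (P.sharpFol μ) f = -F.pair μ ⟨_, ham f hf⟩ := by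
    intro f hf
    funext y
    have e : F.val ⟨_, ham f hf⟩ y = sharp (P.toFun y) (F.folDif f y) :=
      Subtype.ext (congrFun (hamField_eq P f) y)
    have := sharp_skew (P.toFun y) (μ y) (F.folDif f y)
    simp only [Pi.neg_apply, RegularFoliation.pair, e]
    exact this
  -- bracket of Hamiltonian fields
  have hbr : br (hamField P.onM f) (hamField P.onM g) = hamField P.onM (pbr P.onM f g) := by
    funext y
    by_contra hne
    obtain ⟨h, hh, hne'⟩ := exists_dif y _ (sub_ne_zero.mpr hne)
    apply hne'
    rw [map_sub, sub_eq_zero]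
    have e1 := act_br (ham f hf).1 (ham g hg).1 hh y
    have J := P.jacobi f g h hf hg hh y
    change pbr P.onM f (pbr P.onM g h) y + pbr P.onM g (pbr P.onM h f) y
      + pbr P.onM h (pbr P.onM f g) y = 0 at J
    have s1 : pbr P.onM g (pbr P.onM h f) y = - pbr P.onM g (pbr P.onM f h) y := by
      have : pbr P.onM h f = (-1 : ℝ) • pbr P.onM f h := by rw [skew h f]; simp
      rw [this, pbr_smul_right _ (pbr_smooth f h hf hh)]
      ring
    have s2 := congrFun (skew h (pbr P.onM f g)) y
    rw [Pi.neg_apply] at s2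
    rw [s1, s2] at J
    change act (br _ _) h y = pbr P.onM (pbr P.onM f g) h y
    rw [e1]
    change pbr P.onM f (pbr P.onM g h) y - pbr P.onM g (pbr P.onM f h) y = _
    linarith
  have hc := hμ.2 ⟨_, ham f hf⟩ ⟨_, ham g hg⟩ x
  have hbr' : F.bracket ⟨_, ham f hf⟩ ⟨_, ham g hg⟩
      = ⟨_, ham _ (pbr_smooth f g hf hg)⟩ := Subtype.ext hbr
  rw [hbr'] at hc
  have hl := congrFun (hact _ (pbr_smooth f g hf hg)) x
  rw [hl, hact f hf, hact g hg]
  have hl2 := congrFun (skew (-F.pair μ ⟨_, ham f hf⟩) g) x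
  rw [hl2]
  have n1 : ∀ X, -F.pair μ X = (-1 : ℝ) • F.pair μ X := by intro X; simp
  rw [n1 ⟨_, ham f hf⟩, n1 ⟨_, ham g hg⟩, Pi.neg_apply, pbr_smul_right _ (hμ.1 _),
    Pi.neg_apply, pbr_smul_right _ (hμ.1 _)]
  change act (hamField P.onM f) _ x - act (hamField P.onM g) _ x - _ = 0 at hc
  rw [← pbr_eq, ← pbr_eq] at hc
  linarith

/-- `P^♯` on closed foliated 1-forms. -/
noncomputable def sharpClosed [T2Space M] (P : LeafPoisson F) :
    F.closedForms →ₗ[ℝ] P.folPoiss where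
  toFun μ := ⟨P.sharpFol μ.1, P.sharpFol_mem_folPoiss μ.2⟩
  map_add' μ ν := by ext x; simp [sharpFol, RegularFoliation.OneForm.add_apply]
  map_smul' c μ := by ext x; simp [sharpFol, RegularFoliation.OneForm.smul_apply]

/-- The map `(P^♯)^*` in cohomology, `[μ] ↦ [P^♯ μ]`. -/
noncomputable def sharpStar [T2Space M] (P : LeafPoisson F) : F.DeRhamH1 →ₗ[ℝ] P.FolH1 :=
  Submodule.mapQ _ _ P.sharpClosed (by
    rintro ⟨μ, hμ⟩ ⟨f, hf, h⟩
    refine ⟨f, hf, ?_⟩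
    rw [hamField_eq, ← h]
    rfl)

/-- `d_F i_P η`, a foliated form of degree `n - 1`, as a function of tuples of tangent sections.
For `n < 2` one has `i_P η = 0`. -/
noncomputable def dInsert (P : LeafPoisson F) : {n : ℕ} → F.FolForm n →
    (Fin (n - 1) → F.sections) → M → ℝ
  | 0, _ => 0
  | 1, _ => 0
  | _ + 2, η => F.folD (fun x => contractTwo (η x) (P.toFun x))

/-- `Z` is the modular vector field of the Poisson foliation relative to `τ`:
`i_Z τ = - d_F i_P τ`. -/
def IsFolModularField (P : LeafPoisson F) (τ : F.FolForm k) (Z : F.sections) : Prop :=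
  ∀ (X : Fin (k - 1) → F.sections) (x : M), F.folInsert Z τ X x = - P.dInsert τ X x

/-- `c` is the modular class of the Poisson foliation: for every leaf-wise volume form `τ` the
modular vector field exists, is Poisson, and `c` is its class. -/
def IsFolModularClass (P : LeafPoisson F) (c : P.FolH1) : Prop :=
  ∀ τ : F.FolForm k, F.IsLeafVolume τ →
    ∃ Z : P.folPoiss, P.IsFolModularField τ ⟨Z.1, Z.2.1⟩ ∧ c = Submodule.Quotient.mk Z

end LeafPoisson

/-! ### Connections and the bigrading -/

/-- A connection form: a smooth projection `γ` of `TM` onto the tangent bundle of the foliation.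
Its kernel is a normal bundle of the foliation. -/
structure ConnectionForm (F : RegularFoliation E M k) where
  /-- the projection at `x` -/
  toFun : Π x : M, TangentSpace 𝓘(ℝ, E) x →ₗ[ℝ] F.tangent x
  proj : ∀ x, ∀ v : F.tangent x, toFun x v = v
  smooth : ∀ X : VField E M, SmoothField X →
    SmoothField (fun x => (toFun x (X x) : TangentSpace 𝓘(ℝ, E) x))

namespace ConnectionForm

variable {F : RegularFoliation E M k}

/-- The vector field `γ(X)`. -/
noncomputable def vert (γ : ConnectionForm F) (X : VField E M) : VField E M :=
  fun x => (γ.toFun x (X x) : TangentSpace 𝓘(ℝ, E) x)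

/-- `τ_γ = τ ∘ γ`, the extension of a foliated form by zero on the normal bundle `ker γ`. -/
noncomputable def extend (γ : ConnectionForm F) {n : ℕ} (τ : F.FolForm n) : Form E M n :=
  fun x => (τ x).compLinearMap (γ.toFun x)

/-- The component of bidegree `(n - q, q)` of an `n`-form, given by its values on vector fields:
`q` of the arguments are projected to the tangent bundle of the foliation along `ker γ` and the
others to `ker γ`, in all possible ways. -/
noncomputable def component (γ : ConnectionForm F) {n : ℕ} (q : ℕ)
    (η : (Fin n → VField E M) → M → ℝ) (X : Fin n → VField E M) (x : M) : ℝ :=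
  ∑ A ∈ Finset.powersetCard q (Finset.univ : Finset (Fin n)),
    η (fun i => if i ∈ A then γ.vert (X i) else X i - γ.vert (X i)) x

/-- `μ` is the 1-form `λ_ς^γ`: a smooth 1-form vanishing on `ker γ` with
`d_{0,1}^γ ς = μ ∧ ς`. Here `ς` is of bidegree `(s, 0)`, so that `d_{0,1}^γ ς` is the component of
bidegree `(s, 1)` of `dς`. -/
def IsReebOneForm (γ : ConnectionForm F) {s : ℕ} (ς : Form E M s)
    (μ : Π x : M, Module.Dual ℝ (TangentSpace 𝓘(ℝ, E) x)) : Prop :=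
  (∀ X : VField E M, SmoothField X → SmoothFun E (fun x => μ x (X x))) ∧
  (∀ x v, γ.toFun x v = 0 → μ x v = 0) ∧
  ∀ X : Fin (s + 1) → VField E M, (∀ i, SmoothField (X i)) → ∀ x,
    γ.component 1 (extD ς) X x
      = ∑ i : Fin (s + 1), (-1 : ℝ) ^ (i : ℕ) * μ x (X i x) * formEval ς (i.removeNth X) x

/-- The form `ς ∧ τ_γ`. -/
noncomputable def totalForm (γ : ConnectionForm F) {s : ℕ} (ς : Form E M s) (τ : F.FolForm k) :
    Form E M (s + k) :=
  fun x => wedgeForm (ς x) (γ.extend τ x)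

end ConnectionForm

end Foliations

end FoliatedPoisson

open FoliatedPoisson

namespace FoliatedPoisson

/-! ## Cartan calculus of Lie–Rinehart algebras -/

section LieRinehart

open Function

/-! Everything is governed by divergence operators. If `τ` is a leaf-wise volume form and `L_X τ =
δ(X) τ` for tangent sections `X`, then `δ(fX) = f δ(X) + X(f)` and `δ[X,Y] = X δ(Y) - Y δ(X)`; these
two rules are `IsDivergence`. For any such `δ` the operator `f ↦ δ(P^♯ df)` is a vector field: if `P
= ∑ X_i ∧ Y_i` locally, the second derivatives of `f` combine into commutators, and the operator is
`∑ δ(Y_i) X_i - δ(X_i) Y_i - [X_i, Y_i]` (`localModular_lie`, `exists_modular`). It preserves `P`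
because `[P^♯ df, P^♯ dg] = P^♯ d{f,g}` and `δ` is flat (`modular_mem`). Cartan calculus and `dτ =
0` identify it with the solution of `i_Z τ = -d i_P τ` (`ceDiff_curry_curry`).

A volume form `Ω` on `M` is a leaf-wise volume form of the foliation with a single leaf (`full`).
Restricting its divergence to tangent sections gives `Z_P^Ω` by the same construction, so this field
is automatically tangent to the leaves.

For tangent `X` one has `L_X ς = λ(X) ς`. The product rule for `Ω = ς ∧ τ_γ` gives `δ_Ω = δ_τ + λ`
on tangent sections (`IsTotal.divergence`). Evaluating at `P^♯ df`, and using `λ(P^♯ df) = -(P^♯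
λ)(f)`, yields `Z_P^Ω = Z_P^τ - P^♯ λ`. Multiplying a volume form by a nowhere zero `h` adds `X(log
|h|)` to the divergence. This changes modular fields by Hamiltonian fields and `λ` by an exact form,
so the classes do not depend on the choices. Finally `λ_ς^γ = λ ∘ γ`, because `i_X ς = 0` turns
Cartan's formula into `i_X dς = λ(X) ς`.

The calculus is carried out algebraically: tangent sections form a Lie–Rinehart algebra over
`C^∞(M)`, and forms are alternating maps over `C^∞(M)`. Tensoriality (`linear_apply_eq_zero`,
`exists_pointForm`) passes back to points. -/

theorem cons_removeNth_apply {R V : Type*} [CommRing R] [AddCommGroup V] [Module R V] {n : ℕ}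
    (η : V [⋀^Fin (n + 1)]→ₗ[R] R) (X : V) (i : Fin (n + 1))
    (Y : Fin (n + 1) → V) :
    η (Fin.cons X (i.removeNth Y)) = (-1 : R) ^ (i : ℕ) * η (update Y i X) := by
  have h := η.neg_one_pow_smul_map_insertNth i X (i.removeNth Y)
  rw [Fin.insertNth_removeNth] at h
  rw [show (Fin.cons X (i.removeNth Y) : Fin (n + 1) → V) = Matrix.vecCons X (i.removeNth Y) from rfl,
    ← h]
  simp

theorem removeNth_succ_cons {V : Type*} {m : ℕ} (X : V) (i : Fin (m + 1)) (Y : Fin (m + 1) → V) :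
    (i.succ.removeNth (Fin.cons X Y : Fin (m + 2) → V)) = Fin.cons X (i.removeNth Y) := by
  funext l
  refine Fin.cases ?_ (fun l => ?_) l
  · simp [Fin.removeNth]
  · simp [Fin.removeNth]

variable {A L : Type*} [CommRing A] [Algebra ℝ A] [LieRing L] [Module A L] [LieRingModule L A]
  [LieRinehartRing A L] {n : ℕ}

/-- Division by two comes from the real algebra structure on `A`. -/
theorem self_eq_zero_of_eq_neg {a : A} (h : a = -a) : a = 0 := by
  have h2 : (2 : ℝ) • a = 0 := by rw [two_smul]; nth_rewrite 1 [h]; simp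
  simpa using h2

theorem lie_smul_left_eq (f : A) (X Y : L) : ⁅f • X, Y⁆ = f • ⁅X, Y⁆ - ⁅Y, f⁆ • X := by
  rw [← lie_skew, LieRinehartRing.leibniz_smul_right, ← lie_skew X Y]
  module

/-- The Lie derivative of an alternating form along an element of a Lie–Rinehart algebra. -/
noncomputable def lieForm (X : L) (η : L [⋀^Fin n]→ₗ[A] A) : L [⋀^Fin n]→ₗ[A] A where
  toFun Y := ⁅X, η Y⁆ - ∑ i, η (update Y i ⁅X, Y i⁆)
  map_update_add' := by
    intro dec Y i p q
    obtain rfl : dec = instDecidableEqFin n := Subsingleton.elim _ _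
    have key : ∀ j, η (update (update Y i (p + q)) j ⁅X, update Y i (p + q) j⁆)
        = η (update (update Y i p) j ⁅X, update Y i p j⁆)
          + η (update (update Y i q) j ⁅X, update Y i q j⁆) := by
      intro j
      by_cases h : j = i
      · subst h; simp
      · simp only [update_of_ne h]
        rw [update_comm (Ne.symm h), update_comm (Ne.symm h), update_comm (Ne.symm h),
          η.map_update_add]
    simp only [key, Finset.sum_add_distrib, η.map_update_add, lie_add]
    ring
  map_update_smul' := by
    intro dec Y i f p
    obtain rfl : dec = instDecidableEqFin n := Subsingleton.elim _ _
    have key : ∀ j, η (update (update Y i (f • p)) j ⁅X, update Y i (f • p) j⁆)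
        = f * η (update (update Y i p) j ⁅X, update Y i p j⁆)
          + if j = i then ⁅X, f⁆ * η (update Y i p) else 0 := by
      intro j
      by_cases h : j = i
      · subst h; simp
      · simp only [update_of_ne h, if_neg h, add_zero]
        rw [update_comm (Ne.symm h), update_comm (Ne.symm h), η.map_update_smul, smul_eq_mul]
    simp only [key, Finset.sum_add_distrib, η.map_update_smul, smul_eq_mul,
      LieRinehartRing.leibniz_mul_right, Finset.sum_ite_eq', Finset.mem_univ, if_true,
      ← Finset.mul_sum]
    ring
  map_eq_zero_of_eq' := by
    intro Y i j h hij
    have hs : Y ∘ Equiv.swap i j = Y := by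
      funext l
      exact Equiv.apply_swap_eq_self h l
    have e0 : η Y = 0 := η.map_eq_zero_of_eq Y h hij
    -- Reindexing the sum by the transposition of `i` and `j` permutes the arguments of each term by
    -- that same transposition, so the whole sum equals its negative.
    have e1 : ∑ l, η (update Y l ⁅X, Y l⁆) = -∑ l, η (update Y l ⁅X, Y l⁆) := by
      conv_lhs => rw [← Equiv.sum_comp (Equiv.swap i j)]
      rw [← Finset.sum_neg_distrib]
      refine Finset.sum_congr rfl fun l _ => ?_
      rw [← η.map_swap _ hij]
      congr 1
      funext m
      have hl : Y (Equiv.swap i j l) = Y l := congrFun hs l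
      by_cases hm : m = Equiv.swap i j l
      · subst hm; simp [hl]
      · have hm' : Equiv.swap i j m ≠ l := fun h' => hm (by rw [← h']; simp)
        rw [comp_apply, update_of_ne hm, update_of_ne hm']
        exact (congrFun hs m).symm
    rw [self_eq_zero_of_eq_neg e1, e0]
    simp

theorem lieForm_apply (X : L) (η : L [⋀^Fin n]→ₗ[A] A) (Y : Fin n → L) :
    lieForm X η Y = ⁅X, η Y⁆ - ∑ i, η (update Y i ⁅X, Y i⁆) := rfl

theorem lieForm_add_left (X W : L) (η : L [⋀^Fin n]→ₗ[A] A) :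
    lieForm (X + W) η = lieForm X η + lieForm W η := by
  ext Y
  simp only [lieForm_apply, AlternatingMap.add_apply, add_lie, η.map_update_add,
    Finset.sum_add_distrib]
  ring

/-- The correction is `df ∧ i_X η`: it comes from the derivative of `f` in `⁅f • X, Y i⁆`, and it is
why `lieForm` is not linear over `A` in the field. -/
theorem lieForm_smul_left (f : A) (X : L) (η : L [⋀^Fin n]→ₗ[A] A) (Y : Fin n → L) :
    lieForm (f • X) η Y = f * lieForm X η Y + ∑ i, ⁅Y i, f⁆ * η (update Y i X) := by
  simp only [lieForm_apply, lie_smul_left_eq, η.map_update_sub, η.map_update_smul, smul_eq_mul,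
    Finset.sum_sub_distrib, LieRinehartRing.lie_smul_eq_mul, ← Finset.mul_sum]
  ring

theorem lieForm_smul (X : L) (f : A) (η : L [⋀^Fin n]→ₗ[A] A) :
    lieForm X (f • η) = ⁅X, f⁆ • η + f • lieForm X η := by
  ext Y
  simp only [lieForm_apply, AlternatingMap.add_apply, AlternatingMap.smul_apply, smul_eq_mul,
    LieRinehartRing.leibniz_mul_right, ← Finset.mul_sum]
  ring

theorem lieForm_lie (X W : L) (η : L [⋀^Fin n]→ₗ[A] A) :
    lieForm ⁅X, W⁆ η = lieForm X (lieForm W η) - lieForm W (lieForm X η) := by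
  ext Y
  -- Terms in which the two brackets hit different slots are symmetric in `X` and `W` and cancel;
  -- the diagonal terms combine by the Jacobi identity.
  have key : ∑ i, ∑ j, η (update (update Y i ⁅X, Y i⁆) j ⁅W, update Y i ⁅X, Y i⁆ j⁆)
      - ∑ i, ∑ j, η (update (update Y i ⁅W, Y i⁆) j ⁅X, update Y i ⁅W, Y i⁆ j⁆)
      = -∑ i, η (update Y i ⁅⁅X, W⁆, Y i⁆) := by
    conv_lhs => enter [2]; rw [Finset.sum_comm]
    simp only [← Finset.sum_sub_distrib]
    rw [← Finset.sum_neg_distrib]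
    refine Finset.sum_congr rfl fun i _ => ?_
    rw [Finset.sum_eq_single i]
    · simp only [update_self, update_idem]
      rw [← η.map_update_sub, ← η.map_update_neg, lie_lie, neg_sub]
    · intro j _ h
      rw [update_of_ne h, update_of_ne (Ne.symm h), update_comm h, sub_self]
    · simp
  simp only [lieForm_apply, AlternatingMap.sub_apply, lie_sub, lie_sum, Finset.sum_sub_distrib,
    lie_lie]
  simp only [lie_lie] at key
  linear_combination -key

/-- The Chevalley–Eilenberg differential, as a function of tuples. -/
noncomputable def ceDiff (η : (Fin n → L) → A) (X : Fin (n + 1) → L) : A :=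
  ∑ i : Fin (n + 1), (-1 : A) ^ (i : ℕ) * ⁅X i, η (i.removeNth X)⁆
    + ∑ i : Fin (n + 1), ∑ j : Fin (n + 1), if i < j then
        (-1 : A) ^ (j : ℕ) * η (j.removeNth (update X i ⁅X i, X j⁆))
      else 0

theorem ceDiff_zero (η : L [⋀^Fin 0]→ₗ[A] A) (Y : Fin 1 → L) :
    ceDiff η Y = ⁅Y 0, η ![]⁆ := by
  have : (Fin.removeNth 0 Y : Fin 0 → L) = ![] := Subsingleton.elim _ _
  simp [ceDiff, this]

/-- The rule `i_X L_W = L_W i_X - i_[W,X]`: only slot zero of the sum brackets `W` with `X`. -/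
theorem lieForm_cons (W X : L) (η : L [⋀^Fin (n + 1)]→ₗ[A] A) (Z : Fin n → L) :
    lieForm W η (Fin.cons X Z) = lieForm W (η.curryLeft X) Z - η (Fin.cons ⁅W, X⁆ Z) := by
  have hc : ∀ v : Fin n → L, η.curryLeft X v = η (Fin.cons X v) := fun v => rfl
  have h2 : ∀ (i : Fin n) (z : L), update (Fin.cons X Z : Fin (n + 1) → L) i.succ z
      = Fin.cons X (update Z i z) := fun i z => by rw [Fin.cons_update]
  have h3 : ∀ z : L, update (Fin.cons X Z : Fin (n + 1) → L) 0 z = Fin.cons z Z :=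
    fun z => Fin.update_cons_zero _ _ _
  simp only [lieForm_apply, Fin.sum_univ_succ, Fin.cons_zero, Fin.cons_succ, h2, h3, hc]
  ring

/-- Cartan's magic formula. -/
theorem ceDiff_cons (η : L [⋀^Fin (n + 1)]→ₗ[A] A) (X : L) (Y : Fin (n + 1) → L) :
    ceDiff η (Fin.cons X Y) = lieForm X η Y - ceDiff (η.curryLeft X) Y := by
  have hc : ∀ v : Fin n → L, η.curryLeft X v = η (Fin.cons X v) := fun v => rfl
  have h2 : ∀ (i : Fin (n + 1)) (z : L), update (Fin.cons X Y : Fin (n + 2) → L) i.succ z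
      = Fin.cons X (update Y i z) := fun i z => by rw [Fin.cons_update]
  have h3 : ∀ z : L, update (Fin.cons X Y : Fin (n + 2) → L) 0 z = Fin.cons z Y :=
    fun z => Fin.update_cons_zero _ _ _
  have sq : ∀ i : ℕ, (-1 : A) ^ i * (-1 : A) ^ i = 1 := fun i => by
    rw [← mul_pow]; simp
  unfold ceDiff
  rw [Fin.sum_univ_succ, Fin.sum_univ_succ (f := fun i => ∑ j, _)]
  simp only [Fin.sum_univ_succ (n := n + 1), Fin.cons_zero, Fin.cons_succ, removeNth_succ_cons,
    Fin.removeNth_zero, Fin.tail_cons, h2, h3, Fin.succ_lt_succ_iff, Fin.not_lt_zero, if_false,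
    Fin.succ_pos, if_true, hc, Fin.val_succ, Fin.val_zero, pow_zero, one_mul, lt_self_iff_false,
    zero_add, pow_succ]
  simp only [cons_removeNth_apply η ⁅X, Y _⁆, lieForm_apply]
  have e : ∀ i : Fin (n + 1), (-1 : A) ^ (i : ℕ) * -1 * ((-1 : A) ^ (i : ℕ) *
      η (update Y i ⁅X, Y i⁆)) = - η (update Y i ⁅X, Y i⁆) := fun i => by
    linear_combination (-η (update Y i ⁅X, Y i⁆)) * sq i
  have e4 : ∀ (p : Prop) [Decidable p] (i : ℕ) (a : A),
      (if p then (-1 : A) ^ i * -1 * a else 0) = - if p then (-1 : A) ^ i * a else 0 := by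
    intro p _ i a; split_ifs <;> ring
  simp only [e, e4]
  simp only [mul_neg, mul_one, neg_mul, Finset.sum_neg_distrib]
  ring

/-- The Chevalley–Eilenberg differential of a form is again a form. -/
theorem exists_ceDiff : ∀ (n : ℕ) (η : L [⋀^Fin n]→ₗ[A] A),
    ∃ D : L [⋀^Fin (n + 1)]→ₗ[A] A, ∀ Y, D Y = ceDiff η Y
  | 0, η => by
    refine ⟨AlternatingMap.ofSubsingleton A L A (0 : Fin 1)
      { toFun := fun Y => ⁅Y, η ![]⁆, map_add' := fun _ _ => add_lie _ _ _,
        map_smul' := fun f Y => by simp }, fun Y => ?_⟩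
    rw [ceDiff_zero]
    rfl
  | n + 1, η => by
    -- Induction on the degree through Cartan's formula: `D X` is `d(i_X η)`, so `G X = L_X η -
    -- d(i_X η)` is the candidate for `i_X dη`. It remains to see that `G` is linear in `X` and
    -- alternates with the other arguments.
    choose D hD using fun X => exists_ceDiff n (η.curryLeft X)
    set G : L → L [⋀^Fin (n + 1)]→ₗ[A] A := fun X => lieForm X η - D X with hG
    have hGc : ∀ X Y, G X Y = ceDiff η (Fin.cons X Y) := fun X Y => by
      rw [ceDiff_cons, ← hD]; rfl
    have hadd : ∀ X W Y, G (X + W) Y = G X Y + G W Y := by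
      intro X W Y
      have : D (X + W) Y = D X Y + D W Y := by
        simp only [hD, ceDiff, map_add, AlternatingMap.add_apply, lie_add, mul_add,
          Finset.sum_add_distrib]
        have : ∀ (p : Prop) [Decidable p] (a b : A),
          (if p then a + b else 0) = (if p then a else 0) + if p then b else 0 := by
          intro p _ a b; split_ifs <;> simp
        simp only [this, Finset.sum_add_distrib]
        ring
      simp only [hG, AlternatingMap.sub_apply, lieForm_add_left, AlternatingMap.add_apply, this]
      ring
    -- Since `[X, X] = 0`, `i_X L_X = L_X i_X`; Cartan's formula for `i_X η` and `i_X i_X = 0` leave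
    -- nothing.
    have halt : ∀ X (Z : Fin n → L), G X (Fin.cons X Z) = 0 := by
      intro X Z
      rw [hG, AlternatingMap.sub_apply, hD, lieForm_cons, lie_self,
        η.map_coord_zero (i := 0) (by simp), sub_zero, sub_eq_zero]
      cases n with
      | zero =>
        rw [ceDiff_zero, lieForm_apply]
        simp [Subsingleton.elim Z ![]]
      | succ m =>
        rw [ceDiff_cons, AlternatingMap.curryLeft_same]
        simp [ceDiff]
    have hskew : ∀ X W (Z : Fin n → L), G X (Fin.cons W Z) = - G W (Fin.cons X Z) := by
      intro X W Z
      have h := halt (X + W) Z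
      have e : ∀ U, G U (Fin.cons (X + W) Z) = G U (Fin.cons X Z) + G U (Fin.cons W Z) :=
        fun U => (G U).toMultilinearMap.cons_add Z X W
      rw [hadd, e, e, halt, halt] at h
      linear_combination h
    -- Linearity over `A` is known in the later slots; skewness carries it to the first slot, where
    -- it is not visible from the formula.
    have hsmul : ∀ (f : A) X Y, G (f • X) Y = f * G X Y := by
      intro f X Y
      have e : G (Y 0) (Fin.cons (f • X) (Fin.tail Y)) = f * G (Y 0) (Fin.cons X (Fin.tail Y)) :=
        (G (Y 0)).toMultilinearMap.cons_smul (Fin.tail Y) f X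
      rw [← Fin.cons_self_tail Y, hskew, e, hskew]
      ring
    let G' : L →ₗ[A] L [⋀^Fin (n + 1)]→ₗ[A] A :=
      { toFun := G
        map_add' := fun X W => AlternatingMap.ext (hadd X W)
        map_smul' := fun f X => AlternatingMap.ext (hsmul f X) }
    have hcons0 : ∀ (X : L) (Y : Fin (n + 1) → L) (j : Fin (n + 1)), Y j = X → G X Y = 0 := by
      intro X Y j hj
      by_cases h0 : j = 0
      · subst h0
        rw [← Fin.cons_self_tail Y, hj, halt]
      · have h1 := (G X).map_swap Y (Ne.symm h0)
        rw [← Fin.cons_self_tail (Y ∘ Equiv.swap 0 j)] at h1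
        have : (Y ∘ Equiv.swap 0 j) 0 = X := by simp [hj]
        rw [this, halt] at h1
        exact (neg_eq_zero.mp h1.symm)
    refine ⟨{ LinearMap.uncurryLeft (AlternatingMap.toMultilinearMapLM (S := A) ∘ₗ G') with
      map_eq_zero_of_eq' := ?_ }, fun Y => ?_⟩
    · intro Y i j h hij
      change G (Y 0) (Fin.tail Y) = 0
      induction i using Fin.cases with
      | zero =>
        induction j using Fin.cases with
        | zero => exact absurd rfl hij
        | succ j => exact hcons0 _ _ j h.symm
      | succ i =>
        induction j using Fin.cases with
        | zero => exact hcons0 _ _ i h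
        | succ j => exact (G (Y 0)).map_eq_zero_of_eq _ h (fun e => hij (congrArg _ e))
    · change G (Y 0) (Fin.tail Y) = _
      rw [hGc, Fin.cons_self_tail]

end LieRinehart

/-! ## Linear algebra of alternating forms -/

section LinearAlgebra

open Function

variable {V W : Type*} [AddCommGroup V] [Module ℝ V] [AddCommGroup W] [Module ℝ W] {n : ℕ}

/-- An alternating map which vanishes on the kernel of a surjective map descends. -/
theorem exists_descent (f : V →ₗ[ℝ] W) (hf : Surjective f) (Λ : V [⋀^Fin n]→ₗ[ℝ] ℝ)
    (h : ∀ (v : Fin n → V) (i : Fin n), f (v i) = 0 → Λ v = 0) :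
    ∃ θ : W [⋀^Fin n]→ₗ[ℝ] ℝ, ∀ v, Λ v = θ (fun i => f (v i)) := by
  obtain ⟨r, hr⟩ := f.exists_rightInverse_of_surjective (LinearMap.range_eq_top.mpr hf)
  refine ⟨Λ.compLinearMap r, fun v => ?_⟩
  have hr' : ∀ w, f (r w) = w := fun w => LinearMap.congr_fun hr w
  -- The arguments are replaced by their lifts one at a time; each replacement changes an argument
  -- by an element of the kernel of `f`.
  have key : ∀ t : Finset (Fin n),
      Λ v = Λ (fun i => if i ∈ t then r (f (v i)) else v i) := by
    intro t
    induction t using Finset.induction_on with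
    | empty => simp
    | insert a t ha ih =>
      rw [ih, ← sub_eq_zero]
      set u : Fin n → V := fun i => if i ∈ t then r (f (v i)) else v i with hu
      have e1 : u = update u a (v a) := by
        funext i; by_cases hi : i = a
        · subst hi; simp [hu, ha]
        · simp [hi]
      have e2 : (fun i => if i ∈ insert a t then r (f (v i)) else v i)
          = update u a (r (f (v a))) := by
        funext i; by_cases hi : i = a
        · subst hi; simp
        · simp [hi, hu]
      rw [e2, e1, update_idem, ← Λ.map_update_sub]
      exact h _ a (by simp [hr'])
  rw [key Finset.univ]
  simp

theorem exists_ne_zero_apply {τ : V [⋀^Fin n]→ₗ[ℝ] ℝ} (h : τ ≠ 0) : ∃ v, τ v ≠ 0 := by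
  by_contra! h'
  exact h (AlternatingMap.ext h')

variable [FiniteDimensional ℝ V]

/-- Both forms are multiples of the determinant of a basis, with nonzero coefficient in the case of
`τ`. -/
theorem exists_eq_smul_of_finrank_eq (hn : Module.finrank ℝ V = n) {τ : V [⋀^Fin n]→ₗ[ℝ] ℝ}
    (hτ : τ ≠ 0) (θ : V [⋀^Fin n]→ₗ[ℝ] ℝ) : ∃ c : ℝ, θ = c • τ := by
  let b := Module.finBasisOfFinrankEq ℝ V hn
  refine ⟨θ b * (τ b)⁻¹, ?_⟩
  have hb : τ b ≠ 0 := (τ.map_basis_ne_zero_iff b).mpr hτ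
  have h1 := τ.eq_smul_basis_det b
  have h2 := θ.eq_smul_basis_det b
  generalize τ b = c at *
  generalize θ b = d at *
  rw [h1, h2, smul_smul, mul_assoc, inv_mul_cancel₀ hb, mul_one]

/-- Two forms of degree equal to the codimension of `U` which vanish on `U` are proportional. -/
theorem exists_eq_smul_of_vanish (U : Submodule ℝ V) {s : ℕ}
    (hs : Module.finrank ℝ U + s = Module.finrank ℝ V) {ς : V [⋀^Fin s]→ₗ[ℝ] ℝ} (hς : ς ≠ 0)
    (h : ∀ v : Fin s → V, (∃ i, v i ∈ U) → ς v = 0) (η : V [⋀^Fin s]→ₗ[ℝ] ℝ)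
    (h' : ∀ v : Fin s → V, (∃ i, v i ∈ U) → η v = 0) : ∃ c : ℝ, η = c • ς := by
  have hk : ∀ v, U.mkQ v = 0 ↔ v ∈ U := fun v => by simp
  -- Both forms descend to `V ⧸ U`, where they have top degree.
  obtain ⟨ς', e⟩ := exists_descent U.mkQ U.mkQ_surjective ς fun v i hi => h v ⟨i, (hk _).mp hi⟩
  obtain ⟨η', e'⟩ := exists_descent U.mkQ U.mkQ_surjective η fun v i hi => h' v ⟨i, (hk _).mp hi⟩
  have hq : Module.finrank ℝ (V ⧸ U) = s := by
    have := U.finrank_quotient_add_finrank; omega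
  obtain ⟨c, hc⟩ := exists_eq_smul_of_finrank_eq hq (τ := ς')
    (fun h0 => hς (AlternatingMap.ext fun v => by rw [e, h0]; rfl)) η'
  exact ⟨c, AlternatingMap.ext fun v => by
    rw [e', hc, AlternatingMap.smul_apply, AlternatingMap.smul_apply, e]⟩

/-- The form `α ∧ τ` has degree `n + 1` on an `n`-dimensional space and therefore vanishes; this is
its expansion on `(X, Y)`. -/
theorem trace_identity (hn : Module.finrank ℝ V = n) (τ : V [⋀^Fin n]→ₗ[ℝ] ℝ)
    (α : Module.Dual ℝ V) (X : V) (Y : Fin n → V) :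
    ∑ i, α (Y i) * τ (update Y i X) = α X * τ Y := by
  have h0 := (AlternatingMap.alternatizeUncurryFin (α.smulRight τ)).map_linearDependent
    (Matrix.vecCons X Y) (fun hl => by
      have := hl.fintype_card_le_finrank
      rw [hn, Fintype.card_fin] at this
      omega)
  rw [AlternatingMap.alternatizeUncurryFin_apply, Fin.sum_univ_succ] at h0
  have e : ∀ i : Fin n, (-1 : ℝ) ^ (i : ℕ) * τ (i.succ.removeNth (Matrix.vecCons X Y))
      = τ (update Y i X) := by
    intro i
    cases n with
    | zero => exact i.elim0
    | succ m =>
      have : (i.succ.removeNth (Matrix.vecCons X Y)) = (Fin.cons X (i.removeNth Y) : Fin (m + 1) → V) :=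
        removeNth_succ_cons X i Y
      rw [this, cons_removeNth_apply, ← mul_assoc, ← mul_pow]
      simp
  have h1 : α X * τ Y = ∑ i : Fin n, α (Y i) *
      ((-1 : ℝ) ^ (i : ℕ) * τ (i.succ.removeNth (Matrix.vecCons X Y))) := by
    rw [← sub_eq_zero, ← h0]
    simp [pow_succ, sub_eq_add_neg, Fin.removeNth_zero, Matrix.vecCons, ← Finset.sum_neg_distrib]
    refine Finset.sum_congr rfl fun i _ => by ring
  rw [h1]
  exact Finset.sum_congr rfl fun i _ => by rw [e]

/-- Cramer's rule. -/
theorem cramer_identity (hn : Module.finrank ℝ V = n) (τ : V [⋀^Fin n]→ₗ[ℝ] ℝ)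
    (X : V) (Y : Fin n → V) : τ Y • X = ∑ i, τ (update Y i X) • Y i := by
  rw [← sub_eq_zero, ← Module.forall_dual_apply_eq_zero_iff ℝ]
  intro α
  have := trace_identity hn τ α X Y
  simp only [map_sub, map_smul, map_sum, smul_eq_mul, sub_eq_zero]
  rw [mul_comm, ← this]
  exact Finset.sum_congr rfl fun i _ => mul_comm _ _

/-- Nondegeneracy of a top form: up to sign, the coefficients in Cramer's rule are values of `τ`
with `z` in front. -/
theorem eq_zero_of_cons_eq_zero (hn : Module.finrank ℝ V = n + 1) {τ : V [⋀^Fin (n + 1)]→ₗ[ℝ] ℝ}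
    (hτ : τ ≠ 0) {z : V} (h : ∀ v : Fin n → V, τ (Fin.cons z v) = 0) : z = 0 := by
  obtain ⟨e, he⟩ := exists_ne_zero_apply hτ
  have := cramer_identity hn τ z e
  rw [Finset.sum_eq_zero] at this
  · exact (smul_eq_zero.mp this).resolve_left he
  · intro i _
    have h1 := cons_removeNth_apply τ z i e
    rw [h] at h1
    rw [(mul_eq_zero.mp h1.symm).resolve_left (pow_ne_zero _ (by norm_num)), zero_smul]

/-- Every nontrivial shuffle puts some `e j` into `ς`, which kills it, so a single term of the
exterior product survives. -/
theorem wedgeForm_append {p q : ℕ} (ς : V [⋀^Fin p]→ₗ[ℝ] ℝ) (α : V [⋀^Fin q]→ₗ[ℝ] ℝ)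
    (U : Submodule ℝ V) (h : ∀ v : Fin p → V, (∃ i, v i ∈ U) → ς v = 0)
    (w : Fin p → V) (e : Fin q → V) (he : ∀ j, e j ∈ U) :
    wedgeForm ς α (Fin.append w e) = ς w * α e := by
  have happ : (fun i => Fin.append w e (finSumFinEquiv i)) = Sum.elim w e := by
    funext i; rcases i with i | i <;> simp
  change LinearMap.mul' ℝ ℝ (ς.domCoprod α (fun i => Fin.append w e (finSumFinEquiv i))) = _
  rw [happ]
  change LinearMap.mul' ℝ ℝ ((∑ σ : Equiv.Perm.ModSumCongr (Fin p) (Fin q),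
    AlternatingMap.domCoprod.summand ς α σ) (Sum.elim w e)) = _
  rw [sum_apply, map_sum]
  refine (Finset.sum_eq_single
    (Quotient.mk'' 1 : Equiv.Perm.ModSumCongr (Fin p) (Fin q)) ?_ ?_).trans ?_
  · intro σ _ hσ
    induction σ using Quotient.inductionOn' with | _ σ
    rw [AlternatingMap.domCoprod.summand_mk'']
    -- If no argument of `ς` lies in `U`, then `σ` preserves the left block and its class is that of
    -- the identity.
    have : ∃ i, Sum.elim w e (σ (Sum.inl i)) ∈ U := by
      by_contra! hU
      apply hσ
      have hinl : ∀ i, ∃ j, σ (Sum.inl i) = Sum.inl j := by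
        intro i
        rcases hi : σ (Sum.inl i) with j | j
        · exact ⟨j, rfl⟩
        · exact absurd (he j) (by simpa [hi] using hU i)
      refine Quotient.sound' ?_
      rw [QuotientGroup.leftRel_apply]
      rw [mul_one]
      apply inv_mem
      refine Equiv.Perm.mem_sumCongrHom_range_of_perm_mapsTo_inl ?_
      rintro _ ⟨i, rfl⟩
      obtain ⟨j, hj⟩ := hinl i
      exact ⟨j, hj.symm⟩
    have h0 := h (fun i => Sum.elim w e (σ (Sum.inl i))) this
    simp [h0]
  · simp
  · rw [AlternatingMap.domCoprod.summand_mk'']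
    simp

end LinearAlgebra

/-! ## Tangent sections as a Lie–Rinehart algebra -/

section Sections

variable {E : Type*} [NormedAddCommGroup E] [NormedSpace ℝ E] [FiniteDimensional ℝ E]
  {M : Type*} [TopologicalSpace M] [ChartedSpace E M] [IsManifold 𝓘(ℝ, E) ∞ M] {k : ℕ}

/-- The algebra of smooth functions on `M`. -/
abbrev SmoothAlg (E : Type*) [NormedAddCommGroup E] [NormedSpace ℝ E]
    (M : Type*) [TopologicalSpace M] [ChartedSpace E M] : Type _ :=
  C^∞⟮𝓘(ℝ, E), M; ℝ⟯

theorem dif_mul {f g : M → ℝ} (hf : SmoothFun E f) (hg : SmoothFun E g) (x : M) :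
    dif (E := E) (f * g) x = f x • dif g x + g x • dif f x := by
  have := mvfderiv_smul (I := 𝓘(ℝ, E)) (x := x) (a := f) (g := g)
    (hf.mdifferentiable (by simp) x) (hg.mdifferentiable (by simp) x)
  have e : (f * g : M → ℝ) = f • g := rfl
  unfold dif
  rw [e, this]
  ext v
  simp [mul_comm]

theorem dif_congr {f g : M → ℝ} {x : M} (h : f =ᶠ[𝓝 x] g) : dif (E := E) f x = dif g x := by
  unfold dif mvfderiv
  have h1 := h.mfderiv_eq (I := 𝓘(ℝ, E)) (I' := 𝓘(ℝ, ℝ))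
  ext v
  exact DFunLike.congr_fun h1 v

theorem SmoothField.mdiff {X : VField E M} (hX : SmoothField X) (x : M) :
    MDifferentiableAt 𝓘(ℝ, E) 𝓘(ℝ, E).tangent
      (fun x => (⟨x, X x⟩ : TangentBundle 𝓘(ℝ, E) M)) x :=
  (hX x).mdifferentiableAt (by simp)

namespace RegularFoliation

variable (F : RegularFoliation E M k)

noncomputable instance sectionsSMul : SMul (SmoothAlg E M) F.sections where
  smul f X := ⟨fun x => f x • X.1 x, ContMDiff.smul_section f.contMDiff X.2.1,
    fun y => (F.tangent y).smul_mem _ (X.2.2 y)⟩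

noncomputable instance sectionsModule : Module (SmoothAlg E M) F.sections where
  one_smul X := Subtype.ext (funext fun x => one_smul ℝ (X.1 x))
  mul_smul f g X := Subtype.ext (funext fun x => mul_smul (f x) (g x) (X.1 x))
  smul_zero f := Subtype.ext (funext fun x => smul_zero (f x))
  smul_add f X Y := Subtype.ext (funext fun x => smul_add (f x) (X.1 x) (Y.1 x))
  add_smul f g X := Subtype.ext (funext fun x => add_smul (f x) (g x) (X.1 x))
  zero_smul X := Subtype.ext (funext fun x => zero_smul ℝ (X.1 x))

theorem val_add (X Y : F.sections) (x : M) : F.val (X + Y) x = F.val X x + F.val Y x := rfl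

theorem val_smul (f : SmoothAlg E M) (X : F.sections) (x : M) :
    F.val (f • X) x = f x • F.val X x := rfl

noncomputable instance sectionsLieRing : LieRing F.sections :=
  { (inferInstance : AddCommGroup F.sections) with
    bracket := F.bracket
    add_lie := fun X Y Z => Subtype.ext (funext fun x =>
      VectorField.mlieBracket_add_left (X.2.1.mdiff x) (Y.2.1.mdiff x))
    lie_add := fun X Y Z => Subtype.ext (funext fun x =>
      VectorField.mlieBracket_add_right (Y.2.1.mdiff x) (Z.2.1.mdiff x))
    lie_self := fun X => Subtype.ext VectorField.mlieBracket_self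
    leibniz_lie := fun X Y Z => Subtype.ext (by
      have hle : minSmoothness ℝ 2 ≤ ((⊤ : ℕ∞) : WithTop ℕ∞) := by
        rw [minSmoothness_of_isRCLikeNormedField]; exact ENat.LEInfty.out
      have : CompleteSpace E := FiniteDimensional.complete ℝ E
      have : IsManifold 𝓘(ℝ, E) (minSmoothness ℝ 3) M := by
        rw [minSmoothness_of_isRCLikeNormedField]
        exact IsManifold.of_le (n := ∞) ENat.LEInfty.out
      exact VectorField.leibniz_identity_mlieBracket (X.2.1.of_le hle) (Y.2.1.of_le hle)
        (Z.2.1.of_le hle)) }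

theorem lie_eq_bracket (X Y : F.sections) : ⁅X, Y⁆ = F.bracket X Y := rfl

noncomputable instance sectionsBracket : Bracket F.sections (SmoothAlg E M) where
  bracket X f := ⟨act X.1 f, act_smooth X.2.1 f.contMDiff⟩

noncomputable instance sectionsLieRingModule : LieRingModule F.sections (SmoothAlg E M) where
  add_lie X Y f := ContMDiffMap.ext fun x => map_add (dif f x) (X.1 x) (Y.1 x)
  lie_add X f g := ContMDiffMap.ext fun x =>
    LinearMap.congr_fun (dif_add f.contMDiff g.contMDiff x) (X.1 x)
  leibniz_lie X Y f := ContMDiffMap.ext fun x => by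
    have : CompleteSpace E := FiniteDimensional.complete ℝ E
    have := act_br X.2.1 Y.2.1 f.contMDiff x
    change act X.1 (act Y.1 f) x = act (br X.1 Y.1) f x + act Y.1 (act X.1 f) x
    linarith

instance sectionsLieRinehart : LieRinehartRing (SmoothAlg E M) F.sections where
  lie_smul_eq_mul' f g X := ContMDiffMap.ext fun x => map_smul (dif g x) (f x) (X.1 x)
  leibniz_mul_right' X f g := ContMDiffMap.ext fun x => by
    have := LinearMap.congr_fun (dif_mul f.contMDiff g.contMDiff x) (X.1 x)
    refine Eq.trans this ?_
    change f x * act X.1 g x + g x * act X.1 f x = f x * act X.1 g x + act X.1 f x * g x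
    ring
  leibniz_smul_right' X Y f := Subtype.ext (funext fun x => by
    refine (VectorField.mlieBracket_smul_right (f.contMDiff.mdifferentiable (by simp) x)
      (Y.2.1.mdiff x)).trans ?_
    exact add_comm _ _)

end RegularFoliation

end Sections

/-! ## Tensoriality -/

section Tensoriality

open Function

variable {E : Type*} [NormedAddCommGroup E] [NormedSpace ℝ E] [FiniteDimensional ℝ E]
  {M : Type*} [TopologicalSpace M] [T2Space M] [ChartedSpace E M] [IsManifold 𝓘(ℝ, E) ∞ M] {k : ℕ}

instance (x : M) : FiniteDimensional ℝ (TangentSpace 𝓘(ℝ, E) x) :=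
  inferInstanceAs (FiniteDimensional ℝ E)

/-- The differentials at `x` of global functions form a subspace of the dual that separates vectors,
hence the whole dual in finite dimension. -/
theorem exists_dif_eq (x : M) (ℓ : Module.Dual ℝ (TangentSpace 𝓘(ℝ, E) x)) :
    ∃ f : M → ℝ, SmoothFun E f ∧ dif f x = ℓ := by
  let S : Submodule ℝ (Module.Dual ℝ (TangentSpace 𝓘(ℝ, E) x)) :=
    { carrier := {ℓ | ∃ f : M → ℝ, SmoothFun E f ∧ dif f x = ℓ}
      zero_mem' := ⟨0, smoothFun_zero, dif_zero x⟩
      add_mem' := by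
        rintro _ _ ⟨f, hf, rfl⟩ ⟨g, hg, rfl⟩
        exact ⟨f + g, ContMDiff.add hf hg, dif_add hf hg x⟩
      smul_mem' := by
        rintro c _ ⟨f, hf, rfl⟩
        exact ⟨c • f, smoothFun_smul c hf, dif_smul hf c x⟩ }
  have hS : S.dualCoannihilator = ⊥ := by
    rw [eq_bot_iff]
    intro v hv
    by_contra hne
    obtain ⟨f, hf, h⟩ := exists_dif x v hne
    exact h ((Submodule.mem_dualCoannihilator v).mp hv _ ⟨f, hf, rfl⟩)
  have hT : S = ⊤ := by
    rw [← Subspace.dualCoannihilator_dualAnnihilator_eq (W := S), hS]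
    simp
  exact (hT ▸ Submodule.mem_top : ℓ ∈ S)

/-- A global smooth vector field with a given value. -/
theorem exists_smoothField (x : M) (v : TangentSpace 𝓘(ℝ, E) x) :
    ∃ X : VField E M, SmoothField X ∧ X x = v := by
  obtain ⟨s, hs, hZ⟩ := FiberBundle.exists_contMDiffOn_extend (k := ∞) 𝓘(ℝ, E) E v
  obtain ⟨b, -, hb⟩ := ((SmoothBumpFunction.nhds_basis_tsupport (I := 𝓘(ℝ, E)) x).mem_iff).mp
    (interior_mem_nhds.mpr hs)
  refine ⟨(b : M → ℝ) • FiberBundle.extend E v, ?_, ?_⟩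
  · exact ContMDiffOn.smul_section_of_tsupport b.contMDiff.contMDiffOn isOpen_interior hb
      (hZ.mono interior_subset)
  · simp

/-- A smooth function equal to one at `x` and vanishing outside a given neighbourhood. -/
theorem exists_bump {x : M} {U : Set M} (hU : U ∈ 𝓝 x) :
    ∃ χ : SmoothAlg E M, χ x = 1 ∧ ∀ y, y ∉ U → χ y = 0 := by
  obtain ⟨b, -, hb⟩ := ((SmoothBumpFunction.nhds_basis_tsupport (I := 𝓘(ℝ, E)) x).mem_iff).mp hU
  exact ⟨⟨b, b.contMDiff⟩, b.eq_one, fun y hy => image_eq_zero_of_notMem_tsupport fun h => hy (hb h)⟩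

theorem vec_ext {x : M} {v w : TangentSpace 𝓘(ℝ, E) x}
    (h : ∀ f : M → ℝ, SmoothFun E f → dif f x v = dif f x w) : v = w := by
  by_contra hne
  obtain ⟨f, hf, h'⟩ := exists_dif x _ (sub_ne_zero.mpr hne)
  exact h' (by rw [map_sub, h f hf, sub_self])

namespace RegularFoliation

variable (F : RegularFoliation E M k) {n : ℕ}

/-- The foliation with a single leaf. -/
noncomputable def full (hn : Module.finrank ℝ E = n) : RegularFoliation E M n where
  tangent x := ⊤
  finrank_tangent x := by rw [finrank_top]; exact hn
  exists_section x v _ := by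
    obtain ⟨X, hX, h⟩ := exists_smoothField x v
    exact ⟨X, hX, fun _ => Submodule.mem_top, h⟩
  involutive _ _ _ _ _ _ _ := Submodule.mem_top

theorem exists_val_eq (x : M) (v : F.tangent x) : ∃ X : F.sections, F.val X x = v := by
  obtain ⟨X, hX, h, e⟩ := F.exists_section x v.1 v.2
  exact ⟨⟨X, hX, h⟩, Subtype.ext e⟩

theorem exists_val_tuple (x : M) (v : Fin n → F.tangent x) :
    ∃ X : Fin n → F.sections, ∀ i, F.val (X i) x = v i := by
  choose X hX using fun i => F.exists_val_eq x (v i)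
  exact ⟨X, hX⟩

theorem val_update (Y : Fin n → F.sections) (i : Fin n) (p : F.sections) (x : M) :
    (fun j => F.val (update Y i p j) x) = update (fun j => F.val (Y j) x) i (F.val p x) := by
  funext j
  exact apply_update (fun _ X => F.val X x) Y i p j

/-- A smooth foliated form as an alternating map on tangent sections. -/
noncomputable def toAlt (η : F.FolForm n) (hη : ∀ X, SmoothFun E (F.folEval η X)) :
    F.sections [⋀^Fin n]→ₗ[SmoothAlg E M] SmoothAlg E M where
  toFun Y := ⟨F.folEval η Y, hη Y⟩
  map_update_add' := by
    intro dec Y i p q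
    obtain rfl : dec = instDecidableEqFin n := Subsingleton.elim _ _
    refine ContMDiffMap.ext fun x => ?_
    change η x (fun j => F.val _ x) = η x (fun j => F.val _ x) + η x (fun j => F.val _ x)
    simp only [val_update, val_add, (η x).map_update_add]
  map_update_smul' := by
    intro dec Y i f p
    obtain rfl : dec = instDecidableEqFin n := Subsingleton.elim _ _
    refine ContMDiffMap.ext fun x => ?_
    change η x (fun j => F.val _ x) = f x • η x (fun j => F.val _ x)
    simp only [val_update, val_smul, (η x).map_update_smul]
  map_eq_zero_of_eq' := by
    intro Y i j h hij
    exact ContMDiffMap.ext fun x => (η x).map_eq_zero_of_eq _ (by rw [h]) hij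

theorem toAlt_apply (η : F.FolForm n) (hη : ∀ X, SmoothFun E (F.folEval η X))
    (Y : Fin n → F.sections) (x : M) : F.toAlt η hη Y x = η x (fun i => F.val (Y i) x) := rfl

/-- A determinant of `k` differentials of global functions, chosen to restrict to a dual basis at
`x`. It is smooth everywhere and may vanish away from `x`; it exists without any orientability and
takes the place of a local frame. -/
theorem exists_local_volume (x : M) : ∃ β : F.FolForm k,
    (∀ X, SmoothFun E (F.folEval β X)) ∧ β x ≠ 0 := by
  let b := Module.finBasisOfFinrankEq ℝ (F.tangent x) (F.finrank_tangent x)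
  have hf : ∀ i, ∃ f : M → ℝ, SmoothFun E f ∧ (dif f x).comp (F.tangent x).subtype = b.coord i := by
    intro i
    obtain ⟨g, hg⟩ := (b.coord i).exists_extend
    obtain ⟨f, hf, e⟩ := exists_dif_eq x g
    exact ⟨f, hf, by rw [e, hg]⟩
  choose f hf hfb using hf
  refine ⟨fun y => (Matrix.detRowAlternating (R := ℝ) (n := Fin k)).compLinearMap
    (LinearMap.pi fun i => (dif (f i) y).comp (F.tangent y).subtype), fun X => ?_, fun h => ?_⟩
  · have e : F.folEval (fun y => (Matrix.detRowAlternating (R := ℝ) (n := Fin k)).compLinearMap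
        (LinearMap.pi fun i => (dif (f i) y).comp (F.tangent y).subtype)) X
        = ((Matrix.of fun i j => (⁅X i, (⟨f j, hf j⟩ : SmoothAlg E M)⁆ : SmoothAlg E M)).det :
          SmoothAlg E M) := by
      funext y
      have := RingHom.map_det (ContMDiffMap.evalRingHom y : SmoothAlg E M →+* ℝ)
        (Matrix.of fun i j => (⁅X i, (⟨f j, hf j⟩ : SmoothAlg E M)⁆ : SmoothAlg E M))
      exact this.symm
    rw [e]
    exact ContMDiffMap.contMDiff _
  · have h1 := congrArg (fun η => η (fun i => b i)) h
    have h2 : (Matrix.of fun i j => b.coord j (b i) : Matrix (Fin k) (Fin k) ℝ) = 1 := by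
      ext i j
      simp [Matrix.one_apply, Finsupp.single_apply]
    have h3 : (Matrix.of fun i j => ((dif (f j) x).comp (F.tangent x).subtype) (b i) :
      Matrix (Fin k) (Fin k) ℝ).det = 0 := h1
    simp only [hfb] at h3
    rw [h2, Matrix.det_one] at h3
    exact one_ne_zero h3

/-- Linear maps over the smooth functions are tensorial. -/
theorem linear_apply_eq_zero (φ : F.sections →ₗ[SmoothAlg E M] SmoothAlg E M) {X : F.sections}
    {x : M} (hX : F.val X x = 0) : φ X x = 0 := by
  obtain ⟨β, hβ, hx⟩ := F.exists_local_volume x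
  obtain ⟨v, hv⟩ := exists_ne_zero_apply hx
  obtain ⟨e, he⟩ := F.exists_val_tuple x v
  set B := F.toAlt β hβ with hB
  -- Cramer's rule holds at every point, even where `β` vanishes, so it is an identity of global
  -- sections to which `φ` applies. At `x` all coefficients on the right vanish with `X`, while `B
  -- e` does not.
  have key : B e • X = ∑ i, B (update e i X) • e i := by
    have : ∀ y, F.val (B e • X) y = F.val (∑ i, B (update e i X) • e i) y := by
      intro y
      have h1 := cramer_identity (F.finrank_tangent y) (β y) (F.val X y) (fun i => F.val (e i) y)
      have h2 : ∀ t : Finset (Fin k), F.val (∑ i ∈ t, B (update e i X) • e i) y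
          = ∑ i ∈ t, B (update e i X) y • F.val (e i) y := by
        intro t
        induction t using Finset.induction_on with
        | empty => rfl
        | insert a t ha ih => rw [Finset.sum_insert ha, Finset.sum_insert ha, val_add, ih]; rfl
      rw [h2, val_smul]
      simp only [hB, toAlt_apply, val_update]
      exact h1
    exact Subtype.ext (funext fun y => congrArg Subtype.val (this y))
  have h1 := congrArg (fun f : SmoothAlg E M => f x) (congrArg φ key)
  simp only [map_smul, map_sum] at h1
  have ev : ∀ g : Fin k → SmoothAlg E M, (∑ i, g i) x = ∑ i, g i x := fun g =>
    map_sum (ContMDiffMap.evalRingHom x : SmoothAlg E M →+* ℝ) g Finset.univ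
  rw [ev] at h1
  have h2 : B e x * φ X x = 0 := by
    refine h1.trans (Finset.sum_eq_zero fun i _ => ?_)
    change B (update e i X) x * _ = 0
    rw [hB, toAlt_apply, val_update, hX, (β x).map_update_zero, zero_mul]
  refine (mul_eq_zero.mp h2).resolve_left ?_
  rw [hB, toAlt_apply]
  simpa only [he] using hv

/-- Evaluation at a point. -/
noncomputable def evalAt (x : M) : F.sections →ₗ[ℝ] F.tangent x where
  toFun X := F.val X x
  map_add' _ _ := rfl
  map_smul' _ _ := rfl

theorem const_smul (c : ℝ) (X : F.sections) : c • X = (ContMDiffMap.C c : SmoothAlg E M) • X := rfl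

/-- By tensoriality `Λ` vanishes at `x` once one argument does, so it descends along the surjective
evaluation map. -/
theorem exists_pointForm (Λ : F.sections [⋀^Fin n]→ₗ[SmoothAlg E M] SmoothAlg E M) (x : M) :
    ∃ θ : F.tangent x [⋀^Fin n]→ₗ[ℝ] ℝ, ∀ Y, Λ Y x = θ (fun i => F.val (Y i) x) := by
  let Λx : F.sections [⋀^Fin n]→ₗ[ℝ] ℝ :=
    { toFun := fun Y => Λ Y x
      map_update_add' := by
        intro dec Y i p q
        obtain rfl : dec = instDecidableEqFin n := Subsingleton.elim _ _
        rw [Λ.map_update_add]; rfl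
      map_update_smul' := by
        intro dec Y i c p
        obtain rfl : dec = instDecidableEqFin n := Subsingleton.elim _ _
        rw [const_smul, Λ.map_update_smul]; rfl
      map_eq_zero_of_eq' := by
        intro Y i j h hij
        rw [Λ.map_eq_zero_of_eq Y h hij]; rfl }
  refine exists_descent (F.evalAt x) (F.exists_val_eq x) Λx fun Y i hi => ?_
  have := F.linear_apply_eq_zero (Λ.toMultilinearMap.toLinearMap Y i) (X := Y i) hi
  change Λ Y x = 0
  simpa using this

theorem exists_pointLinear (φ : F.sections →ₗ[SmoothAlg E M] SmoothAlg E M) (x : M) :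
    ∃ θ : F.tangent x →ₗ[ℝ] ℝ, ∀ X, φ X x = θ (F.val X x) := by
  obtain ⟨θ, hθ⟩ := F.exists_pointForm (AlternatingMap.ofSubsingleton _ _ _ (0 : Fin 1) φ) x
  exact ⟨(AlternatingMap.ofSubsingleton _ _ _ (0 : Fin 1)).symm θ, fun X => hθ fun _ => X⟩

/-- Pointwise proportional forms are proportional over the smooth functions. -/
theorem exists_eq_smul {η Λ : F.sections [⋀^Fin n]→ₗ[SmoothAlg E M] SmoothAlg E M}
    (hη : ∀ x, ∃ Y, η Y x ≠ 0) (h : ∀ x, ∃ c : ℝ, ∀ Y, Λ Y x = c * η Y x) :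
    ∃ c : SmoothAlg E M, Λ = c • η := by
  choose c hc using h
  -- Near each point the factor is a quotient of two smooth functions, both forms being evaluated on
  -- one fixed tuple.
  have hs : SmoothFun E c := by
    intro x
    obtain ⟨Y, hY⟩ := hη x
    have h1 : ContMDiffAt 𝓘(ℝ, E) 𝓘(ℝ, ℝ) ∞ (fun y => Λ Y y / η Y y) x :=
      ((Λ Y).contMDiff x).div₀ ((η Y).contMDiff x) hY
    refine h1.congr_of_eventuallyEq ?_
    filter_upwards [((η Y).contMDiff x).continuousAt.eventually_ne hY] with y hy
    rw [hc, mul_div_cancel_right₀ _ hy]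
  exact ⟨⟨c, hs⟩, AlternatingMap.ext fun Y => ContMDiffMap.ext fun x => hc x Y⟩

theorem smul_form_cancel {η : F.sections [⋀^Fin n]→ₗ[SmoothAlg E M] SmoothAlg E M}
    (hη : ∀ x, ∃ Y, η Y x ≠ 0) {c d : SmoothAlg E M} (h : c • η = d • η) : c = d := by
  refine ContMDiffMap.ext fun x => ?_
  obtain ⟨Y, hY⟩ := hη x
  have := congrArg (fun f : SmoothAlg E M => f x) (congrArg (fun Λ => Λ Y) h)
  exact mul_right_cancel₀ hY this

theorem exists_toAlt_ne_zero {η : F.FolForm n} (hη : ∀ X, SmoothFun E (F.folEval η X))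
    (h : ∀ x, η x ≠ 0) (x : M) : ∃ Y, F.toAlt η hη Y x ≠ 0 := by
  obtain ⟨v, hv⟩ := exists_ne_zero_apply (h x)
  obtain ⟨Y, hY⟩ := F.exists_val_tuple x v
  exact ⟨Y, by rw [toAlt_apply]; simpa only [hY] using hv⟩

end RegularFoliation

end Tensoriality

/-! ## Divergences and their modular vector fields -/

section Divergence

open Function

variable {E : Type*} [NormedAddCommGroup E] [NormedSpace ℝ E] [FiniteDimensional ℝ E]
  {M : Type*} [TopologicalSpace M] [T2Space M] [ChartedSpace E M] [IsManifold 𝓘(ℝ, E) ∞ M] {k : ℕ}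

theorem act_congr {X : VField E M} {f g : M → ℝ} {x : M} (h : f =ᶠ[𝓝 x] g) :
    act X f x = act X g x := by
  unfold act
  rw [dif_congr h]

namespace RegularFoliation

variable {F : RegularFoliation E M k}

/-- A divergence operator on the tangent sections: a flat right connection on functions. -/
structure IsDivergence (δ : F.sections →+ SmoothAlg E M) : Prop where
  smul : ∀ (f : SmoothAlg E M) (X : F.sections), δ (f • X) = f * δ X + ⁅X, f⁆
  lie : ∀ X Y : F.sections, δ ⁅X, Y⁆ = ⁅X, δ Y⁆ - ⁅Y, δ X⁆

/-- A divergence is local: for a bump function `χ` with `χ • (X - Y) = 0` and `χ x = 1`, the product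
rule leaves only the difference at `x`, since `X - Y` vanishes there. -/
theorem IsDivergence.congr {δ : F.sections →+ SmoothAlg E M} (hδ : IsDivergence δ)
    {X Y : F.sections} {x : M} (h : ∀ᶠ y in 𝓝 x, X.1 y = Y.1 y) : δ X x = δ Y x := by
  obtain ⟨χ, h1, h0⟩ := exists_bump (E := E) h
  have e : χ • (X - Y) = 0 := by
    refine Subtype.ext (funext fun y => ?_)
    by_cases hy : X.1 y = Y.1 y
    · change χ y • (X.1 y - Y.1 y) = 0
      rw [hy, sub_self, smul_zero]
    · change χ y • (X.1 y - Y.1 y) = 0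
      rw [h0 y hy, zero_smul]
  have hs := hδ.smul χ (X - Y)
  rw [e, map_zero, map_sub] at hs
  have hx := congrArg (fun f : SmoothAlg E M => f x) hs
  have ha : act (X - Y : F.sections).1 χ x = 0 := by
    have : (X - Y : F.sections).1 x = 0 := sub_eq_zero.mpr h.self_of_nhds
    rw [act, this, map_zero]
  change 0 = χ x * (δ X x - δ Y x) + act (X - Y : F.sections).1 χ x at hx
  rw [ha, h1] at hx
  linarith

/-! ### Divergence of a leaf-wise volume form -/

section Volume

variable {τ : F.FolForm k}

theorem IsLeafVolume.smooth (hτ : F.IsLeafVolume τ) : ∀ X, SmoothFun E (F.folEval τ X) := hτ.1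

theorem IsLeafVolume.ne_zero (hτ : F.IsLeafVolume τ) : ∀ x, τ x ≠ 0 := hτ.2

theorem exists_lieForm_eq_smul (hτ : F.IsLeafVolume τ) (X : F.sections) :
    ∃ c : SmoothAlg E M, lieForm X (F.toAlt τ hτ.smooth) = c • F.toAlt τ hτ.smooth := by
  refine F.exists_eq_smul (F.exists_toAlt_ne_zero hτ.smooth hτ.ne_zero) fun x => ?_
  obtain ⟨θ, hθ⟩ := F.exists_pointForm (lieForm X (F.toAlt τ hτ.smooth)) x
  obtain ⟨c, hc⟩ := exists_eq_smul_of_finrank_eq (F.finrank_tangent x) (hτ.ne_zero x) θ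
  exact ⟨c, fun Y => by rw [hθ, hc]; rfl⟩

theorem trace_identity_sections (hτ : F.IsLeafVolume τ) (f : SmoothAlg E M) (X : F.sections)
    (Y : Fin k → F.sections) :
    ∑ i, ⁅Y i, f⁆ * F.toAlt τ hτ.smooth (update Y i X) = ⁅X, f⁆ * F.toAlt τ hτ.smooth Y := by
  refine ContMDiffMap.ext fun x => ?_
  have h := trace_identity (F.finrank_tangent x) (τ x)
    ((dif f x).comp (F.tangent x).subtype) (F.val X x) (fun i => F.val (Y i) x)
  refine (map_sum (ContMDiffMap.evalRingHom x : SmoothAlg E M →+* ℝ) _ Finset.univ).trans ?_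
  refine Eq.trans ?_ h
  refine Finset.sum_congr rfl fun i _ => ?_
  rw [← val_update]
  rfl

/-- The divergence of a leaf-wise volume form: `L_X τ = δ(X) τ`. -/
theorem exists_divergence (hτ : F.IsLeafVolume τ) : ∃ δ : F.sections →+ SmoothAlg E M,
    IsDivergence δ ∧ ∀ X, lieForm X (F.toAlt τ hτ.smooth) = δ X • F.toAlt τ hτ.smooth := by
  choose δ hδ using F.exists_lieForm_eq_smul hτ
  have hne := F.exists_toAlt_ne_zero hτ.smooth hτ.ne_zero
  have hadd : ∀ X Y, δ (X + Y) = δ X + δ Y := fun X Y =>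
    F.smul_form_cancel hne (by rw [← hδ, lieForm_add_left, hδ, hδ, add_smul])
  refine ⟨AddMonoidHom.mk' δ hadd, ⟨fun f X => ?_, fun X Y => ?_⟩, hδ⟩
  · refine F.smul_form_cancel hne (AlternatingMap.ext fun Y => ?_)
    change δ (f • X) * F.toAlt τ hτ.smooth Y = (f * δ X + ⁅X, f⁆) * F.toAlt τ hτ.smooth Y
    have h1 := congrArg (fun Λ => Λ Y) (hδ (f • X))
    have h2 := congrArg (fun Λ => Λ Y) (hδ X)
    simp only [AlternatingMap.smul_apply, smul_eq_mul] at h1 h2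
    -- The term `df ∧ i_X τ` equals `X(f) τ` because `df ∧ τ = 0` along the leaves.
    rw [← h1, lieForm_smul_left, h2, trace_identity_sections hτ]
    ring
  · refine F.smul_form_cancel hne ?_
    change δ ⁅X, Y⁆ • F.toAlt τ hτ.smooth = (⁅X, δ Y⁆ - ⁅Y, δ X⁆) • F.toAlt τ hτ.smooth
    -- From `L_[X,Y] = [L_X, L_Y]`; the products `δ(X) δ(Y)` cancel.
    rw [← hδ, lieForm_lie, hδ, hδ, lieForm_smul, lieForm_smul, hδ, hδ]
    refine AlternatingMap.ext fun W => ?_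
    simp only [AlternatingMap.sub_apply, AlternatingMap.add_apply, AlternatingMap.smul_apply,
      smul_eq_mul]
    ring

end Volume

/-- The foliated one-form of a linear map on tangent sections. -/
theorem exists_oneForm (φ : F.sections →ₗ[SmoothAlg E M] SmoothAlg E M) :
    ∃ μ : F.OneForm, ∀ X, F.pair μ X = φ X := by
  choose μ hμ using F.exists_pointLinear φ
  exact ⟨μ, fun X => funext fun x => (hμ x X).symm⟩

theorem OneForm.ext_pair {μ ν : F.OneForm} (h : ∀ X, F.pair μ X = F.pair ν X) : μ = ν := by
  refine funext fun x => LinearMap.ext fun v => ?_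
  obtain ⟨X, rfl⟩ := F.exists_val_eq x v
  exact congrFun (h X) x

/-- The values of a smooth foliated one-form as smooth functions. -/
noncomputable def pairAlg {μ : F.OneForm} (hμ : ∀ X, SmoothFun E (F.pair μ X)) (X : F.sections) :
    SmoothAlg E M := ⟨F.pair μ X, hμ X⟩

end RegularFoliation

/-! ### Hamiltonian fields and the modular field of a divergence -/

namespace LeafPoisson

open RegularFoliation

variable {F : RegularFoliation E M k} (P : LeafPoisson F)

/-- Hamiltonian vector fields as tangent sections. -/
noncomputable def ham (f : SmoothAlg E M) : F.sections :=
  ⟨hamField P.onM f, by rw [hamField_eq]; exact P.sharpFol_mem (folDif_smooth f.contMDiff)⟩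

theorem val_ham (f : SmoothAlg E M) (x : M) :
    F.val (P.ham f) x = sharp (P.toFun x) (F.folDif f x) :=
  Subtype.ext (congrFun (hamField_eq P f) x)

theorem ham_skew (f g : SmoothAlg E M) : ⁅P.ham f, g⁆ = -⁅P.ham g, f⁆ :=
  ContMDiffMap.ext fun _ => sharp_skew _ _ _

theorem sections_ext {X Y : F.sections} (h : ∀ f : SmoothAlg E M, ⁅X, f⁆ = ⁅Y, f⁆) : X = Y :=
  Subtype.ext (funext fun x => vec_ext fun f hf =>
    congrArg (fun g : SmoothAlg E M => g x) (h ⟨f, hf⟩))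

/-- The Jacobi identity, read as an equality of derivations applied to a third function. -/
theorem lie_ham (f g : SmoothAlg E M) : ⁅P.ham f, P.ham g⁆ = P.ham ⁅P.ham f, g⁆ := by
  refine sections_ext fun h => ?_
  have J : ⁅P.ham f, ⁅P.ham g, h⁆⁆ + ⁅P.ham g, ⁅P.ham h, f⁆⁆ + ⁅P.ham h, ⁅P.ham f, g⁆⁆ = 0 :=
    ContMDiffMap.ext fun x => P.jacobi f g h f.contMDiff g.contMDiff h.contMDiff x
  rw [P.ham_skew h f, P.ham_skew h, lie_neg] at J
  rw [lie_lie]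
  linear_combination J

/-- The local expression of the modular vector field of a divergence. -/
noncomputable def localModular (δ : F.sections → SmoothAlg E M) {m : ℕ} (X Y : Fin m → F.sections) :
    F.sections :=
  ∑ i, (δ (Y i) • X i - δ (X i) • Y i - ⁅X i, Y i⁆)

theorem sum_lie {m : ℕ} (X : Fin m → F.sections) (f : SmoothAlg E M) :
    ⁅∑ i, X i, f⁆ = ∑ i, ⁅X i, f⁆ := by
  let B : F.sections →+ SmoothAlg E M := AddMonoidHom.mk' (fun X => ⁅X, f⁆) fun X Y => add_lie X Y f
  exact map_sum B X Finset.univ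

/-- The product rule for `δ` yields `Y_i X_i f - X_i Y_i f`, which is minus the bracket term of
`localModular`. -/
theorem localModular_lie {δ : F.sections →+ SmoothAlg E M} (hδ : IsDivergence δ) {m : ℕ}
    (X Y : Fin m → F.sections) (f : SmoothAlg E M) :
    ⁅localModular δ X Y, f⁆ = δ (∑ i, (⁅X i, f⁆ • Y i - ⁅Y i, f⁆ • X i)) := by
  rw [localModular, sum_lie, map_sum]
  refine Finset.sum_congr rfl fun i _ => ?_
  rw [map_sub, hδ.smul, hδ.smul, sub_lie, sub_lie, lie_lie,
    LieRinehartRing.lie_smul_eq_mul, LieRinehartRing.lie_smul_eq_mul]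
  ring

theorem sections_sum_apply {m : ℕ} (X : Fin m → F.sections) (x : M) :
    (∑ i, X i).1 x = ∑ i, (X i).1 x := by
  let B : F.sections →+ TangentSpace 𝓘(ℝ, E) x := AddMonoidHom.mk' (fun X => X.1 x) fun _ _ => rfl
  exact map_sum B X Finset.univ

theorem ham_eventuallyEq {m : ℕ} {X Y : Fin m → F.sections} {x₀ : M}
    (h : ∀ᶠ x in 𝓝 x₀, P.toFun x = ∑ i, wedgeVec (F.val (X i) x) (F.val (Y i) x))
    (f : SmoothAlg E M) :
    ∀ᶠ x in 𝓝 x₀, (P.ham f).1 x = (∑ i, (⁅X i, f⁆ • Y i - ⁅Y i, f⁆ • X i)).1 x := by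
  filter_upwards [h] with x hx
  rw [sections_sum_apply]
  refine (congrArg Subtype.val (P.val_ham f x)).trans ?_
  simp only [hx, map_sum, LinearMap.sum_apply, sharp_wedgeVec, Submodule.coe_sum]
  rfl

/-- The modular vector field of a divergence. -/
theorem exists_modular {δ : F.sections →+ SmoothAlg E M} (hδ : IsDivergence δ) :
    ∃ Z : F.sections, ∀ f : SmoothAlg E M, ⁅Z, f⁆ = δ (P.ham f) := by
  choose m X Y hXY using P.smooth
  -- On a neighbourhood of `x₀` the local expression built there represents `f ↦ δ(P^♯ df)`. As this
  -- operator does not depend on the decomposition of `P`, the local expressions agree and glue.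
  have key : ∀ x₀, ∀ᶠ x in 𝓝 x₀, ∀ f : SmoothAlg E M,
      dif f x ((localModular δ (X x₀) (Y x₀)).1 x) = δ (P.ham f) x := by
    intro x₀
    filter_upwards [(hXY x₀).eventually_nhds] with x hx f
    rw [hδ.congr (P.ham_eventuallyEq hx f), ← localModular_lie hδ]
    rfl
  have hZ : ∀ x₀, ∀ᶠ x in 𝓝 x₀, (localModular δ (X x) (Y x)).1 x
      = (localModular δ (X x₀) (Y x₀)).1 x := by
    intro x₀
    filter_upwards [key x₀] with x hx
    exact vec_ext fun f hf => ((key x).self_of_nhds ⟨f, hf⟩).trans (hx ⟨f, hf⟩).symm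
  refine ⟨⟨fun x => (localModular δ (X x) (Y x)).1 x, fun x₀ => ?_, fun x => ?_⟩, fun f => ?_⟩
  · refine ((localModular δ (X x₀) (Y x₀)).2.1 x₀).congr_of_eventuallyEq ?_
    filter_upwards [hZ x₀] with x hx
    rw [hx]
  · exact (localModular δ (X x) (Y x)).2.2 x
  · exact ContMDiffMap.ext fun x => (key x).self_of_nhds f

/-- `Z{f,g} = δ[P^♯ df, P^♯ dg]`, and flatness of `δ` splits this into `{f, Zg} - {g, Zf}`. -/
theorem modular_mem {δ : F.sections →+ SmoothAlg E M} (hδ : IsDivergence δ) {Z : F.sections}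
    (hZ : ∀ f : SmoothAlg E M, ⁅Z, f⁆ = δ (P.ham f)) : Z.1 ∈ P.folPoiss := by
  refine ⟨Z.2, Z.2.1, fun f g hf hg x => ?_⟩
  let f' : SmoothAlg E M := ⟨f, hf⟩
  let g' : SmoothAlg E M := ⟨g, hg⟩
  have h : ⁅Z, ⁅P.ham f', g'⁆⁆ = ⁅P.ham ⁅Z, f'⁆, g'⁆ + ⁅P.ham f', ⁅Z, g'⁆⁆ := by
    rw [hZ, ← lie_ham, hδ.lie, P.ham_skew _ g', hZ, hZ]
    ring
  exact congrArg (fun f : SmoothAlg E M => f x) h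

/-- Skewness of `P^♯`; the minus sign in the final formula originates here. -/
theorem pair_ham {μ : F.OneForm} (hμ : ∀ X, SmoothFun E (F.pair μ X)) (f : SmoothAlg E M) :
    ⁅(⟨P.sharpFol μ, P.sharpFol_mem hμ⟩ : F.sections), f⁆ = -pairAlg hμ (P.ham f) := by
  refine ContMDiffMap.ext fun x => ?_
  have := sharp_skew (P.toFun x) (μ x) (F.folDif f x)
  rw [← P.val_ham] at this
  exact this

end LeafPoisson

end Divergence

/-! ## The foliated modular vector field -/

section LieRinehart

open Function

variable {A L : Type*} [CommRing A] [Algebra ℝ A] [LieRing L] [Module A L] [LieRingModule L A]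
  [LieRinehartRing A L] {n : ℕ}

theorem ceDiff_add (η θ : (Fin n → L) → A) (X : Fin (n + 1) → L) :
    ceDiff (fun Y => η Y + θ Y) X = ceDiff η X + ceDiff θ X := by
  have : ∀ (p : Prop) [Decidable p] (a b : A),
    (if p then a + b else 0) = (if p then a else 0) + if p then b else 0 := by
    intro p _ a b; split_ifs <;> simp
  simp only [ceDiff, lie_add, mul_add, Finset.sum_add_distrib, this]
  ring

theorem ceDiff_sum {ι : Type*} (t : Finset ι) (η : ι → (Fin n → L) → A) (X : Fin (n + 1) → L) :
    ceDiff (fun Y => ∑ i ∈ t, η i Y) X = ∑ i ∈ t, ceDiff (η i) X := by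
  classical
  induction t using Finset.induction_on with
  | empty => simp [ceDiff]
  | insert a t ha ih => simp only [Finset.sum_insert ha, ceDiff_add, ih]

/-- `d i_X i_Y τ = - i_Z τ` with `Z = δ(Y) X - δ(X) Y - [X, Y]`, for a closed form `τ` with
divergence `δ`. -/
theorem ceDiff_curry_curry {τ : L [⋀^Fin (n + 2)]→ₗ[A] A} (h0 : ∀ V, ceDiff τ V = 0) {δ : L → A}
    (hδ : ∀ X, lieForm X τ = δ X • τ) (X Y : L) (W : Fin (n + 1) → L) :
    ceDiff (fun U => τ (Fin.cons Y (Fin.cons X U : Fin (n + 1) → L))) W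
      = -τ (Fin.cons (δ Y • X - δ X • Y - ⁅X, Y⁆) W) := by
  -- Cartan's formula gives `d i_X i_Y τ = L_X i_Y τ - i_X d i_Y τ`. Closedness of `τ` replaces `d
  -- i_Y τ` by `L_Y τ`, and `[L_X, i_Y] = i_[X,Y]` finishes.
  have h1 : ceDiff (fun U => τ (Fin.cons Y (Fin.cons X U : Fin (n + 1) → L))) W
      = lieForm X (τ.curryLeft Y) W - ceDiff (τ.curryLeft Y) (Fin.cons X W) := by
    have := ceDiff_cons (τ.curryLeft Y) X W
    rw [this, sub_sub_cancel]
    rfl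
  have h2 : ceDiff (τ.curryLeft Y) (Fin.cons X W) = lieForm Y τ (Fin.cons X W) := by
    have := ceDiff_cons τ Y (Fin.cons X W)
    rw [h0] at this
    linear_combination this
  have h3 := lieForm_cons X Y τ W
  have e1 : τ (Fin.cons (δ Y • X - δ X • Y - ⁅X, Y⁆) W)
      = δ Y * τ (Fin.cons X W) - δ X * τ (Fin.cons Y W) - τ (Fin.cons ⁅X, Y⁆ W) := by
    have hs : ∀ U V : L, τ (Fin.cons (U - V) W) = τ (Fin.cons U W) - τ (Fin.cons V W) := by
      intro U V
      have := map_sub (τ.toMultilinearMap.toLinearMap (Fin.cons 0 W) 0) U V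
      simp only [MultilinearMap.toLinearMap_apply, Fin.update_cons_zero] at this
      exact this
    have hm : ∀ (f : A) (U : L), τ (Fin.cons (f • U) W) = f * τ (Fin.cons U W) := fun f U =>
      τ.toMultilinearMap.cons_smul W f U
    rw [hs, hs, hm, hm]
  rw [hδ] at h2 h3
  rw [h1, h2, e1]
  simp only [AlternatingMap.smul_apply, smul_eq_mul] at h3 ⊢
  linear_combination -h3

end LieRinehart

section FoliatedModular

open Function RegularFoliation

variable {E : Type*} [NormedAddCommGroup E] [NormedSpace ℝ E] [FiniteDimensional ℝ E]
  {M : Type*} [TopologicalSpace M] [T2Space M] [ChartedSpace E M] [IsManifold 𝓘(ℝ, E) ∞ M] {k : ℕ}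
  {F : RegularFoliation E M k}

/-- Agreement of `η` and `θ` near `x` suffices, because the formula only differentiates values. This
matters since `P` is a sum of wedge products only locally. The map `ι` allows fields on `M` as well
as tangent sections as arguments. -/
theorem koszul_eq_ceDiff {S : Type*} {a : S → (M → ℝ) → M → ℝ} {b : S → S → S} (ι : F.sections → S)
    (ha : ∀ X, a (ι X) = act X.1) (hb : ∀ X Y, b (ι X) (ι Y) = ι ⁅X, Y⁆) {n : ℕ}
    {η : (Fin n → S) → M → ℝ} {θ : (Fin n → F.sections) → SmoothAlg E M} {x : M}
    (h : ∀ W : Fin n → F.sections, η (fun i => ι (W i)) =ᶠ[𝓝 x] θ W) (V : Fin (n + 1) → F.sections) :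
    koszul a b η (fun i => ι (V i)) x = ceDiff θ V x := by
  have hx : ∀ f : SmoothAlg E M, f x = (ContMDiffMap.evalRingHom x : SmoothAlg E M →+* ℝ) f :=
    fun _ => rfl
  have hu : ∀ i X, update (fun i => ι (V i)) i (ι X) = fun j => ι (update V i X j) := fun i X =>
    funext fun j => (apply_update (fun _ => ι) V i X j).symm
  rw [hx, koszul, ceDiff]
  simp only [map_add, map_sum, map_mul, map_pow, map_neg, map_one,
    apply_ite (ContMDiffMap.evalRingHom x : SmoothAlg E M →+* ℝ), map_zero, ha, hb, hu]
  congr 1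
  · refine Finset.sum_congr rfl fun i _ => ?_
    congr 1
    exact act_congr (h (i.removeNth V))
  · refine Finset.sum_congr rfl fun i _ => Finset.sum_congr rfl fun j _ => ?_
    refine if_congr Iff.rfl ?_ rfl
    congr 1
    exact (h (j.removeNth (update V i ⁅V i, V j⁆))).self_of_nhds

/-- Leaf-wise volume forms are closed. -/
theorem ceDiff_leafVolume (τ : F.sections [⋀^Fin k]→ₗ[SmoothAlg E M] SmoothAlg E M)
    (V : Fin (k + 1) → F.sections) : ceDiff τ V = 0 := by
  -- Once the differential is known to be a form, it is tensorial, and it has degree `k + 1` on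
  -- spaces of dimension `k`.
  obtain ⟨D, hD⟩ := exists_ceDiff k τ
  refine ContMDiffMap.ext fun x => ?_
  obtain ⟨θ, hθ⟩ := F.exists_pointForm D x
  rw [← hD, hθ]
  refine θ.map_linearDependent _ fun hl => ?_
  have := hl.fintype_card_le_finrank
  rw [F.finrank_tangent, Fintype.card_fin] at this
  omega

theorem alternating_sum_apply {V : Type*} [AddCommGroup V] [Module ℝ V] {n m : ℕ}
    (η : Fin m → V [⋀^Fin n]→ₗ[ℝ] ℝ) (v : Fin n → V) : (∑ i, η i) v = ∑ i, η i v := by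
  let B : V [⋀^Fin n]→ₗ[ℝ] ℝ →+ ℝ := AddMonoidHom.mk' (fun η => η v) fun _ _ => rfl
  exact map_sum B η Finset.univ

theorem contractTwo_wedgeVec {V : Type*} [AddCommGroup V] [Module ℝ V] {n : ℕ}
    (η : V [⋀^Fin (n + 2)]→ₗ[ℝ] ℝ) (X Y : V) (v : Fin n → V) :
    contractTwo η (wedgeVec X Y) v = η (Fin.cons Y (Fin.cons X v : Fin (n + 1) → V)) := by
  rw [contractTwo, bivectorLift_wedgeVec]
  rfl

theorem val_cons {n : ℕ} (X : F.sections) (Y : Fin n → F.sections) (x : M) :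
    (fun i => F.val ((Fin.cons X Y : Fin (n + 1) → F.sections) i) x)
      = Fin.cons (F.val X x) (fun i => F.val (Y i) x) := by
  funext i
  refine Fin.cases rfl (fun _ => rfl) i

namespace LeafPoisson

variable (P : LeafPoisson F)

theorem toFun_eq_zero_of_rank_one {F : RegularFoliation E M 1} (P : LeafPoisson F) (x : M) :
    P.toFun x = 0 := by
  obtain ⟨m, X, Y, h⟩ := P.smooth x
  rw [h.self_of_nhds]
  refine Finset.sum_eq_zero fun i _ => (exteriorPower.ιMulti ℝ 2).map_linearDependent _ fun hl => ?_
  have := hl.fintype_card_le_finrank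
  rw [F.finrank_tangent, Fintype.card_fin] at this
  omega

/-- In rank at least two, `ceDiff_curry_curry` is summed over a local decomposition of `P`. The
ranks zero and one are separate because `i_P τ` is zero there by convention. -/
theorem isFolModularField_of_modular {τ : F.FolForm k} (hτ : F.IsLeafVolume τ)
    {δ : F.sections →+ SmoothAlg E M} (hδ : IsDivergence δ)
    (hL : ∀ X, lieForm X (F.toAlt τ hτ.smooth) = δ X • F.toAlt τ hτ.smooth) {Z : F.sections}
    (hZ : ∀ f : SmoothAlg E M, ⁅Z, f⁆ = δ (P.ham f)) : P.IsFolModularField τ Z := by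
  intro W x
  match k, F, P, τ, hτ, δ, hδ, hL, Z, hZ, W with
  | 0, F, P, τ, hτ, δ, hδ, hL, Z, hZ, W => simp [folInsert, dInsert]
  | 1, F, P, τ, hτ, δ, hδ, hL, Z, hZ, W =>
    -- Bivectors on a line vanish, so both sides are zero.
    have hh : ∀ f, P.ham f = 0 := fun f => Subtype.ext (funext fun y => by
      refine (congrArg Subtype.val (P.val_ham f y)).trans ?_
      rw [toFun_eq_zero_of_rank_one]
      simp)
    have hZ0 : Z = 0 := sections_ext fun f => by rw [hZ, hh, map_zero, zero_lie]
    subst hZ0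
    change τ x _ = -0
    rw [neg_zero]
    exact (τ x).map_coord_zero 0 rfl
  | n + 2, F, P, τ, hτ, δ, hδ, hL, Z, hZ, W =>
    obtain ⟨m, X, Y, hXY⟩ := P.smooth x
    have hZx : F.val Z x = F.val (localModular δ X Y) x := Subtype.ext (vec_ext fun f hf => by
      have h1 := congrArg (fun g : SmoothAlg E M => g x) (hZ ⟨f, hf⟩)
      have h2 := congrArg (fun g : SmoothAlg E M => g x) (localModular_lie hδ X Y ⟨f, hf⟩)
      exact h1.trans ((hδ.congr (P.ham_eventuallyEq hXY ⟨f, hf⟩)).trans h2.symm))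
    set T := F.toAlt τ hτ.smooth with hT
    have hD : P.dInsert τ W x = ceDiff (fun U => ∑ i,
        T (Fin.cons (Y i) (Fin.cons (X i) U : Fin (n + 1) → F.sections))) W x := by
      refine koszul_eq_ceDiff (fun X => X) (fun _ => rfl) (fun _ _ => rfl) (fun U => ?_) W
      filter_upwards [hXY] with y hy
      have e : (∑ i, T (Fin.cons (Y i) (Fin.cons (X i) U : Fin (n + 1) → F.sections))) y
          = ∑ i, T (Fin.cons (Y i) (Fin.cons (X i) U : Fin (n + 1) → F.sections)) y :=
        map_sum (ContMDiffMap.evalRingHom y : SmoothAlg E M →+* ℝ) _ Finset.univ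
      rw [e, folEval, hy, map_sum, alternating_sum_apply]
      refine Finset.sum_congr rfl fun i _ => ?_
      rw [contractTwo_wedgeVec, hT, toAlt_apply, val_cons, val_cons]
    have hsum : ceDiff (fun U => ∑ i,
        T (Fin.cons (Y i) (Fin.cons (X i) U : Fin (n + 1) → F.sections))) W
        = -T (Fin.cons (localModular δ X Y) W) := by
      rw [ceDiff_sum]
      simp only [ceDiff_curry_curry (ceDiff_leafVolume T) hL]
      have := map_sum (T.toMultilinearMap.toLinearMap (Fin.cons 0 W) 0)
        (fun i => δ (Y i) • X i - δ (X i) • Y i - ⁅X i, Y i⁆) Finset.univ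
      simp only [MultilinearMap.toLinearMap_apply, Fin.update_cons_zero] at this
      rw [Finset.sum_neg_distrib]
      exact congrArg Neg.neg this.symm
    rw [hD, hsum]
    change τ x _ = - - T (Fin.cons (localModular δ X Y) W) x
    rw [neg_neg, hT, toAlt_apply, val_cons, val_cons, hZx]

/-- A nonzero top form is nondegenerate. In rank zero the defining equation says nothing, but the
tangent spaces are trivial. -/
theorem isFolModularField_unique {τ : F.FolForm k} (hτ : F.IsLeafVolume τ) {Z Z' : F.sections}
    (h : P.IsFolModularField τ Z) (h' : P.IsFolModularField τ Z') : Z = Z' := by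
  match k, F, P, τ, hτ, Z, Z', h, h' with
  | 0, F, P, τ, hτ, Z, Z', h, h' =>
    refine Subtype.ext (funext fun x => ?_)
    have := Module.finrank_zero_iff.mp (F.finrank_tangent x)
    exact congrArg Subtype.val (Subsingleton.elim (F.val Z x) (F.val Z' x))
  | n + 1, F, P, τ, hτ, Z, Z', h, h' =>
    refine Subtype.ext (funext fun x => ?_)
    suffices F.val (Z - Z') x = 0 from sub_eq_zero.mp (congrArg Subtype.val this)
    refine eq_zero_of_cons_eq_zero (F.finrank_tangent x) (hτ.ne_zero x) fun v => ?_
    obtain ⟨W, hW⟩ := F.exists_val_tuple x v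
    have e := (h W x).trans (h' W x).symm
    change τ x _ = τ x _ at e
    rw [val_cons, val_cons] at e
    simp only [hW] at e
    have hs := map_sub ((τ x).toMultilinearMap.toLinearMap (Fin.cons 0 v) 0) (F.val Z x) (F.val Z' x)
    simp only [MultilinearMap.toLinearMap_apply, Fin.update_cons_zero] at hs
    exact hs.trans (sub_eq_zero.mpr e)

end LeafPoisson

end FoliatedModular

/-! ## Forms on `M`, Reeb form and the divergence of the total volume form -/

section Total

open Function RegularFoliation

variable {E : Type*} [NormedAddCommGroup E] [NormedSpace ℝ E] [FiniteDimensional ℝ E]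
  {M : Type*} [TopologicalSpace M] [T2Space M] [ChartedSpace E M] [IsManifold 𝓘(ℝ, E) ∞ M] {k : ℕ}

namespace RegularFoliation

variable (F : RegularFoliation E M k) {n N : ℕ} (hN : Module.finrank ℝ E = N)

theorem exists_log (h : SmoothAlg E M) (hne : ∀ x, h x ≠ 0) :
    ∃ u : SmoothAlg E M, ∀ X : F.sections, ⁅X, h⁆ = h * ⁅X, u⁆ := by
  -- `Real.log` is `log |·|`, so the sign of `h` plays no role.
  refine ⟨⟨fun x => Real.log (h x), fun x => (Real.contDiffAt_log.mpr (hne x)).contMDiffAt.comp x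
    (h.contMDiff x)⟩, fun X => ContMDiffMap.ext fun x => ?_⟩
  have hl : HasDerivAt Real.log (h x)⁻¹ (h x) := Real.hasDerivAt_log (hne x)
  have hc := mfderiv_comp_apply x (I := 𝓘(ℝ, E)) (I' := 𝓘(ℝ, ℝ)) (I'' := 𝓘(ℝ, ℝ)) (g := Real.log)
    (f := h) hl.differentiableAt.mdifferentiableAt
    (h.contMDiff.mdifferentiable (by simp) x) (X.1 x)
  rw [mfderiv_eq_fderiv] at hc
  have hd : ∀ t : ℝ, fderiv ℝ Real.log (h x) t = (h x)⁻¹ * t := fun t => by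
    rw [hl.hasFDerivAt.fderiv]; simp [mul_comm]
  have h2 : act X.1 (fun x => Real.log (h x)) x = (h x)⁻¹ * act X.1 h x := hc.trans (hd _)
  change act X.1 h x = h x * act X.1 (fun x => Real.log (h x)) x
  rw [h2, mul_inv_cancel_left₀ (hne x)]

/-- Proportional nowhere vanishing forms have cohomologous divergences. -/
theorem exists_log_change {η η' : F.sections [⋀^Fin n]→ₗ[SmoothAlg E M] SmoothAlg E M}
    (hη' : ∀ x, ∃ Y, η' Y x ≠ 0) (h : ∀ x, ∃ c : ℝ, ∀ Y, η' Y x = c * η Y x)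
    (hη : ∀ x, ∃ Y, η Y x ≠ 0) :
    ∃ u : SmoothAlg E M, ∀ (X : F.sections) (c c' : SmoothAlg E M), lieForm X η = c • η →
      lieForm X η' = c' • η' → c' = c + ⁅X, u⁆ := by
  obtain ⟨f, rfl⟩ := F.exists_eq_smul hη h
  have hf : ∀ x, f x ≠ 0 := fun x h0 => by
    obtain ⟨Y, hY⟩ := hη' x
    refine hY ?_
    change f x * η Y x = 0
    rw [h0, zero_mul]
  obtain ⟨u, hu⟩ := F.exists_log f hf
  refine ⟨u, fun X c c' h1 h2 => F.smul_form_cancel hη' ?_⟩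
  rw [← h2, lieForm_smul, h1, hu]
  refine AlternatingMap.ext fun Y => ?_
  simp only [AlternatingMap.add_apply, AlternatingMap.smul_apply, smul_eq_mul]
  ring

/-- A smooth vector field as a section of the full foliation. -/
def ofField {X : VField E M} (hX : SmoothField X) : (full (M := M) hN).sections :=
  ⟨X, hX, fun _ => Submodule.mem_top⟩

/-- Tangent sections as vector fields. -/
noncomputable def toFull : F.sections →+ (full (M := M) hN).sections :=
  AddMonoidHom.mk' (fun X => ofField hN X.2.1) fun _ _ => rfl

theorem toFull_smul (f : SmoothAlg E M) (X : F.sections) :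
    F.toFull hN (f • X) = f • F.toFull hN X := rfl

theorem toFull_lie (X Y : F.sections) : F.toFull hN ⁅X, Y⁆ = ⁅F.toFull hN X, F.toFull hN Y⁆ := rfl

theorem toFull_lie_apply (X : F.sections) (f : SmoothAlg E M) : ⁅F.toFull hN X, f⁆ = ⁅X, f⁆ := rfl

/-- A form on `M` as a foliated form of the full foliation. -/
noncomputable def fullForm (η : Form E M n) : (full (M := M) hN).FolForm n :=
  fun x => (η x).compLinearMap ((full (M := M) hN).tangent x).subtype

theorem fullForm_smooth {η : Form E M n} (hη : SmoothForm η) (X : Fin n → (full (M := M) hN).sections) :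
    SmoothFun E ((full hN).folEval (fullForm hN η) X) := hη (fun i => (X i).1) fun i => (X i).2.1

/-- A smooth form on `M` as an alternating map on vector fields. -/
noncomputable def formAlt {η : Form E M n} (hη : SmoothForm η) :
    (full (M := M) hN).sections [⋀^Fin n]→ₗ[SmoothAlg E M] SmoothAlg E M :=
  (full hN).toAlt (fullForm hN η) (fullForm_smooth hN hη)

theorem formAlt_apply {η : Form E M n} (hη : SmoothForm η) (Y : Fin n → (full (M := M) hN).sections)
    (x : M) : formAlt hN hη Y x = η x (fun i => (Y i).1 x) := rfl

theorem fullForm_ne_zero {η : Form E M n} {x : M} (h : η x ≠ 0) : fullForm hN η x ≠ 0 := fun h0 => by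
  obtain ⟨v, hv⟩ := exists_ne_zero_apply h
  exact hv (congrArg (fun θ => θ (fun i => (⟨v i, Submodule.mem_top⟩ : (full (M := M) hN).tangent x)))
    h0)

theorem exists_formAlt_ne_zero {η : Form E M n} (hη : SmoothForm η) (h : ∀ x, η x ≠ 0) (x : M) :
    ∃ Y, formAlt hN hη Y x ≠ 0 :=
  (full hN).exists_toAlt_ne_zero _ (fun x => fullForm_ne_zero hN (h x)) x

theorem lieDeriv_eq {η : Form E M n} (hη : SmoothForm η) (X : (full (M := M) hN).sections)
    (Y : Fin n → (full (M := M) hN).sections) (x : M) :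
    lieDeriv X.1 η (fun i => (Y i).1) x = lieForm X (formAlt hN hη) Y x := by
  have h1 : (lieForm X (formAlt hN hη) Y) x = ⁅X, formAlt hN hη Y⁆ x
      - (∑ i, formAlt hN hη (update Y i ⁅X, Y i⁆)) x := rfl
  have h2 : (∑ i, formAlt hN hη (update Y i ⁅X, Y i⁆)) x
      = ∑ i, formAlt hN hη (update Y i ⁅X, Y i⁆) x :=
    map_sum (ContMDiffMap.evalRingHom x : SmoothAlg E M →+* ℝ) _ Finset.univ
  rw [h1, h2]
  refine congrArg₂ _ rfl (Finset.sum_congr rfl fun i _ => ?_)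
  rw [formAlt_apply]
  refine congrArg _ (funext fun j => ?_)
  exact (apply_update (fun _ (Z : (full (M := M) hN).sections) => Z.1 x) Y i
    ⁅X, Y i⁆ j).symm

/-! ### The Reeb form of a transversal volume element -/

section Reeb

variable {s : ℕ} {ς : Form E M s}

theorem IsTransverseVolume.smooth (hς : F.IsTransverseVolume ς) : SmoothForm ς := hς.2.1

theorem IsTransverseVolume.vanish (hς : F.IsTransverseVolume ς) :
    ∀ x, ∀ v : Fin s → TangentSpace 𝓘(ℝ, E) x, (∃ i, v i ∈ F.tangent x) → ς x v = 0 := hς.2.2.1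

theorem IsTransverseVolume.ne_zero (hς : F.IsTransverseVolume ς) : ∀ x, ς x ≠ 0 := hς.2.2.2

theorem formAlt_vanish (hς : F.IsTransverseVolume ς) (Y : Fin s → (full (M := M) hN).sections)
    (i : Fin s) (X : F.sections) (hi : Y i = F.toFull hN X) :
    formAlt hN (hς.smooth F) Y = 0 :=
  ContMDiffMap.ext fun x => hς.vanish F x _ ⟨i, by
    have h : (Y i).1 x = X.1 x := congrArg (fun Z : (full (M := M) hN).sections => Z.1 x) hi
    change (Y i).1 x ∈ _
    rw [h]
    exact X.2.2 x⟩

theorem exists_eq_smul_transverse (hς : F.IsTransverseVolume ς)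
    (Λ : (full (M := M) hN).sections [⋀^Fin s]→ₗ[SmoothAlg E M] SmoothAlg E M)
    (hΛ : ∀ (Y : Fin s → (full (M := M) hN).sections) (i : Fin s) (X : F.sections),
      Y i = F.toFull hN X → Λ Y = 0) (x : M) :
    ∃ c : ℝ, ∀ Y, Λ Y x = c * formAlt hN (hς.smooth F) Y x := by
  obtain ⟨θ, hθ⟩ := (full hN).exists_pointForm Λ x
  let U : Submodule ℝ ((full (M := M) hN).tangent x) :=
    (F.tangent x).comap ((full (M := M) hN).tangent x).subtype
  have hU : Module.finrank ℝ U = k := by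
    rw [← F.finrank_tangent x]
    exact (Submodule.comapSubtypeEquivOfLe (le_top : F.tangent x ≤ ⊤)).finrank_eq
  obtain ⟨c, hc⟩ := exists_eq_smul_of_vanish U (s := s) (ς := fullForm hN ς x)
    (by rw [hU, (full hN).finrank_tangent, hς.1, hN]) (fullForm_ne_zero hN (hς.ne_zero F x))
    (fun v ⟨i, hi⟩ => hς.vanish F x _ ⟨i, hi⟩) θ (fun v ⟨i, hi⟩ => by
      obtain ⟨Y, hY⟩ := (full hN).exists_val_tuple x v
      obtain ⟨X, hX⟩ := F.exists_val_eq x ⟨(v i).1, hi⟩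
      -- The tangent entry of `v` is extended by a section of `F`, since the hypothesis on `Λ`
      -- concerns tangent sections and not tangent vectors.
      have h1 : v = fun j => (full hN).val (update Y i (F.toFull hN X) j) x := by
        rw [val_update]
        funext j
        by_cases hj : j = i
        · subst hj
          rw [update_self]
          exact Subtype.ext (congrArg Subtype.val hX).symm
        · rw [update_of_ne hj, hY]
      rw [h1, ← hθ, hΛ _ i X (update_self _ _ _)]
      rfl)
  exact ⟨c, fun Y => by rw [hθ, hc]; rfl⟩

/-- The Reeb form of a transversal volume element. -/
theorem exists_reeb (hς : F.IsTransverseVolume ς) :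
    ∃ φ : F.sections →ₗ[SmoothAlg E M] SmoothAlg E M,
      (∀ X, lieForm (F.toFull hN X) (formAlt hN (hς.smooth F)) = φ X • formAlt hN (hς.smooth F)) ∧
      ∀ X Y, φ ⁅X, Y⁆ = ⁅X, φ Y⁆ - ⁅Y, φ X⁆ := by
  set η := formAlt hN (hς.smooth F) with hη
  have hne : ∀ x, ∃ Y, η Y x ≠ 0 := exists_formAlt_ne_zero hN (hς.smooth F) (hς.ne_zero F)
  have hvan := F.formAlt_vanish hN hς
  have hex : ∀ X : F.sections, ∃ c : SmoothAlg E M, lieForm (F.toFull hN X) η = c • η := by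
    intro X
    refine (full hN).exists_eq_smul hne (F.exists_eq_smul_transverse hN hς _ fun Y i Z hi => ?_)
    rw [lieForm_apply, hη, hvan Y i Z hi, lie_zero, zero_sub, neg_eq_zero]
    refine Finset.sum_eq_zero fun j _ => ?_
    -- The form `L_X ς` still kills tangent sections: the bracket `⁅X, Z⁆` is again tangent, by
    -- involutivity.
    by_cases hj : j = i
    · subst hj
      exact hvan _ j ⁅X, Z⁆ (by rw [update_self, hi]; rfl)
    · exact hvan _ i Z (by rw [update_of_ne (Ne.symm hj), hi])
  choose φ hφ using hex
  refine ⟨{ toFun := φ, map_add' := fun X Y => ?_, map_smul' := fun f X => ?_ }, hφ, fun X Y => ?_⟩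
  · refine (full hN).smul_form_cancel hne ?_
    rw [← hφ, map_add, lieForm_add_left, hφ, hφ, add_smul]
  · refine (full hN).smul_form_cancel hne (AlternatingMap.ext fun Y => ?_)
    have h2 := congrArg (fun Λ => Λ Y) (hφ X)
    -- The correction `df ∧ i_X ς` is zero, so `φ` is linear over functions, unlike a divergence.
    rw [← hφ, toFull_smul, lieForm_smul_left, Finset.sum_eq_zero]
    · simp only [AlternatingMap.smul_apply, smul_eq_mul] at h2
      simp only [AlternatingMap.smul_apply, smul_eq_mul, add_zero, RingHom.id_apply, h2, mul_assoc]
    · intro i _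
      rw [hη, hvan _ i X (update_self _ _ _), mul_zero]
  · refine (full hN).smul_form_cancel hne ?_
    change φ ⁅X, Y⁆ • η = (⁅X, φ Y⁆ - ⁅Y, φ X⁆) • η
    rw [← hφ, toFull_lie, lieForm_lie, hφ, hφ, lieForm_smul, lieForm_smul, hφ, hφ]
    refine AlternatingMap.ext fun W => ?_
    simp only [AlternatingMap.sub_apply, AlternatingMap.add_apply, AlternatingMap.smul_apply,
      smul_eq_mul, toFull_lie_apply]
    ring

end Reeb

/-- The restriction of a divergence on `M` to the tangent sections of a foliation. -/
theorem IsDivergence.restrict {δ : (full (M := M) hN).sections →+ SmoothAlg E M}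
    (hδ : IsDivergence δ) : IsDivergence (δ.comp (F.toFull hN)) :=
  ⟨fun f X => hδ.smul f (F.toFull hN X), fun X Y => hδ.lie (F.toFull hN X) (F.toFull hN Y)⟩

/-! ### Exterior products of transversal and leaf-wise volume forms -/

section TotalForm

variable {s : ℕ} {ς : Form E M s} {τ : F.FolForm k} {Ω : Form E M (s + k)}

/-- `Ω` is the exterior product of a transversal form with an extension of a foliated form. -/
def IsTotal (ς : Form E M s) (τ : F.FolForm k) (Ω : Form E M (s + k)) : Prop :=
  ∀ x (w : Fin s → TangentSpace 𝓘(ℝ, E) x) (e : Fin k → F.tangent x),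
    Ω x (Fin.append w (fun j => (e j).1)) = ς x w * τ x e

/-- No smoothness of `g` is needed: on tuples whose last `k` entries are tangent, only `g v = v`
enters. -/
theorem isTotal_wedge (hς : F.IsTransverseVolume ς)
    (g : Π x : M, TangentSpace 𝓘(ℝ, E) x →ₗ[ℝ] F.tangent x) (hg : ∀ x, ∀ v : F.tangent x, g x v = v) :
    F.IsTotal ς τ (fun x => wedgeForm (ς x) ((τ x).compLinearMap (g x))) := by
  intro x w e
  rw [wedgeForm_append _ _ (F.tangent x) (hς.vanish F x) _ _ fun j => (e j).2]
  refine congrArg _ ?_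
  rw [AlternatingMap.compLinearMap_apply]
  exact congrArg _ (funext fun j => hg x (e j))

theorem IsTotal.isVolumeForm (hΩ : F.IsTotal ς τ Ω) (hς : F.IsTransverseVolume ς)
    (hτ : F.IsLeafVolume τ) : IsVolumeForm Ω := by
  have hN : Module.finrank ℝ E = s + k := by rw [← hς.1, add_comm]
  have hne : ∀ x, Ω x ≠ 0 := fun x h0 => by
    obtain ⟨w, hw⟩ := exists_ne_zero_apply (hς.ne_zero F x)
    obtain ⟨e, he⟩ := exists_ne_zero_apply (hτ.ne_zero x)
    have := hΩ x w e
    rw [h0] at this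
    exact mul_ne_zero hw he this.symm
  refine ⟨hN.symm, fun Z hZ x => ?_, hne⟩
  -- Near `x` the form `Ω` is a multiple of a smooth reference form `β`. The factor is read off from
  -- one tuple adapted to the foliation, on which `Ω` is the smooth product `G`, so `Ω = (G / B Y)
  -- β`.
  obtain ⟨β, hβ, hβx⟩ := (full (M := M) hN).exists_local_volume x
  set B := (full (M := M) hN).toAlt β hβ with hB
  obtain ⟨w, hw⟩ := exists_ne_zero_apply (hς.ne_zero F x)
  obtain ⟨e, he⟩ := exists_ne_zero_apply (hτ.ne_zero x)
  choose W hW hWx using fun i => exists_smoothField x (w i)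
  obtain ⟨e', he'⟩ := F.exists_val_tuple x e
  set Y : Fin (s + k) → (full (M := M) hN).sections :=
    Fin.append (fun i => ofField hN (hW i)) (fun j => F.toFull hN (e' j)) with hY
  have hYv : ∀ y, fullForm hN Ω y (fun i => (full hN).val (Y i) y)
      = ς y (fun i => W i y) * F.toAlt τ hτ.smooth e' y := by
    intro y
    rw [toAlt_apply, ← hΩ]
    refine congrArg (Ω y) (funext fun i => ?_)
    refine Fin.addCases (fun i => ?_) (fun j => ?_) i
    · simp [hY]; rfl
    · simp [hY]; rfl
  set G : SmoothAlg E M := ⟨_, hς.smooth F W hW⟩ * F.toAlt τ hτ.smooth e' with hG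
  have hGx : G x ≠ 0 := by
    refine mul_ne_zero (a := ς x (fun i => W i x)) (by simpa only [hWx] using hw) ?_
    rw [toAlt_apply]
    simpa only [he'] using he
  have hBx : B Y x ≠ 0 := by
    obtain ⟨c, hc⟩ := exists_eq_smul_of_finrank_eq ((full (M := M) hN).finrank_tangent x) hβx
      (fullForm hN Ω x)
    intro h0
    refine hGx ((hYv x).symm.trans ?_)
    rw [hc, AlternatingMap.smul_apply]
    exact (congrArg (c • ·) h0).trans (smul_zero c)
  have hs : ContMDiffAt 𝓘(ℝ, E) 𝓘(ℝ, ℝ) ∞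
      (fun y => G y / B Y y * B (fun i => ofField hN (hZ i)) y) x :=
    ((G.contMDiff x).div₀ ((B Y).contMDiff x) hBx).mul ((B _).contMDiff x)
  refine hs.congr_of_eventuallyEq ?_
  filter_upwards [((B Y).contMDiff x).continuousAt.eventually_ne hBx] with y hy
  have hβy : β y ≠ 0 := fun h0 => hy (by rw [hB, toAlt_apply, h0]; rfl)
  obtain ⟨c, hc⟩ := exists_eq_smul_of_finrank_eq ((full (M := M) hN).finrank_tangent y) hβy
    (fullForm hN Ω y)
  have h1 : G y = c * B Y y := (hYv y).symm.trans (by rw [hc]; rfl)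
  have h2 : Ω y (fun i => Z i y) = c * B (fun i => ofField hN (hZ i)) y := by
    change fullForm hN Ω y (fun i => (full hN).val (ofField hN (hZ i)) y) = _
    rw [hc]; rfl
  rw [h1, h2, mul_div_cancel_right₀ _ hy]

theorem update_append_left {α : Type*} {p q : ℕ} (w : Fin p → α) (e : Fin q → α) (i : Fin p) (z : α) :
    update (Fin.append w e) (Fin.castAdd q i) z = Fin.append (update w i z) e := by
  funext j
  refine Fin.addCases (fun j => ?_) (fun j => ?_) j
  · by_cases h : j = i
    · subst h; simp
    · rw [update_of_ne (fun h' => h (Fin.castAdd_injective _ _ h')), Fin.append_left, Fin.append_left,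
        update_of_ne h]
  · rw [update_of_ne (by simp [Fin.ext_iff]; omega), Fin.append_right, Fin.append_right]

theorem update_append_right {α : Type*} {p q : ℕ} (w : Fin p → α) (e : Fin q → α) (i : Fin q) (z : α) :
    update (Fin.append w e) (Fin.natAdd p i) z = Fin.append w (update e i z) := by
  funext j
  refine Fin.addCases (fun j => ?_) (fun j => ?_) j
  · rw [update_of_ne (by simp [Fin.ext_iff]; omega), Fin.append_left, Fin.append_left]
  · by_cases h : j = i
    · subst h; simp
    · rw [update_of_ne (fun h' => h (Fin.natAdd_injective _ _ h')), Fin.append_right,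
        Fin.append_right, update_of_ne h]

/-- The divergence of the total form is the sum of the leaf-wise divergence and the Reeb form. -/
theorem IsTotal.divergence (hΩ : F.IsTotal ς τ Ω) (hς : F.IsTransverseVolume ς)
    (hτ : F.IsLeafVolume τ) (hs : SmoothForm Ω) (X : F.sections) {a b c : SmoothAlg E M}
    (ha : lieForm (F.toFull hN X) (formAlt hN hs) = a • formAlt hN hs)
    (hb : lieForm (F.toFull hN X) (formAlt hN (hς.smooth F)) = b • formAlt hN (hς.smooth F))
    (hc : lieForm X (F.toAlt τ hτ.smooth) = c • F.toAlt τ hτ.smooth) : a = c + b := by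
  set T := F.toAlt τ hτ.smooth with hT
  set η := formAlt hN (hς.smooth F) with hη
  -- Bracketing with `X` keeps the last `k` arguments tangent, so this product formula applies to
  -- every term of `L_X Ω` on such a tuple.
  have key : ∀ (W : Fin s → (full (M := M) hN).sections) (e : Fin k → F.sections),
      formAlt hN hs (Fin.append W (fun j => F.toFull hN (e j))) = η W * T e := by
    intro W e
    refine ContMDiffMap.ext fun y => ?_
    rw [formAlt_apply]
    refine Eq.trans (congrArg (Ω y) (funext fun i => ?_)) (hΩ y (fun i => (W i).1 y)
      (fun j => F.val (e j) y))
    refine Fin.addCases (fun i => ?_) (fun j => ?_) i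
    · simp
    · simp; rfl
  refine ContMDiffMap.ext fun x => ?_
  obtain ⟨W, hW⟩ := exists_formAlt_ne_zero hN (hς.smooth F) (hς.ne_zero F) x
  obtain ⟨e, he⟩ := F.exists_toAlt_ne_zero hτ.smooth hτ.ne_zero x
  have h1 := congrArg (fun Λ => Λ (Fin.append W (fun j => F.toFull hN (e j)))) ha
  have h2 := congrArg (fun Λ => Λ W) hb
  have h3 := congrArg (fun Λ => Λ e) hc
  simp only [AlternatingMap.smul_apply, smul_eq_mul, lieForm_apply, Fin.sum_univ_add,
    Fin.append_left, Fin.append_right, update_append_left, update_append_right, key] at h1 h2 h3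
  have e2 : ∀ i Z, update (fun j => F.toFull hN (e j)) i (F.toFull hN Z)
      = fun j => F.toFull hN (update e i Z j) := fun i Z =>
    funext fun j => (apply_update (fun _ => F.toFull hN) e i Z j).symm
  simp only [← toFull_lie, e2, key, ← Finset.sum_mul, ← Finset.mul_sum,
    LieRinehartRing.leibniz_mul_right, toFull_lie_apply, smul_eq_mul] at h1 h2 h3
  have h4 : a * (η W * T e) = (c + b) * (η W * T e) := by
    linear_combination -h1 + h2 * T e + η W * h3
  have h5 := congrArg (fun f : SmoothAlg E M => f x) h4
  exact mul_right_cancel₀ (mul_ne_zero hW he) h5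

end TotalForm

end RegularFoliation

end Total

/-! ## Modular classes and the Reeb class -/

section Classes

open Function RegularFoliation

variable {E : Type*} [NormedAddCommGroup E] [NormedSpace ℝ E] [FiniteDimensional ℝ E]
  {M : Type*} [TopologicalSpace M] [T2Space M] [ChartedSpace E M] [IsManifold 𝓘(ℝ, E) ∞ M] {k : ℕ}
  {F : RegularFoliation E M k} {n N s : ℕ} (hN : Module.finrank ℝ E = N)

theorem lieDeriv_toFull {η : Form E M n} (hη : SmoothForm η) (X : F.sections)
    {Y : Fin n → VField E M} (hY : ∀ i, SmoothField (Y i)) (x : M) :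
    lieDeriv X.1 η Y x = lieForm (F.toFull hN X) (formAlt hN hη) (fun i => ofField hN (hY i)) x :=
  lieDeriv_eq hN hη (F.toFull hN X) (fun i => ofField hN (hY i)) x

/-- A form with `L_X η = c η` on tuples of fields, versus on alternating maps. -/
theorem lieDeriv_eq_mul_iff {η : Form E M n} (hη : SmoothForm η) (hne : ∀ x, η x ≠ 0)
    (X : F.sections) {d : SmoothAlg E M}
    (hd : lieForm (F.toFull hN X) (formAlt hN hη) = d • formAlt hN hη) (c : M → ℝ) :
    (∀ Y : Fin n → VField E M, (∀ i, SmoothField (Y i)) → ∀ x,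
      lieDeriv X.1 η Y x = c x * formEval η Y x) ↔ c = d := by
  constructor
  · intro h
    funext x
    obtain ⟨Y, hY⟩ := exists_formAlt_ne_zero hN hη hne x
    have h1 := h (fun i => (Y i).1) (fun i => (Y i).2.1) x
    rw [lieDeriv_toFull hN hη X fun i => (Y i).2.1, hd] at h1
    exact (mul_right_cancel₀ hY h1).symm
  · rintro rfl Y hY x
    rw [lieDeriv_toFull hN hη X hY, hd]
    rfl

theorem isReebForm_iff {ς : Form E M s} (hς : F.IsTransverseVolume ς)
    {φ : F.sections →ₗ[SmoothAlg E M] SmoothAlg E M}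
    (hφ : ∀ X, lieForm (F.toFull hN X) (formAlt hN (hς.smooth F)) = φ X • formAlt hN (hς.smooth F))
    (μ : F.OneForm) : F.IsReebForm ς μ ↔ ∀ X, F.pair μ X = φ X :=
  forall_congr' fun X =>
    lieDeriv_eq_mul_iff hN (hς.smooth F) (hς.ne_zero F) X (hφ X) (F.pair μ X)

theorem mem_closedForms {φ : F.sections →ₗ[SmoothAlg E M] SmoothAlg E M}
    (hφ : ∀ X Y, φ ⁅X, Y⁆ = ⁅X, φ Y⁆ - ⁅Y, φ X⁆) {μ : F.OneForm} (hμ : ∀ X, F.pair μ X = φ X) :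
    μ ∈ F.closedForms := by
  refine ⟨fun X => by rw [hμ]; exact (φ X).contMDiff, fun X Y x => ?_⟩
  have h := congrArg (fun f : SmoothAlg E M => f x) (hφ X Y)
  rw [← lie_eq_bracket, hμ, hμ, hμ, sub_eq_zero]
  exact h.symm

/-- Existence of the Reeb form as a closed foliated one-form. -/
theorem exists_closed_reeb {ς : Form E M s} (hς : F.IsTransverseVolume ς) :
    ∃ μ : F.closedForms, F.IsReebForm ς μ.1 := by
  obtain ⟨φ, hφ, hc⟩ := F.exists_reeb rfl hς
  obtain ⟨μ, hμ⟩ := exists_oneForm φ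
  exact ⟨⟨μ, mem_closedForms hc hμ⟩, (isReebForm_iff rfl hς hφ μ).mpr hμ⟩

theorem isReebForm_unique {ς : Form E M s} (hς : F.IsTransverseVolume ς) {μ ν : F.OneForm}
    (h : F.IsReebForm ς μ) (h' : F.IsReebForm ς ν) : μ = ν := by
  obtain ⟨φ, hφ, -⟩ := F.exists_reeb rfl hς
  rw [isReebForm_iff rfl hς hφ] at h h'
  exact OneForm.ext_pair fun X => (h X).trans (h' X).symm

theorem folDif_pair (u : SmoothAlg E M) (X : F.sections) :
    F.pair (F.folDif u) X = (⁅X, u⁆ : SmoothAlg E M) := rfl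

/-- The two transversal volume elements differ by a nowhere zero function `h`, and the Reeb forms by
`d_F log |h|`. -/
theorem reebForm_sub_exact {ς ς' : Form E M s} (hς : F.IsTransverseVolume ς)
    (hς' : F.IsTransverseVolume ς') {μ ν : F.OneForm} (h : F.IsReebForm ς μ)
    (h' : F.IsReebForm ς' ν) : ν - μ ∈ F.exactForms := by
  obtain ⟨φ, hφ, -⟩ := F.exists_reeb rfl hς
  obtain ⟨φ', hφ', -⟩ := F.exists_reeb rfl hς'
  rw [isReebForm_iff rfl hς hφ] at h
  rw [isReebForm_iff rfl hς' hφ'] at h'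
  obtain ⟨u, hu⟩ := (full (M := M) (E := E) rfl).exists_log_change
    (exists_formAlt_ne_zero rfl (hς'.smooth F) (hς'.ne_zero F))
    (F.exists_eq_smul_transverse rfl hς _ (F.formAlt_vanish rfl hς'))
    (exists_formAlt_ne_zero rfl (hς.smooth F) (hς.ne_zero F))
  refine ⟨u, u.contMDiff, ?_⟩
  have : ν = F.folDif u + μ := OneForm.ext_pair fun X => by
    have e : F.pair (F.folDif u + μ) X = F.pair (F.folDif u) X + F.pair μ X := rfl
    rw [e, h', h, hu _ _ _ (hφ X) (hφ' X), folDif_pair, add_comm]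
    rfl
  rw [this, add_sub_cancel_right]

theorem existsUnique_reebClass (htor : F.TransversallyOrientable) :
    ∃! r : F.DeRhamH1, F.IsReebClass r := by
  obtain ⟨s, ς, hς⟩ := htor
  obtain ⟨μ, hμ⟩ := exists_closed_reeb hς
  refine ⟨Submodule.Quotient.mk μ, fun s' ς' hς' => ?_, fun r hr => ?_⟩
  · obtain rfl : s = s' := by have := hς.1; have := hς'.1; omega
    obtain ⟨ν, hν⟩ := exists_closed_reeb hς'
    exact ⟨ν, hν, ((Submodule.Quotient.eq _).mpr (reebForm_sub_exact hς' hς hν hμ))⟩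
  · obtain ⟨ν, hν, rfl⟩ := hr s ς hς
    rw [Subtype.ext (isReebForm_unique hς hν hμ)]

namespace LeafPoisson

variable (P : LeafPoisson F)

/-- A shift of the divergence by an exact form shifts the modular field by a Hamiltonian field. -/
theorem modular_sub_eq {δ δ' : F.sections → SmoothAlg E M} {u : SmoothAlg E M}
    (h : ∀ X, δ' X = δ X + ⁅X, u⁆) {Z Z' : F.sections} (hZ : ∀ f : SmoothAlg E M, ⁅Z, f⁆ = δ (P.ham f))
    (hZ' : ∀ f : SmoothAlg E M, ⁅Z', f⁆ = δ' (P.ham f)) : Z - Z' = P.ham u :=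
  sections_ext fun f => by
    rw [sub_lie, hZ, hZ', h, P.ham_skew]
    ring

theorem ham_mem_Ham (u : SmoothAlg E M) : (P.ham u).1 ∈ Ham P.onM := ⟨u, u.contMDiff, rfl⟩

/-! ### The modular class of the Poisson foliation -/

section FolModular

variable {τ τ' : F.FolForm k}

theorem exists_folModularField (hτ : F.IsLeafVolume τ) :
    ∃ (δ : F.sections →+ SmoothAlg E M) (Z : F.sections), IsDivergence δ ∧
      (∀ X, lieForm X (F.toAlt τ hτ.smooth) = δ X • F.toAlt τ hτ.smooth) ∧
      (∀ f : SmoothAlg E M, ⁅Z, f⁆ = δ (P.ham f)) ∧ P.IsFolModularField τ Z := by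
  obtain ⟨δ, hδ, hL⟩ := exists_divergence hτ
  obtain ⟨Z, hZ⟩ := P.exists_modular hδ
  exact ⟨δ, Z, hδ, hL, hZ, P.isFolModularField_of_modular hτ hδ hL hZ⟩

theorem existsUnique_folModularField (hτ : F.IsLeafVolume τ) :
    ∃! Z : F.sections, P.IsFolModularField τ Z := by
  obtain ⟨δ, Z, -, -, -, hZ⟩ := P.exists_folModularField hτ
  exact ⟨Z, hZ, fun Z' hZ' => P.isFolModularField_unique hτ hZ' hZ⟩

theorem existsUnique_folModularClass (hor : F.Orientable) : ∃! c : P.FolH1, P.IsFolModularClass c := by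
  obtain ⟨τ, hτ⟩ := hor
  obtain ⟨δ, Z, hδ, hL, hZ, hZτ⟩ := P.exists_folModularField hτ
  refine ⟨Submodule.Quotient.mk ⟨Z.1, P.modular_mem hδ hZ⟩, fun τ' hτ' => ?_, fun c hc => ?_⟩
  · obtain ⟨δ', Z', hδ', hL', hZ', hZτ'⟩ := P.exists_folModularField hτ'
    refine ⟨⟨Z'.1, P.modular_mem hδ' hZ'⟩, hZτ', (Submodule.Quotient.eq _).mpr ?_⟩
    obtain ⟨u, hu⟩ := F.exists_log_change (F.exists_toAlt_ne_zero hτ'.smooth hτ'.ne_zero)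
      (η := F.toAlt τ hτ.smooth) (fun x => by
        obtain ⟨c, hc⟩ := exists_eq_smul_of_finrank_eq (F.finrank_tangent x) (hτ.ne_zero x) (τ' x)
        exact ⟨c, fun Y => by rw [toAlt_apply, hc]; rfl⟩)
      (F.exists_toAlt_ne_zero hτ.smooth hτ.ne_zero)
    have h := P.modular_sub_eq (fun X => hu X _ _ (hL X) (hL' X)) hZ hZ'
    change (Z - Z').1 ∈ Ham P.onM
    rw [h]
    exact P.ham_mem_Ham u
  · obtain ⟨Z', hZ', rfl⟩ := hc τ hτ
    have := P.isFolModularField_unique hτ hZ' hZτ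
    congr 1
    exact Subtype.ext (congrArg (fun Z : F.sections => Z.1) this)

end FolModular

/-! ### The modular class of the Poisson manifold -/

section Modular

variable {Ω Ω' : Form E M n}

theorem exists_volume_divergence (hΩ : IsVolumeForm Ω) :
    ∃ δ : (full (M := M) hΩ.1.symm).sections →+ SmoothAlg E M, IsDivergence δ ∧
      ∀ X, lieForm X (formAlt hΩ.1.symm hΩ.2.1) = δ X • formAlt hΩ.1.symm hΩ.2.1 :=
  exists_divergence (F := full hΩ.1.symm)
    ⟨fullForm_smooth hΩ.1.symm hΩ.2.1, fun x => fullForm_ne_zero hΩ.1.symm (hΩ.2.2 x)⟩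

theorem isModularField_iff (hΩ : IsVolumeForm Ω)
    {δ : (full (M := M) hΩ.1.symm).sections →+ SmoothAlg E M}
    (hL : ∀ X, lieForm X (formAlt hΩ.1.symm hΩ.2.1) = δ X • formAlt hΩ.1.symm hΩ.2.1) (Z : VField E M) :
    IsModularField P.onM Ω Z ↔ SmoothField Z ∧
      ∀ f : SmoothAlg E M, act Z f = δ (F.toFull hΩ.1.symm (P.ham f)) := by
  refine and_congr_right fun hZ => ⟨fun h f => ?_, fun h f hf => ?_⟩
  · exact (lieDeriv_eq_mul_iff hΩ.1.symm hΩ.2.1 hΩ.2.2 (P.ham f) (hL _) _).mp (h f f.contMDiff)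
  · exact (lieDeriv_eq_mul_iff hΩ.1.symm hΩ.2.1 hΩ.2.2 (P.ham ⟨f, hf⟩) (hL _) _).mpr (h ⟨f, hf⟩)

theorem isModularField_unique (hΩ : IsVolumeForm Ω) {Z Z' : VField E M}
    (h : IsModularField P.onM Ω Z) (h' : IsModularField P.onM Ω Z') : Z = Z' := by
  obtain ⟨δ, -, hL⟩ := exists_volume_divergence hΩ
  rw [P.isModularField_iff hΩ hL] at h h'
  exact funext fun x => vec_ext fun f hf =>
    congrFun ((h.2 ⟨f, hf⟩).trans (h'.2 ⟨f, hf⟩).symm) x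

/-- Hamiltonian fields are tangent, so only the restricted divergence matters, and the field is
found among the tangent sections. -/
theorem exists_modularField (hΩ : IsVolumeForm Ω) :
    ∃ (δ : (full (M := M) hΩ.1.symm).sections →+ SmoothAlg E M) (Z : F.sections), IsDivergence δ ∧
      (∀ X, lieForm X (formAlt hΩ.1.symm hΩ.2.1) = δ X • formAlt hΩ.1.symm hΩ.2.1) ∧
      (∀ f : SmoothAlg E M, ⁅Z, f⁆ = δ (F.toFull hΩ.1.symm (P.ham f))) ∧
      IsModularField P.onM Ω Z.1 ∧ Z.1 ∈ Poiss P.onM := by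
  obtain ⟨δ, hδ, hL⟩ := exists_volume_divergence hΩ
  obtain ⟨Z, hZ⟩ := P.exists_modular (hδ.restrict F hΩ.1.symm)
  refine ⟨δ, Z, hδ, hL, hZ, (P.isModularField_iff hΩ hL _).mpr ⟨Z.2.1, fun f => ?_⟩,
    (P.modular_mem (hδ.restrict F hΩ.1.symm) hZ).2⟩
  exact congrArg (fun g : SmoothAlg E M => (g : M → ℝ)) (hZ f)

theorem existsUnique_modularField (hΩ : IsVolumeForm Ω) :
    ∃! Z : VField E M, IsModularField P.onM Ω Z := by
  obtain ⟨_, Z, -, -, -, hZ, -⟩ := P.exists_modularField hΩ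
  exact ⟨Z.1, hZ, fun Z' hZ' => P.isModularField_unique hΩ hZ' hZ⟩

theorem modularField_sub_mem (hΩ : IsVolumeForm Ω) (hΩ' : IsVolumeForm Ω') {Z Z' : VField E M}
    (h : IsModularField P.onM Ω Z) (h' : IsModularField P.onM Ω' Z') : Z - Z' ∈ Ham P.onM := by
  obtain ⟨δ, W, -, hL, hW, hZW, -⟩ := P.exists_modularField hΩ
  obtain ⟨δ', W', -, hL', hW', hZW', -⟩ := P.exists_modularField hΩ'
  rw [P.isModularField_unique hΩ h hZW, P.isModularField_unique hΩ' h' hZW']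
  have hN := hΩ.1.symm
  obtain ⟨u, hu⟩ := (full (M := M) hN).exists_log_change
    (exists_formAlt_ne_zero hN hΩ'.2.1 hΩ'.2.2) (η := formAlt hN hΩ.2.1) (fun x => by
      obtain ⟨c, hc⟩ := exists_eq_smul_of_finrank_eq ((full (M := M) hN).finrank_tangent x)
        (fullForm_ne_zero hN (hΩ.2.2 x)) (fullForm hN Ω' x)
      exact ⟨c, fun Y => DFunLike.congr_fun hc (fun i => (full hN).val (Y i) x)⟩)
    (exists_formAlt_ne_zero hN hΩ.2.1 hΩ.2.2)
  have h := P.modular_sub_eq (fun X => hu (F.toFull hN X) _ _ (hL _) (hL' _)) hW hW'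
  have h1 := congrArg Subtype.val h
  change W.1 - W'.1 = _ at h1
  exact h1 ▸ P.ham_mem_Ham u

theorem existsUnique_modularClass (hΩ : IsVolumeForm Ω) :
    ∃! c : PoissonH1 P.onM, IsModularClass P.onM c := by
  -- `IsModularClass` fixes the degree to be `finrank ℝ E`; substitution brings `Ω` to this type.
  obtain ⟨rfl, hΩ₂⟩ := id hΩ
  obtain ⟨_, Z, -, -, -, hZ, hmem⟩ := P.exists_modularField hΩ
  refine ⟨Submodule.Quotient.mk ⟨Z.1, hmem⟩, fun Ω' hΩ' => ?_, fun c hc => ?_⟩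
  · obtain ⟨_, Z', -, -, -, hZ', hmem'⟩ := P.exists_modularField hΩ'
    exact ⟨⟨Z'.1, hmem'⟩, hZ', (Submodule.Quotient.eq _).mpr (P.modularField_sub_mem hΩ hΩ' hZ hZ')⟩
  · obtain ⟨Z', hZ', rfl⟩ := hc Ω hΩ
    congr 1
    exact Subtype.ext (P.isModularField_unique hΩ hZ' hZ)

theorem exists_of_isModularClass {c : PoissonH1 P.onM} (hc : IsModularClass P.onM c)
    (hΩ : IsVolumeForm Ω) :
    ∃ Z : Poiss P.onM, IsModularField P.onM Ω Z.1 ∧ c = Submodule.Quotient.mk Z := by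
  obtain ⟨rfl, hΩ₂⟩ := id hΩ
  exact hc Ω hΩ

end Modular

/-- The relation between the modular vector fields and the Reeb form. -/
theorem modularField_total {ς : Form E M s} {τ : F.FolForm k} {Ω : Form E M (s + k)}
    (hς : F.IsTransverseVolume ς) (hτ : F.IsLeafVolume τ) (hT : F.IsTotal ς τ Ω) {Z : VField E M}
    {W : F.sections} {μ : F.OneForm} (hZ : IsModularField P.onM Ω Z) (hW : P.IsFolModularField τ W)
    (hμ : F.IsReebForm ς μ) : Z = W.1 - P.sharpFol μ := by
  have hΩ := hT.isVolumeForm F hς hτ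
  have hN := hΩ.1.symm
  obtain ⟨δ, Z', -, hL, hZ', hm, -⟩ := P.exists_modularField hΩ
  obtain ⟨δ', W', -, hL', hW', hm'⟩ := P.exists_folModularField hτ
  obtain ⟨φ, hφ, -⟩ := F.exists_reeb hN hς
  rw [isReebForm_iff hN hς hφ] at hμ
  have hs : ∀ X, SmoothFun E (F.pair μ X) := fun X => by rw [hμ]; exact (φ X).contMDiff
  rw [P.isModularField_unique hΩ hZ hm, P.isFolModularField_unique hτ hW hm']
  -- Tested on functions: `δ_Ω = δ_τ + λ` at `P^♯ df`, with `pair_ham` turning `λ(P^♯ df)` into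
  -- `-(P^♯ λ)(f)`.
  have key : Z' = W' - ⟨P.sharpFol μ, P.sharpFol_mem hs⟩ := sections_ext fun f => by
    rw [sub_lie, P.pair_ham hs, hZ', hW',
      hT.divergence F hN hς hτ hΩ.2.1 (P.ham f) (hL _) (hφ _) (hL' _), sub_neg_eq_add]
    congr 1
    exact ContMDiffMap.ext fun x => (congrFun (hμ (P.ham f)) x).symm
  exact congrArg Subtype.val key

end LeafPoisson

end Classes

/-! ## The Reeb one-form of a connection -/

section Connection

open Function RegularFoliation

variable {E : Type*} [NormedAddCommGroup E] [NormedSpace ℝ E] [FiniteDimensional ℝ E]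
  {M : Type*} [TopologicalSpace M] [T2Space M] [ChartedSpace E M] [IsManifold 𝓘(ℝ, E) ∞ M] {k : ℕ}
  {F : RegularFoliation E M k} {s N : ℕ}

theorem apply_eq_of_sub_mem {V : Type*} [AddCommGroup V] [Module ℝ V] (U : Submodule ℝ V)
    {ς : V [⋀^Fin s]→ₗ[ℝ] ℝ} (h : ∀ v : Fin s → V, (∃ i, v i ∈ U) → ς v = 0) {v w : Fin s → V}
    (hvw : ∀ i, v i - w i ∈ U) : ς v = ς w := by
  obtain ⟨θ, hθ⟩ := exists_descent U.mkQ U.mkQ_surjective ς fun v i hi => h v ⟨i, by simpa using hi⟩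
  rw [hθ, hθ]
  exact congrArg θ (funext fun i => (Submodule.Quotient.eq U).mpr (hvw i))

/-- Cartan's formula with `i_X ς = 0`. Degree zero is separate because there is nothing to contract.
-/
theorem ceDiff_cons_toFull (hN : Module.finrank ℝ E = N) {ς : Form E M s}
    (hς : F.IsTransverseVolume ς) {φ : F.sections →ₗ[SmoothAlg E M] SmoothAlg E M}
    (hφ : ∀ X, lieForm (F.toFull hN X) (formAlt hN (hς.smooth F)) = φ X • formAlt hN (hς.smooth F))
    (X : F.sections) (R : Fin s → (full (M := M) hN).sections) :
    ceDiff (formAlt hN (hς.smooth F)) (Fin.cons (F.toFull hN X) R)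
      = φ X * formAlt hN (hς.smooth F) R := by
  have h := congrArg (fun Λ => Λ R) (hφ X)
  simp only [AlternatingMap.smul_apply, smul_eq_mul] at h
  rw [← h]
  cases s with
  | zero =>
    rw [ceDiff_zero, lieForm_apply]
    simp [Subsingleton.elim R ![]]
  | succ m =>
    have h0 : (formAlt hN (hς.smooth F)).curryLeft (F.toFull hN X) = 0 :=
      AlternatingMap.ext fun W => F.formAlt_vanish hN hς _ 0 X rfl
    rw [ceDiff_cons, h0]
    simp [ceDiff]

namespace ConnectionForm

variable (γ : ConnectionForm F)

/-- The vertical part of a vector field as a tangent section. -/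
noncomputable def vertSec {X : VField E M} (hX : SmoothField X) : F.sections :=
  ⟨γ.vert X, γ.smooth X hX, fun x => (γ.toFun x (X x)).2⟩

/-- Exactly one slot `p` is vertical. Moving it to the front costs `(-1)^p`, Cartan's formula then
gives `λ` times `ς`, and `ς` does not see the vertical parts removed from the other arguments. -/
theorem component_one_extD {ς : Form E M s} (hς : F.IsTransverseVolume ς)
    {φ : F.sections →ₗ[SmoothAlg E M] SmoothAlg E M}
    (hφ : ∀ X, lieForm (F.toFull rfl X) (formAlt rfl (hς.smooth F)) = φ X • formAlt rfl (hς.smooth F))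
    {X : Fin (s + 1) → VField E M} (hX : ∀ i, SmoothField (X i)) (x : M) :
    γ.component 1 (extD ς) X x = ∑ p : Fin (s + 1),
      (-1 : ℝ) ^ (p : ℕ) * φ (γ.vertSec (hX p)) x * formEval ς (p.removeNth X) x := by
  rw [component, Finset.powersetCard_one, Finset.sum_map]
  refine Finset.sum_congr rfl fun p _ => ?_
  set W : Fin (s + 1) → (full (M := M) (E := E) rfl).sections := fun i =>
    if i = p then F.toFull rfl (γ.vertSec (hX i))
    else ofField rfl (hX i) - F.toFull rfl (γ.vertSec (hX i)) with hW
  have hWX : (fun i => if i ∈ ({p} : Finset (Fin (s + 1))) then γ.vert (X i)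
      else X i - γ.vert (X i)) = fun i => (W i).1 := by
    funext i
    by_cases h : i = p
    · simp [hW, h]; rfl
    · simp [hW, h]; rfl
  set η := formAlt (rfl : Module.finrank ℝ E = _) (hς.smooth F) with hη
  have h1 : extD ς (fun i => (W i).1) x = ceDiff η W x :=
    koszul_eq_ceDiff (F := full (M := M) (E := E) rfl) (fun X => X.1) (fun _ => rfl)
      (fun _ _ => rfl) (fun _ => Filter.EventuallyEq.rfl) W
  obtain ⟨D, hD⟩ := exists_ceDiff s η
  have h2 : ceDiff η W = (-1) ^ (p : ℕ) * (φ (γ.vertSec (hX p)) * η (p.removeNth W)) := by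
    have h3 := cons_removeNth_apply D (W p) p W
    rw [update_eq_self, hD, hD] at h3
    have h4 : W p = F.toFull rfl (γ.vertSec (hX p)) := by simp [hW]
    rw [h4, ceDiff_cons_toFull rfl hς hφ] at h3
    rw [h3, ← mul_assoc, ← mul_pow]
    simp
  have h5 : η (p.removeNth W) x = formEval ς (p.removeNth X) x := by
    rw [hη, formAlt_apply]
    refine apply_eq_of_sub_mem (F.tangent x) (hς.vanish F x) fun i => ?_
    have : W (p.succAbove i) = ofField rfl (hX (p.succAbove i))
        - F.toFull rfl (γ.vertSec (hX (p.succAbove i))) := by simp [hW]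
    simp only [Fin.removeNth, this]
    change X _ x - γ.vert (X _) x - X _ x ∈ _
    rw [sub_sub_cancel_left]
    exact (F.tangent x).neg_mem (γ.toFun x _).2
  have hp : ((-1 : SmoothAlg E M) ^ (p : ℕ)) x = (-1 : ℝ) ^ (p : ℕ) := by
    have := map_pow (ContMDiffMap.evalRingHom x : SmoothAlg E M →+* ℝ) (-1) (p : ℕ)
    rw [map_neg, map_one] at this
    exact this
  change extD ς (fun i => if i ∈ ({p} : Finset (Fin (s + 1))) then γ.vert (X i)
      else X i - γ.vert (X i)) x = _
  rw [hWX, h1, h2, ← h5, mul_assoc]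
  change ((-1 : SmoothAlg E M) ^ (p : ℕ)) x * _ = _
  rw [hp]
  rfl

/-- The extension of a foliated one-form by zero on the normal bundle. -/
noncomputable def extendOne (μ : F.OneForm) (x : M) : Module.Dual ℝ (TangentSpace 𝓘(ℝ, E) x) :=
  (μ x).comp (γ.toFun x)

/-- On the leaves the defining equation forces the Reeb form, and vanishing on `ker γ` fixes the
rest. -/
theorem isReebOneForm_iff {ς : Form E M s} (hς : F.IsTransverseVolume ς) {μ : F.OneForm}
    (hμ : F.IsReebForm ς μ) (ν : Π x : M, Module.Dual ℝ (TangentSpace 𝓘(ℝ, E) x)) :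
    γ.IsReebOneForm ς ν ↔ ν = γ.extendOne μ := by
  obtain ⟨φ, hφ, -⟩ := F.exists_reeb rfl hς
  rw [isReebForm_iff rfl hς hφ] at hμ
  have hμX : ∀ {X : VField E M} (hX : SmoothField X) (x : M),
      γ.extendOne μ x (X x) = φ (γ.vertSec hX) x := fun hX x =>
    congrFun (hμ (γ.vertSec hX)) x
  constructor
  · rintro ⟨-, hker, h⟩
    have hV : ∀ x (v : F.tangent x), ν x v = μ x v := by
      intro x v
      obtain ⟨X₀, rfl⟩ := F.exists_val_eq x v
      obtain ⟨w, hw⟩ := exists_ne_zero_apply (hς.ne_zero F x)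
      choose Y hY hYx using fun i => exists_smoothField x (w i)
      -- One tangent section in front of fields on which `ς` is nonzero at `x`: every term but the
      -- first then inserts a tangent vector into `ς`.
      let X : Fin (s + 1) → VField E M := Fin.cons X₀.1 Y
      have hX : ∀ i, SmoothField (X i) := fun i => Fin.cases X₀.2.1 hY i
      have h1 := h X hX x
      rw [γ.component_one_extD hς hφ hX, Fin.sum_univ_succ, Fin.sum_univ_succ] at h1
      have h0 : ∀ i : Fin s, formEval ς (i.succ.removeNth X) x = 0 := by
        intro i
        cases s with
        | zero => exact i.elim0
        | succ m =>
          refine hς.vanish F x _ ⟨0, ?_⟩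
          rw [removeNth_succ_cons]
          exact X₀.2.2 x
      simp only [h0, mul_zero, Finset.sum_const_zero, add_zero] at h1
      have h2 : formEval ς (Fin.removeNth 0 X) x ≠ 0 := by
        change ς x (fun i => Y i x) ≠ 0
        simpa only [hYx] using hw
      have h3 := mul_right_cancel₀ h2 h1
      rw [Fin.val_zero, pow_zero, one_mul, one_mul, ← hμX] at h3
      refine h3.symm.trans ?_
      change μ x (γ.toFun x (X₀.1 x)) = _
      exact congrArg _ (γ.proj x (F.val X₀ x))
    refine funext fun x => LinearMap.ext fun v => ?_
    have h1 : ν x (v - (γ.toFun x v : TangentSpace 𝓘(ℝ, E) x)) = 0 :=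
      hker x _ (by rw [map_sub, γ.proj, sub_self])
    rw [map_sub, sub_eq_zero, hV] at h1
    exact h1
  · rintro rfl
    refine ⟨fun X hX => ?_, fun x v hv => ?_, fun X hX x => ?_⟩
    · have : (fun x => γ.extendOne μ x (X x)) = φ (γ.vertSec hX) := funext fun x => hμX hX x
      rw [this]
      exact (φ _).contMDiff
    · rw [extendOne, LinearMap.comp_apply, hv, map_zero]
    · rw [γ.component_one_extD hς hφ hX]
      exact Finset.sum_congr rfl fun p _ => by rw [hμX (hX p)]

theorem sharp_extendOne (P : LeafPoisson F) (μ : F.OneForm) (x : M) :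
    sharp (P.onM x) (γ.extendOne μ x) = P.sharpFol μ x := by
  have h : (γ.extendOne μ x).comp (F.tangent x).subtype = μ x :=
    LinearMap.ext fun v => congrArg (μ x) (γ.proj x v)
  rw [LeafPoisson.onM, LeafPoisson.sharp_map, h]
  rfl

end ConnectionForm

end Connection

end FoliatedPoisson

/-! ### Assembly of the proposition -/

theorem proposition3p1
    {E : Type*} [NormedAddCommGroup E] [NormedSpace ℝ E] [FiniteDimensional ℝ E]
    {M : Type*} [TopologicalSpace M] [T2Space M] [SecondCountableTopology M]
    [ChartedSpace E M] [IsManifold 𝓘(ℝ, E) ∞ M]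
    {k : ℕ} (F : RegularFoliation E M k) (P : LeafPoisson F)
    (hor : F.Orientable) (htor : F.TransversallyOrientable) :
    -- the three classes are well defined
    (∃! c : PoissonH1 P.onM, IsModularClass P.onM c) ∧
    (∃! c : P.FolH1, P.IsFolModularClass c) ∧
    (∃! r : F.DeRhamH1, F.IsReebClass r) ∧
    -- the relation between them
    (∀ (c : PoissonH1 P.onM) (cF : P.FolH1) (r : F.DeRhamH1),
      IsModularClass P.onM c → P.IsFolModularClass cF → F.IsReebClass r →
        c = P.incl cF - P.incl (P.sharpStar r)) ∧
    -- the relation between the vector fields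
    (∀ (γ : ConnectionForm F) (τ : F.FolForm k) (s : ℕ) (ς : Form E M s),
      F.IsLeafVolume τ → F.IsTransverseVolume ς →
        IsVolumeForm (γ.totalForm ς τ) ∧
        (∃! Z : VField E M, IsModularField P.onM (γ.totalForm ς τ) Z) ∧
        (∃! Z : F.sections, P.IsFolModularField τ Z) ∧
        (∃! μ : Π x : M, Module.Dual ℝ (TangentSpace 𝓘(ℝ, E) x), γ.IsReebOneForm ς μ) ∧
        ∀ (ZΩ : VField E M) (Zτ : F.sections)
          (μ : Π x : M, Module.Dual ℝ (TangentSpace 𝓘(ℝ, E) x)),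
          IsModularField P.onM (γ.totalForm ς τ) ZΩ → P.IsFolModularField τ Zτ →
          γ.IsReebOneForm ς μ →
            ∀ x, ZΩ x = Zτ.1 x - sharp (P.onM x) (μ x)) := by
  obtain ⟨τ₀, hτ₀⟩ := hor
  obtain ⟨s₀, ς₀, hς₀⟩ := htor
  -- Pointwise projections, possibly not smooth in `x`, already give a smooth volume form `ς₀ ∧ (τ₀
  -- ∘ g)`, so the class relation needs no connection form.
  have hg : ∀ x : M, ∃ g : TangentSpace 𝓘(ℝ, E) x →ₗ[ℝ] F.tangent x, ∀ v : F.tangent x, g v = v :=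
    fun x => by
      obtain ⟨g, hg⟩ := (F.tangent x).subtype.exists_leftInverse_of_injective
        (LinearMap.ker_eq_bot.mpr Subtype.val_injective)
      exact ⟨g, fun v => LinearMap.congr_fun hg v⟩
  choose g hg using hg
  have hT := F.isTotal_wedge (τ := τ₀) hς₀ g hg
  have hΩ := hT.isVolumeForm F hς₀ hτ₀
  refine ⟨P.existsUnique_modularClass hΩ, P.existsUnique_folModularClass ⟨τ₀, hτ₀⟩,
    existsUnique_reebClass ⟨s₀, ς₀, hς₀⟩, fun c cF r hc hcF hr => ?_, fun γ τ s ς hτ hς => ?_⟩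
  · obtain ⟨Z, hZ, rfl⟩ := P.exists_of_isModularClass hc hΩ
    obtain ⟨W, hW, rfl⟩ := hcF τ₀ hτ₀
    obtain ⟨μ, hμ, rfl⟩ := hr s₀ ς₀ hς₀
    have h := P.modularField_total hς₀ hτ₀ hT hZ hW hμ
    have hZ' : Z = Submodule.inclusion inf_le_right W
        - Submodule.inclusion inf_le_right (P.sharpClosed μ) := Subtype.ext h
    rw [hZ', Submodule.Quotient.mk_sub]
    rfl
  · have hT' : F.IsTotal ς τ (γ.totalForm ς τ) := F.isTotal_wedge hς γ.toFun γ.proj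
    have hΩ' := hT'.isVolumeForm F hς hτ
    obtain ⟨μ, hμ⟩ := exists_closed_reeb hς
    refine ⟨hΩ', P.existsUnique_modularField hΩ', P.existsUnique_folModularField hτ,
      ⟨γ.extendOne μ.1, (γ.isReebOneForm_iff hς hμ _).mpr rfl,
        fun ν hν => (γ.isReebOneForm_iff hς hμ ν).mp hν⟩, fun ZΩ Zτ ν hZΩ hZτ hν x => ?_⟩
    rw [(γ.isReebOneForm_iff hς hμ ν).mp hν, γ.sharp_extendOne,
      P.modularField_total hς hτ hT' hZΩ hZτ hμ]
    rfl
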